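/- Let $M$ be a smooth finite-dimensional manifold with a smooth, free and proper left action $\psi_g$ of a Lie group $G$ with Lie algebra $\mathfrak g$. Let $G$ act on $\tau:TM\to M$ by $T\psi_g$ (written $g\cdot v$), and let $\pi:TM\to TM/G$ be the projection. For $\xi\in\mathfrak g$ let $\tilde\xi$ be the fundamental vector field on $M$, with flow $m\mapsto\psi_{\exp(t\xi)}m$. Let $L:TM\to\mathbb R$ be a smooth $G$-invariant function. For $u\in T_mM$ let $g_u$ be its fibre Hessian, the symmetric bilinear form on $T_mM$ given in coordinates $(x^\alpha,u^\alpha)$ by $\partial^2L/\partial u^\alpha\partial u^\beta$. Assume that $L$ is regular ($g_u$ is non-singular for all $u$), and that for all $u\in T_mM$ and $\xi\in\mathfrak g$, if $g_u(\tilde\xi(m),\tilde\eta(m))=0$ for all $\eta\in\mathfrak g$, then $\xi=0$. Let $\Gamma$ be the Euler-Lagrange field of $L$, the second-order differential equation field on $TM$ with $\Gamma(\partial L/\partial u^\alpha)-\partial L/\partial x^\alpha=0$. The generalized mechanical connection assigns to $u,v\in T_mM$ the unique $\omega_u(v)\in\mathfrak g$ such that, with $\xi=\omega_u(v)$, $g_u(v-\tilde\xi(m),\tilde\eta(m))=0$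 for all $\eta\in\mathfrak g$. Its vertical lift is the $\mathfrak g$-valued 1-form $\Omega_u(W)=\omega_u(T\tau(W))$ on $TM$, where $W\in T_uTM$. Let $\vartheta(X)=TL_{g^{-1}}X$ ($X\in T_gG$) be the Maurer-Cartan form of $G$, where $L_{g^{-1}}$ is left translation. Then $\Gamma$ is $G$-invariant, and so has a reduced field $\check\Gamma$ on $TM/G$ that is $\pi$-related to it. Let $J\subseteq\mathbb R$ be an open interval containing $0$, let $v_0\in TM$, and let $\check v:J\to TM/G$ be an integral curve of $\check\Gamma$ with $\check v(0)=\pi(v_0)$. Then: 1. There is a unique curve $v^h:J\to TM$ (the horizontal lift of $\check v$ through $v_0$) with $\pi\circ v^h=\check v$, $\Omega(\dot v^h)=0$ and $v^h(0)=v_0$. 2. The reconstruction equation $\vartheta(\dot g)=\Omega(\Gamma\circ v^h)$, $g(0)=e$, has a unique solution $g:J\to G$, and $t\mapsto g(t)\cdot v^h(t)$ is the unique integral curve of $\Gamma$ on $J$ through $v_0$ at $t=0$. Moreover, a curve $g$ in $G$ with $g(0)=e$ solves the reconstruction equation on $J$ if and only if $g(t)\cdot v^h(t)$ is an integral curve of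 $\Gamma$ on $J$. 3. Let $(E_a)$ be a basis of $\mathfrak g$, let $W\subseteq M$ be a $G$-invariant open set with a local trivialization $m\mapsto(x,h(m))$ over it, so that $h:W\to G$ is smooth and $h(\psi_gm)=g\,h(m)$, and let $X_i$ be $G$-invariant smooth vector fields on $W$ such that $\{\tilde E_a,X_i\}$ is a frame of $TM$ over $W$. Let $(A^a_b(g))$ be the matrix of $\mathrm{Ad}_g$, with $\mathrm{Ad}_gE_b=A^a_b(g)E_a$, let $\hat E_b=A^a_b(h)\tilde E_a$, and let $(w^a,v^i)$ be the components of tangent vectors with respect to $\{\hat E_a,X_i\}$. These are invariant functions, hence functions on $TM/G$. Put $B^a_i=-g^{ab}g_{bi}$, where $g_{ab}=g(\tilde E_a,\tilde E_b)$, $(g^{ab})=(g_{ab})^{-1}$ and $g_{bi}=g(\tilde E_b,X_i)$. Then for every $t\in J$ with $\tau(v^h(t))\in W$ the right-hand side of the reconstruction equation is $$\Omega(\Gamma(v^h(t)))=\big(A^a_b(h(\tau(v^h(t))))\,w^b(t)-B^a_i(v^h(t))\,v^i(t)\big)E_a,$$ where $w^b(t),v^i(t)$ are the values of $w^b,v^i$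 at $\check v(t)$; thus $g$ solves $\vartheta(\dot g)=(A^a_bw^b-B^a_iv^i)E_a$. -/

import Mathlib

open scoped Manifold ContDiff

noncomputable section

namespace Reconstruction

/-! ### Euler-Lagrange fields and the Hessian -/

section Lagrangian

variable {E : Type*} [NormedAddCommGroup E] [NormedSpace ℝ E]
  {M : Type*} [TopologicalSpace M] [ChartedSpace E M] [IsManifold 𝓘(ℝ, E) ∞ M]

/-- The canonical coordinates `(x, u) : E × E` on `TM` induced by the chart of `M` at `p`. -/
def tangentCoord (p : M) : PartialEquiv (TangentBundle 𝓘(ℝ, E) M) (E × E) :=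
  extChartAt 𝓘(ℝ, E).tangent (⟨p, 0⟩ : TangentBundle 𝓘(ℝ, E) M)

/-- `Γ` is the Euler-Lagrange field of `L`: a (smooth) second-order differential equation field
on `TM`, that is `Tτ (Γ u) = u`, which in the canonical coordinates of every chart satisfies
`Γ (∂L/∂u^α) - ∂L/∂x^α = 0`. (The index `α` is replaced by an arbitrary coordinate
direction `e`.) -/
structure IsEulerLagrangeField (L : TangentBundle 𝓘(ℝ, E) M → ℝ)
    (Γ : (u : TangentBundle 𝓘(ℝ, E) M) → TangentSpace 𝓘(ℝ, E).tangent u) : Prop where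
  smooth : ContMDiff 𝓘(ℝ, E).tangent 𝓘(ℝ, E).tangent.tangent ∞
    (fun u => (⟨u, Γ u⟩ : TangentBundle 𝓘(ℝ, E).tangent (TangentBundle 𝓘(ℝ, E) M)))
  second_order : ∀ u : TangentBundle 𝓘(ℝ, E) M,
    mfderiv 𝓘(ℝ, E).tangent 𝓘(ℝ, E)
      (fun x : TangentBundle 𝓘(ℝ, E) M => x.proj) u (Γ u) = u.snd
  euler_lagrange : ∀ (p : M), ∀ u ∈ (tangentCoord (E := E) p).source, ∀ e : E,
    fderiv ℝ
        (fun z : E × E => fderiv ℝ (fun y => L ((tangentCoord p).symm y)) z ((0 : E), e))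
        (tangentCoord p u)
        (mfderiv 𝓘(ℝ, E).tangent 𝓘(ℝ, E × E) (tangentCoord p) u (Γ u)) =
      fderiv ℝ (fun y => L ((tangentCoord p).symm y)) (tangentCoord p u) (e, (0 : E))

/-- The Hessian `g_u(v, w) = v^V (w^V (L))` of `L` at `u ∈ T_m M`, for `v, w ∈ T_m M`: the iterated
derivative of `L` along the fibre `T_m M` in the directions `w` and `v`. -/
def hessian (L : TangentBundle 𝓘(ℝ, E) M → ℝ) (u : TangentBundle 𝓘(ℝ, E) M)
    (v w : TangentSpace 𝓘(ℝ, E) u.proj) : ℝ :=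
  deriv (fun s : ℝ => deriv (fun t : ℝ =>
    L (⟨u.proj, u.snd + s • v + t • w⟩ : TangentBundle 𝓘(ℝ, E) M)) 0) 0

/-- `L` is regular: its Hessian is everywhere non-singular. -/
def IsRegular (L : TangentBundle 𝓘(ℝ, E) M → ℝ) : Prop :=
  ∀ (u : TangentBundle 𝓘(ℝ, E) M) (v : TangentSpace 𝓘(ℝ, E) u.proj),
    (∀ w : TangentSpace 𝓘(ℝ, E) u.proj, hessian L u v w = 0) → v = 0

end Lagrangian

/-! ### The Lie group -/

section Group

variable {EG : Type*} [NormedAddCommGroup EG] [NormedSpace ℝ EG]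
  {G : Type*} [TopologicalSpace G] [ChartedSpace EG G] [Group G]

/-- The (left) Maurer-Cartan form `ϑ(X) = T(L_{g⁻¹}) X`, for `X ∈ T_g G`. -/
def maurerCartan (g : G) (X : TangentSpace 𝓘(ℝ, EG) g) : GroupLieAlgebra 𝓘(ℝ, EG) G :=
  mfderiv 𝓘(ℝ, EG) 𝓘(ℝ, EG) (fun x : G => g⁻¹ * x) g X

/-- The adjoint action of `g` on the Lie algebra: the derivative of `x ↦ g x g⁻¹` at the
identity. -/
def Ad (g : G) : GroupLieAlgebra 𝓘(ℝ, EG) G →ₗ[ℝ] GroupLieAlgebra 𝓘(ℝ, EG) G :=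
  { toFun := fun ξ => mfderiv 𝓘(ℝ, EG) 𝓘(ℝ, EG) (fun x : G => g * x * g⁻¹) (1 : G) ξ
    map_add' := fun ξ η => map_add (mfderiv 𝓘(ℝ, EG) 𝓘(ℝ, EG) _ (1 : G)) ξ η
    map_smul' := fun r ξ => map_smul (mfderiv 𝓘(ℝ, EG) 𝓘(ℝ, EG) _ (1 : G)) r ξ }

/-- The matrix `(A^a_b(g))` of `Ad_g` with respect to a basis `(E_a)` of the Lie algebra:
`Ad_g E_b = A^a_b(g) E_a`; rows are indexed by `a`, columns by `b`. -/
def adMatrix {ι : Type*} [Fintype ι] [DecidableEq ι]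
    (b : Module.Basis ι ℝ (GroupLieAlgebra 𝓘(ℝ, EG) G)) (g : G) : Matrix ι ι ℝ :=
  LinearMap.toMatrix b b (Ad g)

end Group

/-! ### The action -/

section Action

variable {EG : Type*} [NormedAddCommGroup EG] [NormedSpace ℝ EG]
  {G : Type*} [TopologicalSpace G] [ChartedSpace EG G] [Group G]
  {E : Type*} [NormedAddCommGroup E] [NormedSpace ℝ E]
  {M : Type*} [TopologicalSpace M] [ChartedSpace E M] [IsManifold 𝓘(ℝ, E) ∞ M]
  [MulAction G M]

/-- The induced action of `G` on `TM`: `ψ^{TM}_g = T ψ^M_g`. -/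
def tangentAct (g : G) (u : TangentBundle 𝓘(ℝ, E) M) : TangentBundle 𝓘(ℝ, E) M :=
  tangentMap 𝓘(ℝ, E) 𝓘(ℝ, E) (fun m : M => g • m) u

/-- The fundamental vector field `ξ~` of `ξ` on `M`: the derivative at the identity of the orbit
map `g ↦ g • m`, applied to `ξ`. -/
def fundamentalField (ξ : GroupLieAlgebra 𝓘(ℝ, EG) G) (m : M) : TangentSpace 𝓘(ℝ, E) m :=
  mfderiv 𝓘(ℝ, EG) 𝓘(ℝ, E) (fun g : G => g • m) (1 : G) ξ

/-- The Hessian of `L` is non-singular on the fundamental vector fields (and these vanish nowhere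
for `ξ ≠ 0`): the matrices `g_{ab}` are non-singular. -/
def IsNonsingularOnFundamental (EG G : Type*) [NormedAddCommGroup EG] [NormedSpace ℝ EG]
    [TopologicalSpace G] [ChartedSpace EG G] [Group G] [MulAction G M]
    (L : TangentBundle 𝓘(ℝ, E) M → ℝ) : Prop :=
  ∀ (u : TangentBundle 𝓘(ℝ, E) M) (ξ : GroupLieAlgebra 𝓘(ℝ, EG) G),
    (∀ η : GroupLieAlgebra 𝓘(ℝ, EG) G,
      hessian L u (fundamentalField ξ u.proj) (fundamentalField η u.proj) = 0) → ξ = 0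

/-- The generalized mechanical connection along `τ`, with values in the Lie algebra. For
`u, v ∈ T_m M`, `mechω_u(v)` is the `ξ` for which `v - ξ~(m)` is horizontal, that is,
`g_u`-orthogonal to all fundamental vector fields; this `ξ` exists and is unique when `g_u` is
non-singular on the fundamental vector fields. -/
def mechω (EG G : Type*) [NormedAddCommGroup EG] [NormedSpace ℝ EG]
    [TopologicalSpace G] [ChartedSpace EG G] [Group G] [MulAction G M]
    (L : TangentBundle 𝓘(ℝ, E) M → ℝ) (u : TangentBundle 𝓘(ℝ, E) M)
    (v : TangentSpace 𝓘(ℝ, E) u.proj) : GroupLieAlgebra 𝓘(ℝ, EG) G :=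
  Classical.epsilon fun ξ : GroupLieAlgebra 𝓘(ℝ, EG) G =>
    ∀ η : GroupLieAlgebra 𝓘(ℝ, EG) G,
      hessian L u (v - fundamentalField ξ u.proj) (fundamentalField η u.proj) = 0

/-- The vertical lift `mechΩ` of the generalized mechanical connection: the Lie algebra valued
1-form on `TM` given by `mechΩ_u(W) = mechω_u(Tτ W)` for `W ∈ T_u TM`. -/
def mechΩ (EG G : Type*) [NormedAddCommGroup EG] [NormedSpace ℝ EG]
    [TopologicalSpace G] [ChartedSpace EG G] [Group G] [MulAction G M]
    (L : TangentBundle 𝓘(ℝ, E) M → ℝ) (u : TangentBundle 𝓘(ℝ, E) M)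
    (W : TangentSpace 𝓘(ℝ, E).tangent u) : GroupLieAlgebra 𝓘(ℝ, EG) G :=
  mechω EG G L u (mfderiv 𝓘(ℝ, E).tangent 𝓘(ℝ, E)
    (fun x : TangentBundle 𝓘(ℝ, E) M => x.proj) u W)

/-! ### The orbit space `TM/G`, with its quotient smooth structure -/

/-- The orbit space `TM/G` of the induced action on `TM`. -/
def TangentOrbitSpace (G E M : Type*) [Group G] [NormedAddCommGroup E] [NormedSpace ℝ E]
    [TopologicalSpace M] [ChartedSpace E M] [IsManifold 𝓘(ℝ, E) ∞ M] [MulAction G M] : Type _ :=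
  Quot fun u v : TangentBundle 𝓘(ℝ, E) M => ∃ g : G, tangentAct g u = v

/-- `TM/G` carries the quotient topology. -/
instance : TopologicalSpace (TangentOrbitSpace G E M) :=
  inferInstanceAs (TopologicalSpace (Quot _))

/-- The projection `π : TM → TM/G`. -/
def orbitProj (G : Type*) [Group G] [MulAction G M] (u : TangentBundle 𝓘(ℝ, E) M) :
    TangentOrbitSpace G E M :=
  Quot.mk _ u

/-- Smoothness of a function on an open subset `U` of the quotient manifold `TM/G`: `f` is smooth
exactly when the invariant function `f ∘ π` is smooth on the open set `π⁻¹(U)`. -/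
def IsSmoothOnQuotient (f : TangentOrbitSpace G E M → ℝ) (U : Set (TangentOrbitSpace G E M)) :
    Prop :=
  ContMDiffOn 𝓘(ℝ, E).tangent 𝓘(ℝ, ℝ) ∞
    (fun u : TangentBundle 𝓘(ℝ, E) M => f (orbitProj G u)) (orbitProj G ⁻¹' U)

/-- `c` is, on `J`, an integral curve of the reduced vector field `Γ̌` on `TM/G` of the invariant
vector field `Γ` on `TM`. Here `Γ̌` is the vector field `π`-related to `Γ`: as a derivation, it
sends a smooth function `f` on an open subset of `TM/G` to the function `Γ̌(f)` for which
`Γ̌(f) ∘ π = Γ(f ∘ π)`. An integral curve is a continuous curve `c` such that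
`d/dt f(c(t)) = Γ̌(f)(c(t))` for all smooth functions `f` defined near `c(t)`. -/
def IsReducedIntegralCurveOn
    (Γ : (u : TangentBundle 𝓘(ℝ, E) M) → TangentSpace 𝓘(ℝ, E).tangent u)
    (c : ℝ → TangentOrbitSpace G E M) (J : Set ℝ) : Prop :=
  ContinuousOn c J ∧
    ∀ t ∈ J, ∀ u : TangentBundle 𝓘(ℝ, E) M, orbitProj G u = c t →
      ∀ (U : Set (TangentOrbitSpace G E M)) (f : TangentOrbitSpace G E M → ℝ),
        IsOpen U → c t ∈ U → IsSmoothOnQuotient f U →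
        HasDerivAt (fun s => f (c s))
          (mfderiv 𝓘(ℝ, E).tangent 𝓘(ℝ, ℝ)
            (fun x : TangentBundle 𝓘(ℝ, E) M => f (orbitProj G x)) u (Γ u) : ℝ) t

/-- `vh` is, on `J`, a horizontal lift through `v₀` of the curve `c` in `TM/G`, with respect to the
connection `mechΩ`. -/
structure IsMechHorizontalLift (EG : Type*) [NormedAddCommGroup EG] [NormedSpace ℝ EG]
    [ChartedSpace EG G] (L : TangentBundle 𝓘(ℝ, E) M → ℝ)
    (c : ℝ → TangentOrbitSpace G E M) (J : Set ℝ) (v₀ : TangentBundle 𝓘(ℝ, E) M)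
    (vh : ℝ → TangentBundle 𝓘(ℝ, E) M) : Prop where
  initial : vh 0 = v₀
  proj : ∀ t ∈ J, orbitProj G (vh t) = c t
  differentiable : ∀ t ∈ J, MDifferentiableAt 𝓘(ℝ, ℝ) 𝓘(ℝ, E).tangent vh t
  horizontal : ∀ t ∈ J,
    mechΩ EG G L (vh t) (mfderiv 𝓘(ℝ, ℝ) 𝓘(ℝ, E).tangent vh t (1 : ℝ)) = 0

/-- `g` solves on `J` the equation `ϑ(ġ(t)) = ξ(t)`, with `g(0) = e`. -/
structure SolvesMaurerCartan (J : Set ℝ) (ξ : ℝ → GroupLieAlgebra 𝓘(ℝ, EG) G) (g : ℝ → G) :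
    Prop where
  initial : g 0 = 1
  differentiable : ∀ t ∈ J, MDifferentiableAt 𝓘(ℝ, ℝ) 𝓘(ℝ, EG) g t
  equation : ∀ t ∈ J, maurerCartan (g t) (mfderiv 𝓘(ℝ, ℝ) 𝓘(ℝ, EG) g t (1 : ℝ)) = ξ t

/-! ### Adapted local frames -/

/-- A local trivialization of `M → M/G` over the invariant open set `W`, given by its (equivariant)
component `h : W → G`, so that the action is `(x, h) ↦ (x, g h)`, together with invariant
vector fields `X_i` on `W` which complete the fundamental vector fields `E~_a` of the basis `(E_a)`
to a frame `{E~_a, X_i}` of `TM` over `W`. -/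
structure IsAdaptedFrame {ι κ : Type*} (b : Module.Basis ι ℝ (GroupLieAlgebra 𝓘(ℝ, EG) G))
    (W : Set M) (h : M → G) (X : κ → (m : M) → TangentSpace 𝓘(ℝ, E) m) : Prop where
  isOpen : IsOpen W
  invariant : ∀ (g : G), ∀ m ∈ W, g • m ∈ W
  smooth_triv : ContMDiffOn 𝓘(ℝ, E) 𝓘(ℝ, EG) ∞ h W
  equivariant : ∀ (g : G), ∀ m ∈ W, h (g • m) = g * h m
  smooth_frame : ∀ i, ContMDiffOn 𝓘(ℝ, E) 𝓘(ℝ, E).tangent ∞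
    (fun m => (⟨m, X i m⟩ : TangentBundle 𝓘(ℝ, E) M)) W
  invariant_frame : ∀ i (g : G), ∀ m ∈ W,
    mfderiv 𝓘(ℝ, E) 𝓘(ℝ, E) (fun x : M => g • x) m (X i m) = X i (g • m)
  linearIndependent : ∀ m ∈ W, LinearIndependent ℝ
    (Sum.elim (fun a => fundamentalField (b a) m) (fun i => X i m) :
      ι ⊕ κ → TangentSpace 𝓘(ℝ, E) m)
  span_eq_top : ∀ m ∈ W, Submodule.span ℝ (Set.range
    (Sum.elim (fun a => fundamentalField (b a) m) (fun i => X i m) :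
      ι ⊕ κ → TangentSpace 𝓘(ℝ, E) m)) = ⊤

/-- The invariant vector field `Ê_a(m) = (Ad_{h(m)} E_a)~(m)`. -/
def hatField {ι : Type*} (b : Module.Basis ι ℝ (GroupLieAlgebra 𝓘(ℝ, EG) G)) (h : M → G)
    (a : ι) (m : M) : TangentSpace 𝓘(ℝ, E) m :=
  fundamentalField (Ad (h m) (b a)) m

/-- `(w^a, v^i)` are the quasi-velocities of `u` with respect to the invariant frame
`{Ê_a, X_i}`: `u = w^a Ê_a + v^i X_i`. -/
def IsQuasiVelocity {ι κ : Type*} [Fintype ι] [Fintype κ]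
    (b : Module.Basis ι ℝ (GroupLieAlgebra 𝓘(ℝ, EG) G)) (h : M → G)
    (X : κ → (m : M) → TangentSpace 𝓘(ℝ, E) m) (u : TangentBundle 𝓘(ℝ, E) M)
    (w : ι → ℝ) (v : κ → ℝ) : Prop :=
  u.snd = ∑ a, w a • hatField b h a u.proj + ∑ i, v i • X i u.proj

/-- `B^a_i = - g^{ab} g_{bi}`, where `g_{ab} = g_u(E~_a, E~_b)`, `(g^{ab})` is the inverse matrix of
`(g_{ab})` and `g_{bi} = g_u(E~_b, X_i)`. -/
def mechB {ι κ : Type*} [Fintype ι] [DecidableEq ι] (L : TangentBundle 𝓘(ℝ, E) M → ℝ)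
    (b : Module.Basis ι ℝ (GroupLieAlgebra 𝓘(ℝ, EG) G))
    (X : κ → (m : M) → TangentSpace 𝓘(ℝ, E) m) (u : TangentBundle 𝓘(ℝ, E) M) : Matrix ι κ ℝ :=
  -((Matrix.of fun a c =>
        hessian L u (fundamentalField (b a) u.proj) (fundamentalField (b c) u.proj))⁻¹ *
      Matrix.of fun c i => hessian L u (fundamentalField (b c) u.proj) (X i u.proj))

end Action

end Reconstruction

end

/-!
# Reconstruction by the generalized mechanical connection

Everything follows from two properties of the `𝔤`-valued form `Ω` on `TM` (`IsConnectionForm`):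
`Ω(W + ξ~) = Ω(W) + ξ` for the generators `ξ~` of the action on `TM`, and `Ω(g · W) = Ad_g Ω(W)`.
They hold (`isConnectionForm_mechΩ`) because `ω_u(v)` solves a linear system whose matrix is the
Hessian restricted to the fundamental fields, which is invertible by hypothesis and, like
everything else built from `L`, invariant. The Euler-Lagrange field `Γ` is itself invariant: a
translate of it satisfies the Euler-Lagrange equations again, since these are covariant under
coordinate changes, and regularity makes their solution unique (`eulerLagrangeField_invariant`).

Given `Ω`, let `Z(u) = Γ(u) - (Ω(Γ(u)))~(u)` be the horizontal part of `Γ` (`horField`). It is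
smooth, invariant, annihilated by `Ω`, and has the same projection to `TM/G` as `Γ`. Hence one
lifting result applied to `Γ` and to `Z` gives both curves that are needed: an integral curve `v`
of `Γ` and an integral curve `vh` of `Z`, both defined on all of `J`, through `v₀` and over the
given curve `c`. As they lie over the same curve, `v = g · vh` for a curve `g` in `G`, unique by
freeness. The product rule gives `Ω` of the velocity of `g · vh` as `Ad_g (Ω(vh') + ϑ(g'))`
(`IsConnectionForm.apply_act_curve`), from which the equivalence between the reconstruction
equation for `g` and `g · vh` being an integral curve of `Γ` is read off, and also the uniqueness
of the horizontal lift: two of them differ by a curve `k` with `ϑ(k') = 0`, which is constant.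

The lifting result is in two steps. Locally (`IsSmoothAction.exists_local_lift`), the slice
theorem for a free proper action (`exists_equivariant_map`) provides coordinates on the orbit
space; in these the curve `c` and the projection of a local integral curve of `Z` satisfy the same
ordinary differential equation, so they agree. Then (`IsSmoothAction.exists_lift`) local lifts are
translated by group elements until they fit together, and connectedness of `J` gives a lift over
the whole of `J`; no extension argument for integral curves is needed, since the projected curve
is given on `J` in advance. Infinitesimal freeness, which the slice theorem uses, is part of the
non-singularity of the Hessian on the fundamental fields.

For the formula in an adapted frame, `Ω(Γ(u)) = ω_u(u)` by the second-order property,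
quasi-velocities are constant along the orbits (`IsQuasiVelocity.tangentAct`), and `ω_u` is
evaluated on the frame: on a fundamental field by the reproducing property, on the `X_i` by
inverting the matrix `(g_ab)`.
-/

open scoped Manifold ContDiff

noncomputable section

namespace Reconstruction

/-! ### Smooth actions and their infinitesimal generators -/

section SmoothAction

variable {EG : Type*} [NormedAddCommGroup EG] [NormedSpace ℝ EG]
  {G : Type*} [TopologicalSpace G] [ChartedSpace EG G] [Group G]
  {F : Type*} [NormedAddCommGroup F] [NormedSpace ℝ F]
  {H : Type*} [TopologicalSpace H] {I : ModelWithCorners ℝ F H}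
  {N : Type*} [TopologicalSpace N] [ChartedSpace H N]

/-- A smooth left action of `G` on `N`, given by its action map. Working with the map, instead of
a `MulAction` instance, treats the actions on `M`, on `TM` and on `G` itself alike. -/
structure IsSmoothAction (EG : Type*) [NormedAddCommGroup EG] [NormedSpace ℝ EG]
    [ChartedSpace EG G] (I : ModelWithCorners ℝ F H) (a : G → N → N) : Prop where
  one : ∀ x, a 1 x = x
  mul : ∀ g h x, a (g * h) x = a g (a h x)
  smooth : ContMDiff (𝓘(ℝ, EG).prod I) I ∞ (fun p : G × N => a p.1 p.2)

/-- The infinitesimal generator at `x` of the action `a`: the derivative at the identity of the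
orbit map through `x`. -/
def infGen (EG : Type*) [NormedAddCommGroup EG] [NormedSpace ℝ EG]
    [ChartedSpace EG G] (I : ModelWithCorners ℝ F H) (a : G → N → N) (x : N) :
    GroupLieAlgebra 𝓘(ℝ, EG) G →L[ℝ] TangentSpace I x :=
  (mfderiv 𝓘(ℝ, EG) I (fun g : G => a g x) (1 : G) : EG →L[ℝ] F)

namespace IsSmoothAction

variable {a : G → N → N}

theorem smooth_left (ha : IsSmoothAction EG I a) (g : G) : ContMDiff I I ∞ (a g) :=
  ha.smooth.comp (contMDiff_const.prodMk contMDiff_id)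

theorem smooth_orbit (ha : IsSmoothAction EG I a) (x : N) :
    ContMDiff 𝓘(ℝ, EG) I ∞ (fun g => a g x) :=
  ha.smooth.comp (contMDiff_id.prodMk contMDiff_const)

theorem mdiff_left (ha : IsSmoothAction EG I a) (g : G) (x : N) :
    MDifferentiableAt I I (a g) x :=
  (ha.smooth_left g).mdifferentiable (by simp) x

theorem mdiff_orbit (ha : IsSmoothAction EG I a) (x : N) (g : G) :
    MDifferentiableAt 𝓘(ℝ, EG) I (fun g => a g x) g :=
  (ha.smooth_orbit x).mdifferentiable (by simp) g

theorem inv_act (ha : IsSmoothAction EG I a) (g : G) (x : N) : a g⁻¹ (a g x) = x := by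
  rw [← ha.mul, inv_mul_cancel, ha.one]

theorem act_inv (ha : IsSmoothAction EG I a) (g : G) (x : N) : a g (a g⁻¹ x) = x := by
  rw [← ha.mul, mul_inv_cancel, ha.one]

theorem mfderiv_left_mul (ha : IsSmoothAction EG I a) (g h : G) (x : N) (v : TangentSpace I x) :
    (mfderiv I I (a (g * h)) x v : F) = mfderiv I I (a g) (a h x) (mfderiv I I (a h) x v) := by
  have : a (g * h) = a g ∘ a h := funext fun y => ha.mul g h y
  rw [this, mfderiv_comp x (ha.mdiff_left g _) (ha.mdiff_left h x)]
  rfl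

theorem mfderiv_left_inv (ha : IsSmoothAction EG I a) (g : G) (x : N) (v : TangentSpace I x) :
    (mfderiv I I (a g⁻¹) (a g x) (mfderiv I I (a g) x v) : F) = v := by
  rw [← ha.mfderiv_left_mul]
  have : a (g⁻¹ * g) = id := funext fun y => by rw [inv_mul_cancel, ha.one]; rfl
  rw [this, mfderiv_id]
  rfl

theorem mfderiv_left_act_inv (ha : IsSmoothAction EG I a) (g : G) (x : N)
    (v : TangentSpace I (a g x)) :
    (mfderiv I I (a g) x (mfderiv I I (a g⁻¹) (a g x) v) : F) = v := by
  have h1 := mfderiv_comp (a g x) (ha.mdiff_left g _) (ha.mdiff_left g⁻¹ (a g x))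
  have : a g ∘ a g⁻¹ = id := funext fun y => ha.act_inv g y
  rw [this, mfderiv_id, ha.inv_act] at h1
  exact (congrArg (fun T : F →L[ℝ] F => T v) h1).symm

variable [LieGroup 𝓘(ℝ, EG) ∞ G]

/-- The velocity of an orbit map is the translate of the generator of its Maurer-Cartan
component. -/
theorem mfderiv_orbit (ha : IsSmoothAction EG I a) (x : N) (g : G)
    (X : TangentSpace 𝓘(ℝ, EG) g) :
    (mfderiv 𝓘(ℝ, EG) I (fun g => a g x) g X : F) =
      mfderiv I I (a g) x (infGen EG I a x (maurerCartan g X)) := by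
  have e : (fun g' => a g' x) = a g ∘ ((fun g' => a g' x) ∘ fun g' => g⁻¹ * g') := by
    funext g'
    simp only [Function.comp]
    rw [← ha.mul, mul_inv_cancel_left]
  have h1 : MDifferentiableAt 𝓘(ℝ, EG) 𝓘(ℝ, EG) (fun g' => g⁻¹ * g') g :=
    (contMDiff_mul_left (I := 𝓘(ℝ, EG)) (n := ∞)).mdifferentiable (by simp) g
  have hx : a (g⁻¹ * g) x = x := by rw [inv_mul_cancel, ha.one]
  conv_lhs => rw [e]
  rw [mfderiv_comp g (ha.mdiff_left g _) ((ha.mdiff_orbit x _).comp g h1),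
    mfderiv_comp g (ha.mdiff_orbit x _) h1]
  simp only [Function.comp]
  rw [hx, inv_mul_cancel]
  rfl

/-- The product rule for `t ↦ k(t) · x(t)`. -/
theorem mfderiv_act_curve (ha : IsSmoothAction EG I a) {k : ℝ → G} {x : ℝ → N} {t : ℝ}
    (hk : MDifferentiableAt 𝓘(ℝ, ℝ) 𝓘(ℝ, EG) k t) (hx : MDifferentiableAt 𝓘(ℝ, ℝ) I x t) :
    MDifferentiableAt 𝓘(ℝ, ℝ) I (fun s => a (k s) (x s)) t ∧
    (mfderiv 𝓘(ℝ, ℝ) I (fun s => a (k s) (x s)) t (1 : ℝ) : F) =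
      mfderiv I I (a (k t)) (x t)
        (infGen EG I a (x t) (maurerCartan (k t) (mfderiv 𝓘(ℝ, ℝ) 𝓘(ℝ, EG) k t (1 : ℝ))) +
          mfderiv 𝓘(ℝ, ℝ) I x t (1 : ℝ)) := by
  have h1 : MDifferentiableAt (𝓘(ℝ, EG).prod I) I (fun p : G × N => a p.1 p.2) (k t, x t) :=
    ha.smooth.mdifferentiable (by simp) _
  have h2 : MDifferentiableAt 𝓘(ℝ, ℝ) (𝓘(ℝ, EG).prod I) (fun s => (k s, x s)) t := hk.prodMk hx
  refine ⟨h1.comp t h2, ?_⟩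
  have e : (fun s => a (k s) (x s)) = (fun p : G × N => a p.1 p.2) ∘ fun s => (k s, x s) := rfl
  rw [e, mfderiv_comp t h1 h2, mfderiv_prodMk hk hx]
  rw [map_add, ← ha.mfderiv_orbit]
  exact mfderiv_prod_eq_add_apply h1

/-- Translation by `g` carries the generator of `ξ` to the generator of `Ad_g ξ`. -/
theorem mfderiv_infGen (ha : IsSmoothAction EG I a) (g : G) (x : N)
    (ξ : GroupLieAlgebra 𝓘(ℝ, EG) G) :
    (mfderiv I I (a g) x (infGen EG I a x ξ) : F) = infGen EG I a (a g x) (Ad g ξ) := by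
  have e : a g ∘ (fun h => a h x) = (fun h => a h (a g x)) ∘ fun h => g * h * g⁻¹ := by
    funext h
    simp only [Function.comp]
    rw [← ha.mul, ← ha.mul]
    simp
  have h1 : MDifferentiableAt 𝓘(ℝ, EG) 𝓘(ℝ, EG) (fun h => g * h * g⁻¹) (1 : G) := by
    have : ContMDiff 𝓘(ℝ, EG) 𝓘(ℝ, EG) ∞ (fun h => g * h * g⁻¹) :=
      (contMDiff_const.mul contMDiff_id).mul contMDiff_const
    exact this.mdifferentiable (by simp) _
  have h2 := mfderiv_comp (1 : G) (ha.mdiff_left g (a 1 x)) (ha.mdiff_orbit x 1)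
  have h3 := mfderiv_comp (1 : G) (ha.mdiff_orbit (a g x) _) h1
  rw [e] at h2
  have h4 : g * 1 * g⁻¹ = 1 := by simp
  have h5 := h2.symm.trans h3
  rw [h4, ha.one] at h5
  exact congrArg (fun T : EG →L[ℝ] F => T ξ) h5

end IsSmoothAction

end SmoothAction

section InfGenSmooth

variable {EG : Type*} [NormedAddCommGroup EG] [NormedSpace ℝ EG]
  {G : Type*} [TopologicalSpace G] [ChartedSpace EG G] [Group G]
  {F : Type*} [NormedAddCommGroup F] [NormedSpace ℝ F]
  {H : Type*} [TopologicalSpace H] {I : ModelWithCorners ℝ F H}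
  {N : Type*} [TopologicalSpace N] [ChartedSpace H N]

/-- Tangent vectors at propositionally equal points are compared in the model space. -/
theorem tangent_mk_congr {x y : N} (h : x = y) {v : TangentSpace I x} {w : TangentSpace I y}
    (hv : (v : F) = w) : (⟨x, v⟩ : TangentBundle I N) = ⟨y, w⟩ := by
  subst h
  exact congrArg _ hv

theorem contMDiff_tangent_mk_const [IsManifold I ∞ N] (x : N)
    {F' : Type*} [NormedAddCommGroup F'] [NormedSpace ℝ F']
    {H' : Type*} [TopologicalSpace H'] {I' : ModelWithCorners ℝ F' H'}
    {N' : Type*} [TopologicalSpace N'] [ChartedSpace H' N']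
    {f : N' → F} (hf : ContMDiff I' 𝓘(ℝ, F) ∞ f) :
    ContMDiff I' I.tangent ∞ (fun y => (⟨x, f y⟩ : TangentBundle I N)) := by
  intro y
  refine Bundle.contMDiffAt_totalSpace.2 ⟨contMDiffAt_const, ?_⟩
  refine (hf y).congr_of_eventuallyEq (Filter.Eventually.of_forall fun z => ?_)
  exact tangentCoordChange_self (I := I) (mem_extChartAt_source x)

/-- The vector field `x ↦ (f x)~(x)` is the derivative of the action map on the pair of the vector
`f x` at the identity and the zero vector at `x`, hence smooth. -/
theorem IsSmoothAction.contMDiff_infGen [LieGroup 𝓘(ℝ, EG) ∞ G] [IsManifold I ∞ N]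
    {a : G → N → N} (ha : IsSmoothAction EG I a)
    {f : N → EG} (hf : ContMDiff I 𝓘(ℝ, EG) ∞ f) :
    ContMDiff I I.tangent ∞ (fun x => (⟨x, infGen EG I a x (f x)⟩ : TangentBundle I N)) := by
  have h1 : ContMDiff I (𝓘(ℝ, EG).tangent.prod I.tangent) ∞
      (fun x : N => ((⟨1, f x⟩ : TangentBundle 𝓘(ℝ, EG) G), (⟨x, 0⟩ : TangentBundle I N))) :=
    (contMDiff_tangent_mk_const 1 hf).prodMk (Bundle.contMDiff_zeroSection ℝ _)
  have h2 := (ha.smooth.contMDiff_tangentMap (m := ∞) (by simp)).comp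
    ((contMDiff_equivTangentBundleProd_symm (n := ∞) (I := 𝓘(ℝ, EG)) (M := G) (I' := I)
      (M' := N)).comp h1)
  refine h2.congr fun x => ?_
  refine tangent_mk_congr (ha.one x).symm ?_
  have h3 := mfderiv_prod_eq_add_apply (f := fun p : G × N => a p.1 p.2) (p := (1, x))
    (v := ((f x : EG), (0 : F))) (ha.smooth.mdifferentiable (by simp) _)
  refine Eq.trans ?_ h3.symm
  have h4 : (mfderiv I I (fun z => a 1 z) x 0 : F) = 0 := map_zero _
  exact (add_zero _).symm.trans (congrArg _ h4.symm)

end InfGenSmooth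

section TangentAction

variable {EG : Type*} [NormedAddCommGroup EG] [NormedSpace ℝ EG]
  {G : Type*} [TopologicalSpace G] [ChartedSpace EG G] [Group G]
  {E : Type*} [NormedAddCommGroup E] [NormedSpace ℝ E]
  {M : Type*} [TopologicalSpace M] [ChartedSpace E M]
  [MulAction G M]

theorem isSmoothAction_smul [ContMDiffSMul 𝓘(ℝ, EG) 𝓘(ℝ, E) ∞ G M] :
    IsSmoothAction EG 𝓘(ℝ, E) (fun (g : G) (m : M) => g • m) where
  one := one_smul G
  mul := mul_smul
  smooth := contMDiff_smul

theorem isSmoothAction_mul [LieGroup 𝓘(ℝ, EG) ∞ G] :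
    IsSmoothAction EG 𝓘(ℝ, EG) (fun g h : G => g * h) where
  one := one_mul
  mul := mul_assoc
  smooth := contMDiff_mul 𝓘(ℝ, EG) ∞

variable [IsManifold 𝓘(ℝ, E) ∞ M]

theorem isSmoothAction_tangentAct [LieGroup 𝓘(ℝ, EG) ∞ G] [ContMDiffSMul 𝓘(ℝ, EG) 𝓘(ℝ, E) ∞ G M] :
    IsSmoothAction EG 𝓘(ℝ, E).tangent
      (fun (g : G) (u : TangentBundle 𝓘(ℝ, E) M) => tangentAct g u) where
  one u := by
    have : (fun m : M => (1 : G) • m) = id := funext fun m => one_smul G m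
    unfold tangentAct
    rw [this, tangentMap_id]
    rfl
  mul g h u := by
    have ha := isSmoothAction_smul (EG := EG) (G := G) (E := E) (M := M)
    refine tangent_mk_congr (mul_smul g h u.proj) ?_
    exact ha.mfderiv_left_mul g h u.proj u.snd
  -- up to the inclusion of `G` in `TG` as the zero section, the action map is the tangent map of
  -- the action of `G` on `M`
  smooth := by
    have ha := isSmoothAction_smul (EG := EG) (G := G) (E := E) (M := M)
    have h1 : ContMDiff (𝓘(ℝ, EG).prod 𝓘(ℝ, E).tangent)
        (𝓘(ℝ, EG).tangent.prod 𝓘(ℝ, E).tangent) ∞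
        (fun p : G × TangentBundle 𝓘(ℝ, E) M =>
          ((⟨p.1, 0⟩ : TangentBundle 𝓘(ℝ, EG) G), p.2)) :=
      ((Bundle.contMDiff_zeroSection ℝ (TangentSpace 𝓘(ℝ, EG) : G → Type _)).comp
        contMDiff_fst).prodMk contMDiff_snd
    have h2 := (ha.smooth.contMDiff_tangentMap (m := ∞) (by simp)).comp
      ((contMDiff_equivTangentBundleProd_symm (n := ∞) (I := 𝓘(ℝ, EG)) (M := G) (I' := 𝓘(ℝ, E))
        (M' := M)).comp h1)
    refine h2.congr fun p => ?_
    refine tangent_mk_congr rfl ?_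
    have h3 := mfderiv_prod_eq_add_apply (I := 𝓘(ℝ, EG)) (I' := 𝓘(ℝ, E)) (I'' := 𝓘(ℝ, E))
      (f := fun p : G × M => p.1 • p.2) (p := (p.1, p.2.proj))
      (v := ((0 : EG), (p.2.snd : E))) (ha.smooth.mdifferentiable (by simp) _)
    refine Eq.trans ?_ h3.symm
    have h4 : (mfderiv 𝓘(ℝ, EG) 𝓘(ℝ, E) (fun z : G => z • p.2.proj) p.1 0 : E) = 0 := map_zero _
    exact (zero_add _).symm.trans (congrArg (· + _) h4.symm)

theorem mdifferentiableAt_tangent_proj (u : TangentBundle 𝓘(ℝ, E) M) :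
    MDifferentiableAt 𝓘(ℝ, E).tangent 𝓘(ℝ, E)
      (fun x : TangentBundle 𝓘(ℝ, E) M => x.proj) u :=
  (Bundle.contMDiff_proj (n := ∞) (TangentSpace 𝓘(ℝ, E) : M → Type _)).mdifferentiable
    (by simp) u

variable [LieGroup 𝓘(ℝ, EG) ∞ G] [ContMDiffSMul 𝓘(ℝ, EG) 𝓘(ℝ, E) ∞ G M]

/-- The infinitesimal generators on `TM` project to the fundamental fields on `M`. -/
theorem mfderiv_proj_infGen (u : TangentBundle 𝓘(ℝ, E) M) (ξ : GroupLieAlgebra 𝓘(ℝ, EG) G) :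
    (mfderiv 𝓘(ℝ, E).tangent 𝓘(ℝ, E) (fun x : TangentBundle 𝓘(ℝ, E) M => x.proj) u
      (infGen EG 𝓘(ℝ, E).tangent (fun (g : G) (u : TangentBundle 𝓘(ℝ, E) M) => tangentAct g u)
        u ξ) : E) = fundamentalField ξ u.proj := by
  have hT := isSmoothAction_tangentAct (EG := EG) (G := G) (E := E) (M := M)
  have h1 := mfderiv_comp (1 : G) (mdifferentiableAt_tangent_proj (tangentAct (1 : G) u))
    (hT.mdiff_orbit u 1)
  rw [hT.one] at h1
  exact (congrArg (fun T : EG →L[ℝ] E => T ξ) h1).symm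

theorem mfderiv_proj_tangentAct
    (ha : IsSmoothAction EG 𝓘(ℝ, E) (fun (g : G) (m : M) => g • m)) (g : G)
    (u : TangentBundle 𝓘(ℝ, E) M) (X : TangentSpace 𝓘(ℝ, E).tangent u) :
    (mfderiv 𝓘(ℝ, E).tangent 𝓘(ℝ, E) (fun x : TangentBundle 𝓘(ℝ, E) M => x.proj) (tangentAct g u)
      (mfderiv 𝓘(ℝ, E).tangent 𝓘(ℝ, E).tangent
        (fun x : TangentBundle 𝓘(ℝ, E) M => tangentAct g x) u X) : E) =
      mfderiv 𝓘(ℝ, E) 𝓘(ℝ, E) (fun m : M => g • m) u.proj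
        (mfderiv 𝓘(ℝ, E).tangent 𝓘(ℝ, E) (fun x : TangentBundle 𝓘(ℝ, E) M => x.proj) u X) := by
  have hT := isSmoothAction_tangentAct (EG := EG) (G := G) (E := E) (M := M)
  have h1 := mfderiv_comp u (mdifferentiableAt_tangent_proj (tangentAct g u)) (hT.mdiff_left g u)
  have h2 := mfderiv_comp u (ha.mdiff_left g u.proj) (mdifferentiableAt_tangent_proj u)
  exact congrArg (fun T : E × E →L[ℝ] E => T X) (h1.symm.trans h2)

instance [T2Space M] : T2Space (TangentBundle 𝓘(ℝ, E) M) := by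
  refine ⟨fun u v huv => ?_⟩
  by_cases h : u.proj = v.proj
  · let e := trivializationAt E (TangentSpace 𝓘(ℝ, E) : M → Type _) u.proj
    have hu : u ∈ e.source := FiberBundle.mem_trivializationAt_proj_source
    have hv : v ∈ e.source := by
      rw [e.mem_source, ← h]; exact e.mem_source.1 hu
    obtain ⟨U, V, hU, hV, huU, hvV, hUV⟩ := t2_separation (fun he => huv (e.injOn hu hv he))
    exact ⟨_, _, e.toOpenPartialHomeomorph.isOpen_inter_preimage hU,
      e.toOpenPartialHomeomorph.isOpen_inter_preimage hV, ⟨hu, huU⟩, ⟨hv, hvV⟩,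
      (hUV.preimage _).mono Set.inter_subset_right Set.inter_subset_right⟩
  · obtain ⟨U, V, hU, hV, huU, hvV, hUV⟩ := t2_separation h
    have hc := FiberBundle.continuous_proj E (TangentSpace 𝓘(ℝ, E) : M → Type _)
    exact ⟨_, _, hU.preimage hc, hV.preimage hc, huU, hvV, hUV.preimage _⟩

end TangentAction

/-! ### Local slices of a free proper action -/

section Slice

open Topology

/-- The inverse function theorem with a smooth inverse on the whole target, applied to
`(y, x) ↦ (f (y, x), x)`. -/
theorem exists_openPartialHomeomorph_prod {V E : Type*} [NormedAddCommGroup V] [NormedSpace ℝ V]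
    [FiniteDimensional ℝ V] [NormedAddCommGroup E] [NormedSpace ℝ E] [FiniteDimensional ℝ E]
    {f : V × E → V} {O : Set (V × E)} (hO : IsOpen O) (hf : ContDiffOn ℝ ∞ f O) {z : V × E}
    (hz : z ∈ O) (hinj : ∀ y : V, fderiv ℝ f z (y, 0) = 0 → y = 0) :
    ∃ e : OpenPartialHomeomorph (V × E) (V × E), (∀ p, e p = (f p, p.2)) ∧ e.source ⊆ O ∧
      z ∈ e.source ∧ ContDiffOn ℝ ∞ e.symm e.target := by
  set Φ : V × E → V × E := fun p => (f p, p.2) with hΦ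
  have hΦc : ∀ p ∈ O, ContDiffAt ℝ ∞ Φ p := fun p hp =>
    ((hf p hp).contDiffAt (hO.mem_nhds hp)).prodMk contDiffAt_snd
  have hD : HasFDerivAt Φ ((fderiv ℝ f z).prod (ContinuousLinearMap.snd ℝ V E)) z :=
    ((((hf z hz).contDiffAt (hO.mem_nhds hz)).differentiableAt (by simp)).hasFDerivAt).prodMk
      hasFDerivAt_snd
  have hker : Function.Injective
      (((fderiv ℝ f z).prod (ContinuousLinearMap.snd ℝ V E) : V × E →L[ℝ] V × E) :
        V × E →ₗ[ℝ] V × E) := by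
    rw [← LinearMap.ker_eq_bot, LinearMap.ker_eq_bot']
    rintro ⟨y, x⟩ h
    obtain ⟨h1, h2⟩ := Prod.ext_iff.1 h
    have h2' : x = 0 := h2
    subst h2'
    exact Prod.ext (hinj y h1) rfl
  let A : (V × E) ≃L[ℝ] (V × E) := (LinearEquiv.ofInjectiveEndo _ hker).toContinuousLinearEquiv
  have hA : (A : V × E →L[ℝ] V × E) = (fderiv ℝ f z).prod (ContinuousLinearMap.snd ℝ V E) := by
    ext p <;> rfl
  have hD' : HasFDerivAt Φ (A : V × E →L[ℝ] V × E) z := hA ▸ hD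
  let e₀ := (hΦc z hz).toOpenPartialHomeomorph Φ hD' (by simp)
  have he₀ : (e₀ : V × E → V × E) = Φ := rfl
  -- the points of `O` at which the derivative is invertible form a neighbourhood of `z`
  have hev : ∀ᶠ p in 𝓝 z, p ∈ O ∧ fderiv ℝ Φ p ∈
      Set.range ((↑) : ((V × E) ≃L[ℝ] (V × E)) → V × E →L[ℝ] V × E) := by
    refine Filter.Eventually.and (hO.mem_nhds hz) ?_
    have hc : ContinuousAt (fderiv ℝ Φ) z := (hΦc z hz).continuousAt_fderiv (by simp)
    refine hc ?_
    rw [hD'.fderiv]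
    exact A.nhds
  obtain ⟨O', hO'sub, hO'open, hzO'⟩ := eventually_nhds_iff.1 hev
  refine ⟨e₀.restrOpen O' hO'open, fun p => rfl, fun p hp => (hO'sub p ?_).1, ?_, ?_⟩
  · rw [e₀.restrOpen_source] at hp
    exact hp.2
  · rw [e₀.restrOpen_source]
    exact ⟨ContDiffAt.mem_toOpenPartialHomeomorph_source _ _ _, hzO'⟩
  · intro p hp
    have hs := (e₀.restrOpen O' hO'open).map_target hp
    rw [e₀.restrOpen_source] at hs
    obtain ⟨hpO, B, hB⟩ := hO'sub _ hs.2
    refine ((e₀.restrOpen O' hO'open).contDiffAt_symm (f₀' := B) hp ?_ ?_).contDiffWithinAt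
    · rw [hB]
      exact ((hΦc _ hpO).differentiableAt (by simp)).hasFDerivAt
    · exact hΦc _ hpO

theorem hasFDerivAt_comp_chart_symm {F : Type*} [NormedAddCommGroup F] [NormedSpace ℝ F]
    {H : Type*} [TopologicalSpace H] {I : ModelWithCorners ℝ F H} [I.Boundaryless]
    {N : Type*} [TopologicalSpace N] [ChartedSpace H N] {V : Type*} [NormedAddCommGroup V]
    [NormedSpace ℝ V] {f : N → V} {p : N} (hf : MDifferentiableAt I 𝓘(ℝ, V) f p) :
    HasFDerivAt (f ∘ (extChartAt I p).symm) (mfderiv I 𝓘(ℝ, V) f p : F →L[ℝ] V)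
      (extChartAt I p p) := by
  have h := hf.hasMFDerivAt.2
  rw [I.range_eq_univ] at h
  exact hasFDerivWithinAt_univ.1 h

variable {EG : Type*} [NormedAddCommGroup EG] [NormedSpace ℝ EG]
  {G : Type*} [TopologicalSpace G] [ChartedSpace EG G] [Group G]
  {E : Type*} [NormedAddCommGroup E] [NormedSpace ℝ E]
  {M : Type*} [TopologicalSpace M] [ChartedSpace E M]
  [MulAction G M]

/-- The action map in the charts of `G` at the identity and of `M` at `m₀`. -/
def chartAct (EG G E : Type*) [NormedAddCommGroup EG] [NormedSpace ℝ EG] [TopologicalSpace G]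
    [ChartedSpace EG G] [Group G] [NormedAddCommGroup E] [NormedSpace ℝ E]
    [ChartedSpace E M] [MulAction G M] (m₀ : M) (z : EG × E) : E :=
  extChartAt 𝓘(ℝ, E) m₀
    ((extChartAt 𝓘(ℝ, EG) (1 : G)).symm z.1 • (extChartAt 𝓘(ℝ, E) m₀).symm z.2)

/-- The domain of `chartAct`. -/
def chartActDomain (EG G E : Type*) [NormedAddCommGroup EG] [NormedSpace ℝ EG] [TopologicalSpace G]
    [ChartedSpace EG G] [Group G] [NormedAddCommGroup E] [NormedSpace ℝ E]
    [ChartedSpace E M] [MulAction G M] (m₀ : M) : Set (EG × E) :=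
  ((extChartAt 𝓘(ℝ, EG) (1 : G)).target ×ˢ (extChartAt 𝓘(ℝ, E) m₀).target) ∩
    (fun z : EG × E => (extChartAt 𝓘(ℝ, EG) (1 : G)).symm z.1 •
      (extChartAt 𝓘(ℝ, E) m₀).symm z.2) ⁻¹' (extChartAt 𝓘(ℝ, E) m₀).source

theorem mem_chartActDomain (m₀ : M) {m : M} (hm : m ∈ (extChartAt 𝓘(ℝ, E) m₀).source) :
    (extChartAt 𝓘(ℝ, EG) (1 : G) 1, extChartAt 𝓘(ℝ, E) m₀ m) ∈ chartActDomain EG G E m₀ := by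
  refine ⟨⟨mem_extChartAt_target _, (extChartAt 𝓘(ℝ, E) m₀).map_source hm⟩, ?_⟩
  simp only [Set.mem_preimage, extChartAt_to_inv]
  rw [(extChartAt 𝓘(ℝ, E) m₀).left_inv hm, one_smul]
  exact hm

variable [LieGroup 𝓘(ℝ, EG) ∞ G] [IsManifold 𝓘(ℝ, E) ∞ M] [ContMDiffSMul 𝓘(ℝ, EG) 𝓘(ℝ, E) ∞ G M]

theorem contMDiffOn_chart_symm_smul (m₀ : M) :
    ContMDiffOn 𝓘(ℝ, EG × E) 𝓘(ℝ, E) ∞ (fun z : EG × E =>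
      (extChartAt 𝓘(ℝ, EG) (1 : G)).symm z.1 • (extChartAt 𝓘(ℝ, E) m₀).symm z.2)
      ((extChartAt 𝓘(ℝ, EG) (1 : G)).target ×ˢ (extChartAt 𝓘(ℝ, E) m₀).target) := by
  have h1 : ContMDiffOn 𝓘(ℝ, EG × E) 𝓘(ℝ, EG) ∞
      (fun z : EG × E => (extChartAt 𝓘(ℝ, EG) (1 : G)).symm z.1)
      ((extChartAt 𝓘(ℝ, EG) (1 : G)).target ×ˢ (extChartAt 𝓘(ℝ, E) m₀).target) :=
    (contMDiffOn_extChartAt_symm (1 : G)).comp contDiff_fst.contMDiff.contMDiffOn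
      fun z hz => hz.1
  have h2 : ContMDiffOn 𝓘(ℝ, EG × E) 𝓘(ℝ, E) ∞
      (fun z : EG × E => (extChartAt 𝓘(ℝ, E) m₀).symm z.2)
      ((extChartAt 𝓘(ℝ, EG) (1 : G)).target ×ˢ (extChartAt 𝓘(ℝ, E) m₀).target) :=
    (contMDiffOn_extChartAt_symm m₀).comp contDiff_snd.contMDiff.contMDiffOn
      fun z hz => hz.2
  exact h1.smul h2

theorem isOpen_chartActDomain (m₀ : M) : IsOpen (chartActDomain EG G E m₀) :=
  (contMDiffOn_chart_symm_smul m₀).continuousOn.isOpen_inter_preimage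
    ((isOpen_extChartAt_target _).prod (isOpen_extChartAt_target _)) (isOpen_extChartAt_source _)

theorem contDiffOn_chartAct (m₀ : M) :
    ContDiffOn ℝ ∞ (chartAct EG G E m₀) (chartActDomain EG G E m₀) := by
  rw [← contMDiffOn_iff_contDiffOn]
  refine (contMDiffOn_extChartAt (x := m₀)).comp
    ((contMDiffOn_chart_symm_smul m₀).mono Set.inter_subset_left) fun z hz => ?_
  rw [← extChartAt_source 𝓘(ℝ, E)]
  exact hz.2

/-- In charts, the fundamental field is the partial derivative of the action map. -/
theorem mfderiv_chart_fundamentalField (m₀ : M) {m : M}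
    (hm : m ∈ (extChartAt 𝓘(ℝ, E) m₀).source) (ξ : EG) :
    (mfderiv 𝓘(ℝ, E) 𝓘(ℝ, E) (extChartAt 𝓘(ℝ, E) m₀) m
      (fundamentalField (G := G) (EG := EG) ξ m) : E) =
      fderiv ℝ (chartAct EG G E m₀)
        (extChartAt 𝓘(ℝ, EG) (1 : G) 1, extChartAt 𝓘(ℝ, E) m₀ m) (ξ, 0) := by
  have ha := isSmoothAction_smul (EG := EG) (G := G) (E := E) (M := M)
  have h0 : MDifferentiableAt 𝓘(ℝ, E) 𝓘(ℝ, E) (extChartAt 𝓘(ℝ, E) m₀) ((1 : G) • m) := by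
    rw [one_smul]
    refine (contMDiffAt_extChartAt' (n := ∞) ?_).mdifferentiableAt (by simp)
    rwa [← extChartAt_source 𝓘(ℝ, E)]
  have h1 := mfderiv_comp (1 : G) h0 (ha.mdiff_orbit m 1)
  have h2 : (mfderiv 𝓘(ℝ, E) 𝓘(ℝ, E) (extChartAt 𝓘(ℝ, E) m₀) m
      (fundamentalField (G := G) (EG := EG) ξ m) : E) =
      mfderiv 𝓘(ℝ, EG) 𝓘(ℝ, E) (extChartAt 𝓘(ℝ, E) m₀ ∘ fun g : G => g • m) 1 ξ := by
    rw [one_smul] at h1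
    exact (congrArg (fun T : EG →L[ℝ] E => T ξ) h1).symm
  rw [h2]
  have h3 : MDifferentiableAt 𝓘(ℝ, EG) 𝓘(ℝ, E)
      (extChartAt 𝓘(ℝ, E) m₀ ∘ fun g : G => g • m) 1 := h0.comp (1 : G) (ha.mdiff_orbit m 1)
  have h4 := ((contDiffOn_chartAct (EG := EG) (G := G) (E := E) m₀).contDiffAt
    ((isOpen_chartActDomain m₀).mem_nhds (mem_chartActDomain m₀ hm))).differentiableAt (by simp)
  have h5 : HasFDerivAt (fun y : EG => (y, extChartAt 𝓘(ℝ, E) m₀ m))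
      (ContinuousLinearMap.inl ℝ EG E) (extChartAt 𝓘(ℝ, EG) (1 : G) 1) :=
    hasFDerivAt_prodMk_left _ _
  have h6 := h4.hasFDerivAt.comp (extChartAt 𝓘(ℝ, EG) (1 : G) 1) h5
  have h7 : ((extChartAt 𝓘(ℝ, E) m₀ ∘ fun g : G => g • m) ∘ (extChartAt 𝓘(ℝ, EG) (1 : G)).symm) =
      chartAct EG G E m₀ ∘ (fun y : EG => (y, extChartAt 𝓘(ℝ, E) m₀ m)) := by
    funext y
    simp only [Function.comp, chartAct, (extChartAt 𝓘(ℝ, E) m₀).left_inv hm]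
  have h8 := hasFDerivAt_comp_chart_symm h3
  rw [h7] at h8
  exact congrArg (fun T : EG →L[ℝ] E => T ξ) (HasFDerivAt.unique (E := EG) (F := E) h8 h6)

end Slice

section Slice

open Topology Filter

variable {EG : Type*} [NormedAddCommGroup EG] [NormedSpace ℝ EG]
  {G : Type*} [TopologicalSpace G] [ChartedSpace EG G] [Group G] [LieGroup 𝓘(ℝ, EG) ∞ G]
  {E : Type*} [NormedAddCommGroup E] [NormedSpace ℝ E]
  {M : Type*} [TopologicalSpace M] [ChartedSpace E M] [IsManifold 𝓘(ℝ, E) ∞ M]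
  [MulAction G M] [ContMDiffSMul 𝓘(ℝ, EG) 𝓘(ℝ, E) ∞ G M]

/-- Where the action is infinitesimally free, an equation `F (a • m) = c` near `m₀` has a unique
small solution `a m`, which depends smoothly on `m`. Here `F = P ∘ φ`, where `φ` is a chart at `m₀`
and `P` is a left inverse of the derivative of the orbit map. -/
theorem exists_local_solution [FiniteDimensional ℝ EG] [FiniteDimensional ℝ E] (m₀ : M)
    (hinj : ∀ ξ : GroupLieAlgebra 𝓘(ℝ, EG) G,
      (fundamentalField ξ m₀ : TangentSpace 𝓘(ℝ, E) m₀) = 0 → ξ = 0) :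
    ∃ (F : M → EG) (c : EG) (a : M → G) (V : Set M), IsOpen V ∧ m₀ ∈ V ∧
      ContMDiffOn 𝓘(ℝ, E) 𝓘(ℝ, EG) ∞ a V ∧ a m₀ = 1 ∧ (∀ m ∈ V, F (a m • m) = c) ∧
      ∃ Q ∈ 𝓝 ((1 : G), m₀), ∀ g m, m ∈ V → (g, m) ∈ Q → F (g • m) = c → g = a m := by
  set κ := extChartAt 𝓘(ℝ, EG) (1 : G) with hκ
  set φ := extChartAt 𝓘(ℝ, E) m₀ with hφ
  have hm₀ : m₀ ∈ φ.source := mem_extChartAt_source m₀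
  set z₀ : EG × E := (κ 1, φ m₀) with hz₀
  have hz₀D : z₀ ∈ chartActDomain EG G E m₀ := mem_chartActDomain m₀ hm₀
  have hXinj : ∀ ξ : EG, fderiv ℝ (chartAct EG G E m₀) z₀ (ξ, 0) = 0 → ξ = 0 := by
    intro ξ h
    rw [hz₀, ← mfderiv_chart_fundamentalField m₀ hm₀ ξ] at h
    refine hinj ξ ?_
    have h2 := isInvertible_mfderiv_extChartAt (I := 𝓘(ℝ, E)) hm₀
    exact h2.injective (h.trans (map_zero (mfderiv 𝓘(ℝ, E) 𝓘(ℝ, E) φ m₀)).symm)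
  let X : EG →ₗ[ℝ] E := (fderiv ℝ (chartAct EG G E m₀) z₀).toLinearMap ∘ₗ LinearMap.inl ℝ EG E
  obtain ⟨P₀, hP₀⟩ := X.exists_leftInverse_of_injective
    (LinearMap.ker_eq_bot'.2 fun ξ h => hXinj ξ h)
  let P : E →L[ℝ] EG := LinearMap.toContinuousLinearMap P₀
  have hPX : ∀ ξ : EG, P (fderiv ℝ (chartAct EG G E m₀) z₀ (ξ, 0)) = ξ :=
    fun ξ => LinearMap.congr_fun hP₀ ξ
  have hcd := contDiffOn_chartAct (EG := EG) (G := G) (E := E) m₀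
  have hfd : ContDiffOn ℝ ∞ (fun z => P (chartAct EG G E m₀ z)) (chartActDomain EG G E m₀) :=
    P.contDiff.comp_contDiffOn hcd
  obtain ⟨e, he, heD, hez, hes⟩ := exists_openPartialHomeomorph_prod
    (isOpen_chartActDomain m₀) hfd hz₀D (by
      intro y hy
      have h1 := ((hcd.contDiffAt ((isOpen_chartActDomain m₀).mem_nhds hz₀D)).differentiableAt
        (by simp)).hasFDerivAt
      have h2 : HasFDerivAt (fun z => P (chartAct EG G E m₀ z)) _ z₀ :=
        P.hasFDerivAt.comp z₀ h1
      rw [h2.fderiv] at hy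
      exact (hPX y).symm.trans hy)
  set c : EG := P (chartAct EG G E m₀ z₀) with hc
  have hchart : ∀ (g : G) (m : M), g ∈ κ.source → m ∈ φ.source →
      chartAct EG G E m₀ (κ g, φ m) = φ (g • m) := by
    intro g m hg hm
    simp only [chartAct]
    rw [← hκ, ← hφ, κ.left_inv hg, φ.left_inv hm]
  -- the solution `a m` of `P (φ (a • m)) = c`
  let y : M → EG := fun m => (e.symm (c, φ m)).1
  let a : M → G := fun m => κ.symm (y m)
  let V : Set M := φ.source ∩ (fun m => (c, φ m)) ⁻¹' e.target
  have hVopen : IsOpen V := by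
    refine ContinuousOn.isOpen_inter_preimage ?_ (isOpen_extChartAt_source m₀) e.open_target
    exact continuousOn_const.prodMk (continuousOn_extChartAt m₀)
  have hez₀ : e z₀ = (c, φ m₀) := he z₀
  have hm₀V : m₀ ∈ V := ⟨hm₀, by
    change (c, φ m₀) ∈ e.target
    rw [← hez₀]
    exact e.map_source hez⟩
  have hpair : ∀ m ∈ V, e.symm (c, φ m) = (y m, φ m) ∧ (y m, φ m) ∈ e.source ∧
      y m ∈ κ.target := by
    intro m hm
    have h1 := e.right_inv hm.2
    rw [he] at h1
    have h2 : e.symm (c, φ m) = (y m, φ m) := Prod.ext rfl (Prod.ext_iff.1 h1).2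
    have h3 := e.map_target hm.2
    change e.symm (c, φ m) ∈ e.source at h3
    rw [h2] at h3
    exact ⟨h2, h3, (heD h3).1.1⟩
  have ha₀ : a m₀ = 1 := by
    have h1 : e.symm (c, φ m₀) = z₀ := by rw [← hez₀, e.left_inv hez]
    change κ.symm (e.symm (c, φ m₀)).1 = 1
    rw [h1]
    exact extChartAt_to_inv (1 : G)
  have hy : ContMDiffOn 𝓘(ℝ, E) 𝓘(ℝ, EG) ∞ y V := by
    have h1 : ContMDiffOn 𝓘(ℝ, E) 𝓘(ℝ, E) ∞ φ V :=
      (contMDiffOn_extChartAt (x := m₀)).mono fun m hm => by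
        rw [← extChartAt_source 𝓘(ℝ, E)]; exact hm.1
    have h2 : ContMDiffOn 𝓘(ℝ, E) 𝓘(ℝ, EG × E) ∞ (fun m => (c, φ m)) V :=
      (ContDiff.contMDiff (contDiff_prodMk_right c)).comp_contMDiffOn h1
    have h3 : ContMDiffOn 𝓘(ℝ, EG × E) 𝓘(ℝ, EG) ∞ (fun p => (e.symm p).1) e.target :=
      (contDiff_fst.comp_contDiffOn hes).contMDiffOn
    exact h3.comp h2 fun m hm => hm.2
  have ha : ContMDiffOn 𝓘(ℝ, E) 𝓘(ℝ, EG) ∞ a V :=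
    (contMDiffOn_extChartAt_symm (1 : G)).comp hy fun m hm => (hpair m hm).2.2
  -- a nearby pair solving the same equation is `(a m, m)`
  have huniq : ∀ (g : G) (m : M), m ∈ V → g ∈ κ.source → (κ g, φ m) ∈ e.source →
      P (φ (g • m)) = c → g = a m := by
    intro g m hm hg hs h
    have h1 : e (κ g, φ m) = (c, φ m) := by
      rw [he, hchart g m hg hm.1, h]
    have h2 : (κ g, φ m) = (y m, φ m) := by
      rw [← (hpair m hm).1, ← h1, e.left_inv hs]
    rw [← κ.left_inv hg, show κ g = y m from (Prod.ext_iff.1 h2).1]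
  have hsol : ∀ m ∈ V, P (φ (a m • m)) = c := by
    intro m hm
    have h1 := e.right_inv hm.2
    rw [(hpair m hm).1, he] at h1
    refine Eq.trans ?_ (Prod.ext_iff.1 h1).1
    simp only [chartAct]
    rw [← hφ, φ.left_inv hm.1]
  refine ⟨fun m => P (φ m), c, a, V, hVopen, hm₀V, ha, ha₀, hsol,
    {p | p.1 ∈ κ.source ∧ (κ p.1, φ p.2) ∈ e.source}, ?_,
    fun g m hm hgm h => huniq g m hm hgm.1 hgm.2 h⟩
  have h1 : ∀ᶠ p : G × M in 𝓝 (1, m₀), p.1 ∈ κ.source :=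
    continuousAt_fst.eventually_mem (extChartAt_source_mem_nhds (I := 𝓘(ℝ, EG)) (1 : G))
  have hc1 : ContinuousAt (fun p : G × M => κ p.1) (1, m₀) :=
    ContinuousAt.comp (f := Prod.fst) (x := ((1 : G), m₀)) (continuousAt_extChartAt (1 : G))
      continuousAt_fst
  have hc2 : ContinuousAt (fun p : G × M => φ p.2) (1, m₀) :=
    ContinuousAt.comp (f := Prod.snd) (x := ((1 : G), m₀)) (continuousAt_extChartAt m₀)
      continuousAt_snd
  have h2 : ∀ᶠ p : G × M in 𝓝 (1, m₀), (κ p.1, φ p.2) ∈ e.source :=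
    (hc1.prodMk hc2).eventually_mem (e.open_source.mem_nhds hez)
  exact h1.and h2

/-- Where the action is infinitesimally free there is a smooth `G`-valued map `h₀` near `m₀` which
is equivariant under group elements near the identity: the inverse of the local solution `a` of
`exists_local_solution`, since `a (k • m) * k` also solves the equation at `m`. -/
theorem exists_local_equivariant [FiniteDimensional ℝ EG] [FiniteDimensional ℝ E] (m₀ : M)
    (hinj : ∀ ξ : GroupLieAlgebra 𝓘(ℝ, EG) G,
      (fundamentalField ξ m₀ : TangentSpace 𝓘(ℝ, E) m₀) = 0 → ξ = 0) :
    ∃ h₀ : M → G, ∃ U ∈ 𝓝 (1 : G), ∃ N ∈ 𝓝 m₀, IsOpen N ∧ ContMDiffOn 𝓘(ℝ, E) 𝓘(ℝ, EG) ∞ h₀ N ∧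
      ∀ k ∈ U, ∀ m ∈ N, k • m ∈ N → h₀ (k • m) = k * h₀ m := by
  have : IsTopologicalGroup G := topologicalGroup_of_lieGroup 𝓘(ℝ, EG) ∞
  obtain ⟨F, c, a, V, hVopen, hm₀V, ha, ha₀, hsol, Q, hQ, huniq⟩ :=
    exists_local_solution (EG := EG) (G := G) m₀ hinj
  have hac : ContinuousAt a m₀ := (ha.continuousOn).continuousAt (hVopen.mem_nhds hm₀V)
  have hev : ∀ᶠ p : M × G × M in 𝓝 (m₀, 1, m₀), (a p.1 * p.2.1, p.2.2) ∈ Q := by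
    have hc0 : ContinuousAt (fun p : M × G × M => a p.1) (m₀, 1, m₀) :=
      ContinuousAt.comp (f := Prod.fst) (x := (m₀, (1 : G), m₀)) hac continuousAt_fst
    have hc1 : ContinuousAt (fun p : M × G × M => (a p.1 * p.2.1, p.2.2)) (m₀, 1, m₀) :=
      (hc0.mul (by fun_prop)).prodMk (by fun_prop)
    refine hc1.eventually_mem ?_
    simpa only [ha₀, mul_one] using hQ
  rw [nhds_prod_eq, nhds_prod_eq] at hev
  obtain ⟨N₁, hN₁, Q', hQ', hNQ⟩ := mem_prod_iff.1 hev
  obtain ⟨U, hU, N₂, hN₂, hUN⟩ := mem_prod_iff.1 hQ'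
  obtain ⟨N, hNsub, hNopen, hmN⟩ := mem_nhds_iff.1
    (inter_mem (inter_mem hN₁ hN₂) (hVopen.mem_nhds hm₀V))
  refine ⟨fun m => (a m)⁻¹, U, hU, N, hNopen.mem_nhds hmN, hNopen,
    ContMDiffOn.inv (ha.mono fun m hm => (hNsub hm).2), ?_⟩
  intro k hk m hm hkm
  have h1 : (a (k • m) * k, m) ∈ Q :=
    hNQ (Set.mk_mem_prod (hNsub hkm).1.1 (hUN (Set.mk_mem_prod hk (hNsub hm).1.2)))
  have h2 := huniq (a (k • m) * k) m (hNsub hm).2 h1 (by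
    rw [mul_smul]
    exact hsol _ (hNsub hkm).2)
  change (a (k • m))⁻¹ = k * (a m)⁻¹
  rw [← h2]
  group

/-- A free proper action moves no point near `m₀` to a point near `m₀`, except by group elements
near the identity. -/
theorem exists_nhds_small_translates {G M : Type*} [TopologicalSpace G] [Group G]
    [TopologicalSpace M] [MulAction G M] [ProperSMul G M]
    (hfree : ∀ (g : G) (m : M), g • m = m → g = 1) {U : Set G} (hU : U ∈ 𝓝 (1 : G)) (m₀ : M) :
    ∃ N ∈ 𝓝 m₀, ∀ (k : G) (m : M), m ∈ N → k • m ∈ N → k ∈ U := by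
  obtain ⟨U', hU'U, hU'o, h1⟩ := mem_nhds_iff.1 hU
  have hcl : IsClosed ((fun p : G × M => (p.1 • p.2, p.2)) '' (U'ᶜ ×ˢ Set.univ)) :=
    (ProperSMul.isProperMap_smul_pair (G := G) (X := M)).isClosedMap _
      (hU'o.isClosed_compl.prod isClosed_univ)
  have hm : (m₀, m₀) ∉ (fun p : G × M => (p.1 • p.2, p.2)) '' (U'ᶜ ×ˢ Set.univ) := by
    rintro ⟨⟨k, m⟩, ⟨hk, -⟩, h⟩
    obtain ⟨h2, h3⟩ := Prod.ext_iff.1 h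
    simp only at h2 h3
    subst h3
    exact hk ((hfree k m h2) ▸ h1)
  have hnh := hcl.isOpen_compl.mem_nhds hm
  rw [nhds_prod_eq] at hnh
  obtain ⟨N, hN, hNN⟩ := mem_prod_same_iff.1 hnh
  refine ⟨N, hN, fun k m hmN hkm => by_contra fun hk => ?_⟩
  exact hNN (Set.mk_mem_prod hkm hmN) ⟨(k, m), ⟨fun h => hk (hU'U h), trivial⟩, rfl⟩

/-- The slice theorem for a free proper action: around every point there is an invariant open set
with a smooth equivariant map to `G`. -/
theorem exists_equivariant_map [FiniteDimensional ℝ EG] [FiniteDimensional ℝ E] [ProperSMul G M]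
    (hfree : ∀ (g : G) (m : M), g • m = m → g = 1) (m₀ : M)
    (hinj : ∀ ξ : GroupLieAlgebra 𝓘(ℝ, EG) G,
      (fundamentalField ξ m₀ : TangentSpace 𝓘(ℝ, E) m₀) = 0 → ξ = 0) :
    ∃ (W : Set M) (h : M → G), IsOpen W ∧ m₀ ∈ W ∧ (∀ (g : G), ∀ m ∈ W, g • m ∈ W) ∧
      ContMDiffOn 𝓘(ℝ, E) 𝓘(ℝ, EG) ∞ h W ∧ ∀ (g : G), ∀ m ∈ W, h (g • m) = g * h m := by
  have : ContinuousSMul G M := ContMDiffSMul.continuousSMul (I := 𝓘(ℝ, EG)) (I' := 𝓘(ℝ, E)) ∞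
  obtain ⟨h₀, U, hU, N₁, hN₁, hN₁o, hh₀, heq⟩ :=
    exists_local_equivariant (EG := EG) (G := G) m₀ hinj
  obtain ⟨N₂, hN₂, hsmall⟩ := exists_nhds_small_translates hfree hU m₀
  obtain ⟨N, hNsub, hNo, hmN⟩ := mem_nhds_iff.1 (inter_mem hN₁ hN₂)
  -- on the saturation of `N`, set `h (g • n) = g * h₀ n`
  have hwd : ∀ (g g' : G) (n n' : M), n ∈ N → n' ∈ N → g • n = g' • n' →
      g * h₀ n = g' * h₀ n' := by
    intro g g' n n' hn hn' h
    have h1 : n' = (g'⁻¹ * g) • n := by rw [mul_smul, h, inv_smul_smul]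
    have h2 : g'⁻¹ * g ∈ U := hsmall _ n (hNsub hn).2 (h1 ▸ (hNsub hn').2)
    have h3 := heq _ h2 n (hNsub hn).1 (h1 ▸ (hNsub hn').1)
    rw [← h1] at h3
    rw [h3]
    group
  classical
  let W : Set M := {m | ∃ g : G, g⁻¹ • m ∈ N}
  let h : M → G := fun m => if hm : m ∈ W then hm.choose * h₀ (hm.choose⁻¹ • m) else 1
  have hval : ∀ (g : G) (m : M), g⁻¹ • m ∈ N → h m = g * h₀ (g⁻¹ • m) := by
    intro g m hg
    have hm : m ∈ W := ⟨g, hg⟩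
    simp only [h, dif_pos hm]
    exact hwd _ _ _ _ hm.choose_spec hg (by rw [smul_inv_smul, smul_inv_smul])
  have hWo : ∀ g : G, IsOpen {m : M | g⁻¹ • m ∈ N} := fun g =>
    hNo.preimage (continuous_const_smul g⁻¹)
  refine ⟨W, h, ?_, ⟨1, by simpa using hmN⟩, ?_, ?_, ?_⟩
  · have : W = ⋃ g : G, {m : M | g⁻¹ • m ∈ N} := by ext m; simp [W]
    rw [this]
    exact isOpen_iUnion hWo
  · rintro g m ⟨k, hk⟩
    exact ⟨g * k, by rwa [mul_inv_rev, mul_smul, inv_smul_smul]⟩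
  · rintro m ⟨g, hg⟩
    have hsm : ContMDiffAt 𝓘(ℝ, E) 𝓘(ℝ, EG) ∞ (fun m => g * h₀ (g⁻¹ • m)) m := by
      refine contMDiffAt_const.mul ?_
      have h1 : ContMDiffAt 𝓘(ℝ, E) 𝓘(ℝ, EG) ∞ h₀ (g⁻¹ • m) :=
        hh₀.contMDiffAt (hN₁o.mem_nhds (hNsub hg).1)
      exact h1.comp m ((isSmoothAction_smul (EG := EG) (G := G)).smooth_left g⁻¹).contMDiffAt
    refine (hsm.congr_of_eventuallyEq ?_).contMDiffWithinAt
    filter_upwards [(hWo g).mem_nhds hg] with x hx using hval g x hx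
  · rintro g m ⟨k, hk⟩
    have h1 : (g * k)⁻¹ • g • m = k⁻¹ • m := by rw [mul_inv_rev, mul_smul, inv_smul_smul]
    rw [hval k m hk, hval (g * k) (g • m) (by rwa [h1]), h1, mul_assoc]

end Slice

/-! ### Lagrangians in canonical coordinates -/

section Coordinates

open Topology Filter

variable {E : Type*} [NormedAddCommGroup E] [NormedSpace ℝ E]
  {M : Type*} [TopologicalSpace M] [ChartedSpace E M] [IsManifold 𝓘(ℝ, E) ∞ M]

theorem mem_tangentCoord_source (p : M) (u : TangentBundle 𝓘(ℝ, E) M) :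
    u ∈ (tangentCoord (E := E) p).source ↔ u.proj ∈ (extChartAt 𝓘(ℝ, E) p).source := by
  rw [tangentCoord, extChartAt_source, extChartAt_source, TangentBundle.mem_chart_source_iff]

theorem mdifferentiableAt_chart {p m : M} (hm : m ∈ (extChartAt 𝓘(ℝ, E) p).source) :
    MDifferentiableAt 𝓘(ℝ, E) 𝓘(ℝ, E) (extChartAt 𝓘(ℝ, E) p) m := by
  refine (contMDiffAt_extChartAt' (n := ∞) ?_).mdifferentiableAt (by simp)
  rwa [← extChartAt_source 𝓘(ℝ, E)]

/-- The derivative at `m` of the chart of `M` at `p`, as an endomorphism of the model space. -/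
def chartD (E : Type*) {M : Type*} [NormedAddCommGroup E] [NormedSpace ℝ E] [TopologicalSpace M]
    [ChartedSpace E M] (p m : M) : E →L[ℝ] E :=
  mfderiv 𝓘(ℝ, E) 𝓘(ℝ, E) (extChartAt 𝓘(ℝ, E) p) m

theorem tangentCoord_apply (p : M) {u : TangentBundle 𝓘(ℝ, E) M}
    (hu : u.proj ∈ (extChartAt 𝓘(ℝ, E) p).source) :
    tangentCoord p u = (extChartAt 𝓘(ℝ, E) p u.proj,
      chartD E p u.proj u.snd) := by
  rw [extChartAt_source] at hu
  refine Prod.ext rfl ?_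
  have h1 := TangentBundle.continuousLinearMapAt_trivializationAt (I := 𝓘(ℝ, E)) hu
  have h2 : (chartD E p u.proj : E → E) =
      ((trivializationAt E (TangentSpace 𝓘(ℝ, E)) p).continuousLinearMapAt ℝ u.proj : E → E) :=
    congrArg (fun T : E →L[ℝ] E => (T : E → E)) h1.symm
  change _ = chartD E p u.proj u.snd
  rw [h2]
  exact (congrFun (Bundle.Trivialization.coe_linearMapAt_of_mem
    (e := trivializationAt E (TangentSpace 𝓘(ℝ, E)) p) (R := ℝ) hu) u.snd).symm

theorem contMDiffOn_tangentCoord (p : M) :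
    ContMDiffOn 𝓘(ℝ, E).tangent 𝓘(ℝ, E × E) ∞ (tangentCoord (E := E) p)
      (tangentCoord (E := E) p).source := by
  have := contMDiffOn_extChartAt (I := 𝓘(ℝ, E).tangent) (n := ∞)
    (x := (⟨p, 0⟩ : TangentBundle 𝓘(ℝ, E) M))
  rwa [← extChartAt_source 𝓘(ℝ, E).tangent] at this

theorem contMDiffOn_tangentCoord_symm (p : M) :
    ContMDiffOn 𝓘(ℝ, E × E) 𝓘(ℝ, E).tangent ∞ (tangentCoord (E := E) p).symm
      (tangentCoord (E := E) p).target :=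
  contMDiffOn_extChartAt_symm _

theorem isOpen_tangentCoord_source (p : M) : IsOpen (tangentCoord (E := E) p).source :=
  isOpen_extChartAt_source _

theorem isOpen_tangentCoord_target (p : M) : IsOpen (tangentCoord (E := E) p).target :=
  isOpen_extChartAt_target _

theorem mdifferentiableAt_tangentCoord {p : M} {u : TangentBundle 𝓘(ℝ, E) M}
    (hu : u ∈ (tangentCoord (E := E) p).source) :
    MDifferentiableAt 𝓘(ℝ, E).tangent 𝓘(ℝ, E × E) (tangentCoord (E := E) p) u :=
  ((contMDiffOn_tangentCoord p).contMDiffAt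
    ((isOpen_tangentCoord_source p).mem_nhds hu)).mdifferentiableAt (by simp)

/-- The expression of `L` in the canonical coordinates at `p`. -/
def localL (L : TangentBundle 𝓘(ℝ, E) M → ℝ) (p : M) (z : E × E) : ℝ :=
  L ((tangentCoord p).symm z)

theorem contDiffAt_localL {L : TangentBundle 𝓘(ℝ, E) M → ℝ}
    (hL : ContMDiff 𝓘(ℝ, E).tangent 𝓘(ℝ, ℝ) ∞ L) {p : M} {z : E × E}
    (hz : z ∈ (tangentCoord (E := E) p).target) : ContDiffAt ℝ ∞ (localL L p) z := by
  rw [← contMDiffAt_iff_contDiffAt]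
  exact (hL.contMDiffAt).comp z ((contMDiffOn_tangentCoord_symm p).contMDiffAt
    ((isOpen_tangentCoord_target p).mem_nhds hz))

/-- The second derivative of a function as an iterated directional derivative. -/
theorem fderiv_fderiv_apply {V : Type*} [NormedAddCommGroup V] [NormedSpace ℝ V] {f : V → ℝ} {z : V}
    (hf : ContDiffAt ℝ ∞ f z) (v w : V) :
    fderiv ℝ (fun y => fderiv ℝ f y w) z v = fderiv ℝ (fderiv ℝ f) z v w := by
  have h1 : DifferentiableAt ℝ (fderiv ℝ f) z :=
    (hf.fderiv_right (m := ∞) (by simp)).differentiableAt (by simp)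
  rw [fderiv_clm_apply h1 (differentiableAt_const w)]
  simp

theorem deriv_deriv_eq_fderiv_fderiv {V : Type*} [NormedAddCommGroup V] [NormedSpace ℝ V]
    {f : V → ℝ} {z : V} (hf : ContDiffAt ℝ ∞ f z) (v w : V) :
    deriv (fun s : ℝ => deriv (fun t : ℝ => f (z + s • v + t • w)) 0) 0 =
      fderiv ℝ (fderiv ℝ f) z v w := by
  have hd : ∀ᶠ y in 𝓝 z, DifferentiableAt ℝ f y :=
    ((hf.of_le (m := 1) (by exact_mod_cast le_top)).eventually (by simp)).mono
      fun y hy => hy.differentiableAt (by simp)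
  have hline : ContinuousAt (fun s : ℝ => z + s • v) 0 := by fun_prop
  have h1 : (fun s : ℝ => deriv (fun t : ℝ => f (z + s • v + t • w)) 0) =ᶠ[𝓝 0]
      fun s : ℝ => fderiv ℝ f (z + s • v) w := by
    have h2 := hline.eventually (p := fun y => DifferentiableAt ℝ f y) (by simpa using hd)
    filter_upwards [h2] with s hs
    have h3 : HasDerivAt (fun t : ℝ => z + s • v + t • w) w 0 := by
      simpa using ((hasDerivAt_id (0 : ℝ)).smul_const w).const_add (z + s • v)
    have h4 : HasFDerivAt f (fderiv ℝ f (z + s • v)) (z + s • v + (0 : ℝ) • w) := by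
      simpa using hs.hasFDerivAt
    exact (h4.comp_hasDerivAt (0 : ℝ) h3).deriv
  rw [h1.deriv_eq, ← fderiv_fderiv_apply hf]
  have h5 : HasDerivAt (fun s : ℝ => z + s • v) v 0 := by
    simpa using ((hasDerivAt_id (0 : ℝ)).smul_const v).const_add z
  have h6 : DifferentiableAt ℝ (fun y => fderiv ℝ f y w) z :=
    ((hf.fderiv_right (m := ∞) (by simp)).differentiableAt (by simp)).clm_apply
      (differentiableAt_const w)
  have h7 : HasFDerivAt (fun y => fderiv ℝ f y w) (fderiv ℝ (fun y => fderiv ℝ f y w) z)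
      (z + (0 : ℝ) • v) := by simpa using h6.hasFDerivAt
  exact (h7.comp_hasDerivAt (0 : ℝ) h5).deriv

/-- The Hessian of `L` is the vertical block of the second derivative in canonical coordinates. -/
theorem hessian_eq_coord {L : TangentBundle 𝓘(ℝ, E) M → ℝ}
    (hL : ContMDiff 𝓘(ℝ, E).tangent 𝓘(ℝ, ℝ) ∞ L) {p : M} {u : TangentBundle 𝓘(ℝ, E) M}
    (hu : u ∈ (tangentCoord (E := E) p).source) (v w : TangentSpace 𝓘(ℝ, E) u.proj) :
    hessian L u v w = fderiv ℝ (fderiv ℝ (localL L p)) (tangentCoord p u)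
      ((0 : E), chartD E p u.proj v)
      ((0 : E), chartD E p u.proj w) := by
  rw [← deriv_deriv_eq_fderiv_fderiv
    (contDiffAt_localL hL ((tangentCoord (E := E) p).map_source hu)), hessian]
  congr 1
  funext s
  congr 1
  funext t
  have hp := (mem_tangentCoord_source p u).1 hu
  set q : TangentBundle 𝓘(ℝ, E) M := ⟨u.proj, u.snd + s • v + t • w⟩ with hq
  have hqs : q ∈ (tangentCoord (E := E) p).source := (mem_tangentCoord_source p q).2 hp
  have h1 : tangentCoord p q = tangentCoord p u +
      s • ((0 : E), chartD E p u.proj v) +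
      t • ((0 : E), chartD E p u.proj w) := by
    rw [tangentCoord_apply p hp, tangentCoord_apply p (u := q) hp]
    refine Prod.ext (by simp [hq]) ?_
    let D : E →L[ℝ] E := chartD E p u.proj
    let v' : E := v
    let w' : E := w
    let u' : E := u.snd
    change D (u' + s • v' + t • w') = D u' + s • D v' + t • D w'
    simp
  rw [← h1, localL, (tangentCoord p).left_inv hqs]

theorem isInvertible_mfderiv_chart {p m : M} (hm : m ∈ (extChartAt 𝓘(ℝ, E) p).source) :
    (chartD E p m).IsInvertible :=
  isInvertible_mfderiv_extChartAt (I := 𝓘(ℝ, E)) hm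

/-- The second-order condition in canonical coordinates. -/
theorem IsEulerLagrangeField.coord_fst {L : TangentBundle 𝓘(ℝ, E) M → ℝ}
    {Γ : (u : TangentBundle 𝓘(ℝ, E) M) → TangentSpace 𝓘(ℝ, E).tangent u}
    (hΓ : IsEulerLagrangeField L Γ) {p : M} {u : TangentBundle 𝓘(ℝ, E) M}
    (hu : u ∈ (tangentCoord (E := E) p).source) :
    (mfderiv 𝓘(ℝ, E).tangent 𝓘(ℝ, E × E) (tangentCoord p) u (Γ u) : E × E).1 =
      (tangentCoord p u).2 := by
  have hp := (mem_tangentCoord_source p u).1 hu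
  have h1 := mfderiv_comp u (g := (Prod.fst : E × E → E)) (I'' := 𝓘(ℝ, E))
    (differentiableAt_fst.mdifferentiableAt) (mdifferentiableAt_tangentCoord hu)
  have h2 := mfderiv_comp u (mdifferentiableAt_chart hp) (mdifferentiableAt_tangent_proj u)
  rw [tangentCoord_apply p hp]
  change _ = chartD E p u.proj u.snd
  refine Eq.trans ?_ (congrArg (chartD E p u.proj) (hΓ.second_order u))
  rw [mfderiv_eq_fderiv, fderiv_fst] at h1
  have h3 : (Prod.fst ∘ tangentCoord (E := E) p) =
      (extChartAt 𝓘(ℝ, E) p ∘ fun x : TangentBundle 𝓘(ℝ, E) M => x.proj) := rfl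
  rw [h3] at h1
  exact congrArg (fun T : E × E →L[ℝ] E => T (Γ u)) (h1.symm.trans h2)

end Coordinates

/-! ### Invariance of the Euler-Lagrange field -/

section Invariance

open Topology Filter

theorem _root_.ContDiffAt.hasFDerivAt_fderiv {V W : Type*} [NormedAddCommGroup V]
    [NormedSpace ℝ V] [NormedAddCommGroup W] [NormedSpace ℝ W] {f : V → W} {x : V}
    (hf : ContDiffAt ℝ ∞ f x) : HasFDerivAt (fderiv ℝ f) (fderiv ℝ (fderiv ℝ f) x) x :=
  ((hf.fderiv_right (m := ∞) (by simp)).differentiableAt (by simp)).hasFDerivAt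

theorem _root_.ContDiffAt.eventually_hasFDerivAt {V W : Type*} [NormedAddCommGroup V]
    [NormedSpace ℝ V] [NormedAddCommGroup W] [NormedSpace ℝ W] {f : V → W} {x : V}
    (hf : ContDiffAt ℝ ∞ f x) : ∀ᶠ y in 𝓝 x, HasFDerivAt f (fderiv ℝ f y) y :=
  ((hf.of_le (m := 1) (by exact_mod_cast le_top)).eventually (by simp)).mono
    fun y hy => (hy.differentiableAt (by simp)).hasFDerivAt

variable {E : Type*} [NormedAddCommGroup E] [NormedSpace ℝ E]

/-- The derivative of the tangent prolongation `(x, y) ↦ (φ x, Dφ(x) y)`. -/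
theorem hasFDerivAt_prolongation {φ : E → E} {z : E × E}
    (h1 : HasFDerivAt φ (fderiv ℝ φ z.1) z.1)
    (h2 : HasFDerivAt (fderiv ℝ φ) (fderiv ℝ (fderiv ℝ φ) z.1) z.1) :
    ∃ A : E × E →L[ℝ] E × E,
      HasFDerivAt (fun z : E × E => (φ z.1, fderiv ℝ φ z.1 z.2)) A z ∧
      ∀ d : E × E, A d = (fderiv ℝ φ z.1 d.1,
        fderiv ℝ (fderiv ℝ φ) z.1 d.1 z.2 + fderiv ℝ φ z.1 d.2) := by
  have h3 : HasFDerivAt (fun z : E × E => φ z.1) _ z := h1.comp z hasFDerivAt_fst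
  have h4 : HasFDerivAt (fun z : E × E => fderiv ℝ φ z.1) _ z := h2.comp z hasFDerivAt_fst
  have h5 := h3.prodMk (h4.clm_apply (hasFDerivAt_snd (p := z)))
  refine ⟨_, h5, fun d => ?_⟩
  simp [add_comm]

/-- The Euler-Lagrange expression is covariant under the tangent prolongation of a coordinate
change `φ`. The second derivatives of `φ` cancel by their symmetry. -/
theorem eulerLagrange_covariance {l l' : E × E → ℝ} {φ : E → E} {x y : E}
    (hφ : ContDiffAt ℝ ∞ φ x) (hl' : ContDiffAt ℝ ∞ l' (φ x, fderiv ℝ φ x y))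
    (hl : l =ᶠ[𝓝 (x, y)] fun z => l' (φ z.1, fderiv ℝ φ z.1 z.2)) (a e : E) :
    fderiv ℝ (fun z => fderiv ℝ l z (0, e)) (x, y) (y, a) - fderiv ℝ l (x, y) (e, 0) =
      fderiv ℝ (fderiv ℝ l') (φ x, fderiv ℝ φ x y)
        (fderiv ℝ (fun z : E × E => (φ z.1, fderiv ℝ φ z.1 z.2)) (x, y) (y, a))
        (0, fderiv ℝ φ x e) -
      fderiv ℝ l' (φ x, fderiv ℝ φ x y) (fderiv ℝ φ x e, 0) := by
  set Φ : E × E → E × E := fun z => (φ z.1, fderiv ℝ φ z.1 z.2) with hΦ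
  have hφ' : ContDiffAt ℝ ∞ (fderiv ℝ φ) x := hφ.fderiv_right (by simp)
  have hφz : ∀ᶠ z : E × E in 𝓝 (x, y), HasFDerivAt φ (fderiv ℝ φ z.1) z.1 ∧
      HasFDerivAt (fderiv ℝ φ) (fderiv ℝ (fderiv ℝ φ) z.1) z.1 :=
    (continuous_fst.tendsto (x, y)).eventually
      (hφ.eventually_hasFDerivAt.and hφ'.eventually_hasFDerivAt)
  obtain ⟨A, hA, hAd⟩ := hasFDerivAt_prolongation (z := (x, y))
    hφ.eventually_hasFDerivAt.self_of_nhds hφ.hasFDerivAt_fderiv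
  have hl'z : ∀ᶠ z in 𝓝 (x, y), HasFDerivAt l' (fderiv ℝ l' (Φ z)) (Φ z) :=
    hA.continuousAt.eventually hl'.eventually_hasFDerivAt
  -- the fibre derivatives of `l` and `l'` near `(x, y)`
  have hfib : (fun z => fderiv ℝ l z (0, e)) =ᶠ[𝓝 (x, y)]
      fun z => fderiv ℝ l' (Φ z) (0, fderiv ℝ φ z.1 e) := by
    filter_upwards [hl.eventuallyEq_nhds, hφz, hl'z] with z h1 h2 h3
    obtain ⟨B, hB, hBd⟩ := hasFDerivAt_prolongation h2.1 h2.2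
    rw [h1.fderiv_eq, show (fun z : E × E => l' (φ z.1, fderiv ℝ φ z.1 z.2)) = l' ∘ Φ from rfl,
      (h3.comp z hB).fderiv, ContinuousLinearMap.comp_apply, hBd]
    simp
  have hd1 : HasFDerivAt (fun z => fderiv ℝ l' (Φ z)) _ (x, y) :=
    HasFDerivAt.comp (x, y) (f := Φ) (g := fderiv ℝ l') hl'.hasFDerivAt_fderiv hA
  have hd2 : HasFDerivAt (fun z : E × E => fderiv ℝ φ z.1) _ (x, y) :=
    HasFDerivAt.comp (x, y) (f := Prod.fst) hφ.hasFDerivAt_fderiv hasFDerivAt_fst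
  have hd3 := (hasFDerivAt_const (0 : E) (x, y)).prodMk
    (hd2.clm_apply (hasFDerivAt_const e (x, y)))
  have hd4 := (hd1.clm_apply hd3).fderiv
  have hbase : fderiv ℝ l (x, y) = (fderiv ℝ l' (Φ (x, y))).comp A := by
    rw [hl.fderiv_eq]
    exact (hl'z.self_of_nhds.comp (x, y) hA).fderiv
  have hsym : fderiv ℝ (fderiv ℝ φ) x y e = fderiv ℝ (fderiv ℝ φ) x e y :=
    (hφ.isSymmSndFDerivAt (by
      rw [minSmoothness_of_isRCLikeNormedField]
      exact ENat.LEInfty.out)).eq y e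
  rw [hfib.fderiv_eq, hd4, hbase, hA.fderiv]
  simp only [add_apply, ContinuousLinearMap.comp_apply,
    ContinuousLinearMap.flip_apply, ContinuousLinearMap.prod_apply, hAd,
    zero_apply, ContinuousLinearMap.coe_fst', map_zero, zero_add, add_zero,
    hsym]
  have hsplit : (fderiv ℝ φ x e, fderiv ℝ (fderiv ℝ φ) x e y) =
      ((fderiv ℝ φ x e, 0) : E × E) + (0, fderiv ℝ (fderiv ℝ φ) x e y) := by simp
  rw [hsplit, map_add]
  simp only [hΦ]
  ring

variable {EG : Type*} [NormedAddCommGroup EG] [NormedSpace ℝ EG]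
  {G : Type*} [TopologicalSpace G] [ChartedSpace EG G] [Group G]
  {M : Type*} [TopologicalSpace M] [ChartedSpace E M] [IsManifold 𝓘(ℝ, E) ∞ M]
  [MulAction G M]

/-- The action of `g` in the charts of `M` at `p` and `p'`. -/
def chartTranslate (E : Type*) [NormedAddCommGroup E] [NormedSpace ℝ E] [ChartedSpace E M]
    (g : G) (p p' : M) (x : E) : E :=
  extChartAt 𝓘(ℝ, E) p' (g • (extChartAt 𝓘(ℝ, E) p).symm x)

theorem contDiffAt_chartTranslate (ha : IsSmoothAction EG 𝓘(ℝ, E) (fun (g : G) (m : M) => g • m))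
    (g : G) {p p' m : M} (hm : m ∈ (extChartAt 𝓘(ℝ, E) p).source)
    (hgm : g • m ∈ (extChartAt 𝓘(ℝ, E) p').source) :
    ContDiffAt ℝ ∞ (chartTranslate E g p p') (extChartAt 𝓘(ℝ, E) p m) := by
  rw [← contMDiffAt_iff_contDiffAt]
  have h1 : ContMDiffAt 𝓘(ℝ, E) 𝓘(ℝ, E) ∞ (extChartAt 𝓘(ℝ, E) p).symm
      (extChartAt 𝓘(ℝ, E) p m) :=
    (contMDiffOn_extChartAt_symm p).contMDiffAt
      ((isOpen_extChartAt_target p).mem_nhds ((extChartAt 𝓘(ℝ, E) p).map_source hm))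
  have h2 := (ha.smooth_left g).contMDiffAt.comp _ h1
  refine ContMDiffAt.comp (I' := 𝓘(ℝ, E)) (g := extChartAt 𝓘(ℝ, E) p') _ ?_ h2
  simp only [(extChartAt 𝓘(ℝ, E) p).left_inv hm]
  refine contMDiffAt_extChartAt' ?_
  rwa [← extChartAt_source 𝓘(ℝ, E)]

theorem fderiv_chartTranslate (ha : IsSmoothAction EG 𝓘(ℝ, E) (fun (g : G) (m : M) => g • m))
    (g : G) {p p' m : M} (hm : m ∈ (extChartAt 𝓘(ℝ, E) p).source)
    (hgm : g • m ∈ (extChartAt 𝓘(ℝ, E) p').source) (v : TangentSpace 𝓘(ℝ, E) m) :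
    fderiv ℝ (chartTranslate E g p p') (extChartAt 𝓘(ℝ, E) p m) (chartD E p m v) =
      chartD E p' (g • m) (mfderiv 𝓘(ℝ, E) 𝓘(ℝ, E) (fun m : M => g • m) m v) := by
  have h1 : (chartTranslate E g p p' ∘ extChartAt 𝓘(ℝ, E) p) =ᶠ[𝓝 m]
      (extChartAt 𝓘(ℝ, E) p' ∘ fun m : M => g • m) := by
    filter_upwards [(isOpen_extChartAt_source (I := 𝓘(ℝ, E)) p).mem_nhds hm] with q hq
    simp only [Function.comp, chartTranslate, (extChartAt 𝓘(ℝ, E) p).left_inv hq]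
  have h2 := mfderiv_comp m
    ((contDiffAt_chartTranslate ha g hm hgm).differentiableAt (by simp)).mdifferentiableAt
    (mdifferentiableAt_chart hm)
  have h3 := mfderiv_comp m (mdifferentiableAt_chart hgm) (ha.mdiff_left g m)
  rw [mfderiv_eq_fderiv] at h2
  rw [h1.mfderiv_eq] at h2
  exact congrArg (fun T : E →L[ℝ] E => T v) (h2.symm.trans h3)

theorem tangentCoord_tangentAct (ha : IsSmoothAction EG 𝓘(ℝ, E) (fun (g : G) (m : M) => g • m))
    (g : G) {p p' : M} {u : TangentBundle 𝓘(ℝ, E) M}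
    (hu : u.proj ∈ (extChartAt 𝓘(ℝ, E) p).source)
    (hgu : g • u.proj ∈ (extChartAt 𝓘(ℝ, E) p').source) :
    tangentCoord p' (tangentAct g u) = (chartTranslate E g p p' (tangentCoord p u).1,
      fderiv ℝ (chartTranslate E g p p') (tangentCoord p u).1 (tangentCoord p u).2) := by
  rw [tangentCoord_apply p hu, tangentCoord_apply p' (u := tangentAct g u) hgu,
    fderiv_chartTranslate ha g hu hgu]
  simp only [chartTranslate, (extChartAt 𝓘(ℝ, E) p).left_inv hu]
  rfl

/-- The Euler-Lagrange field of a regular invariant Lagrangian is invariant: its translates satisfy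
the Euler-Lagrange equations, whose solution is unique by regularity. -/
theorem eulerLagrangeField_invariant [LieGroup 𝓘(ℝ, EG) ∞ G]
    [ContMDiffSMul 𝓘(ℝ, EG) 𝓘(ℝ, E) ∞ G M] {L : TangentBundle 𝓘(ℝ, E) M → ℝ}
    (hL : ContMDiff 𝓘(ℝ, E).tangent 𝓘(ℝ, ℝ) ∞ L) (hreg : IsRegular L)
    (ha : IsSmoothAction EG 𝓘(ℝ, E) (fun (g : G) (m : M) => g • m))
    (hinv : ∀ (g : G) (u : TangentBundle 𝓘(ℝ, E) M), L (tangentAct g u) = L u)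
    {Γ : (u : TangentBundle 𝓘(ℝ, E) M) → TangentSpace 𝓘(ℝ, E).tangent u}
    (hΓ : IsEulerLagrangeField L Γ) (g : G) (u : TangentBundle 𝓘(ℝ, E) M) :
    mfderiv 𝓘(ℝ, E).tangent 𝓘(ℝ, E).tangent
      (fun x : TangentBundle 𝓘(ℝ, E) M => tangentAct g x) u (Γ u) = Γ (tangentAct g u) := by
  have hT := isSmoothAction_tangentAct (EG := EG) (G := G) (E := E) (M := M)
  set p := u.proj with hp
  set p' := g • u.proj with hp'
  have hu : u.proj ∈ (extChartAt 𝓘(ℝ, E) p).source := mem_extChartAt_source _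
  have hgu : g • u.proj ∈ (extChartAt 𝓘(ℝ, E) p').source := mem_extChartAt_source _
  have hus : u ∈ (tangentCoord (E := E) p).source := (mem_tangentCoord_source p u).2 hu
  have hgus : tangentAct g u ∈ (tangentCoord (E := E) p').source :=
    (mem_tangentCoord_source p' _).2 hgu
  set φ := chartTranslate E g p p' with hφ
  set Φ : E × E → E × E := fun z => (φ z.1, fderiv ℝ φ z.1 z.2) with hΦ
  obtain ⟨⟨x, y⟩, hxy⟩ : ∃ z, tangentCoord (E := E) p u = z := ⟨_, rfl⟩
  have hx : x = extChartAt 𝓘(ℝ, E) p u.proj := by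
    have := tangentCoord_apply p hu
    rw [hxy] at this
    exact (Prod.ext_iff.1 this).1
  have hφc : ContDiffAt ℝ ∞ φ x := hx ▸ contDiffAt_chartTranslate ha g hu hgu
  have hcoord : tangentCoord p' (tangentAct g u) = Φ (x, y) := by
    rw [tangentCoord_tangentAct ha g hu hgu, hxy]
  -- coordinates of `Γ u`, of its translate and of `Γ (g • u)`
  set V : E × E := mfderiv 𝓘(ℝ, E).tangent 𝓘(ℝ, E × E) (tangentCoord p) u (Γ u) with hV
  set V' : E × E := mfderiv 𝓘(ℝ, E).tangent 𝓘(ℝ, E × E) (tangentCoord p') (tangentAct g u)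
    (mfderiv 𝓘(ℝ, E).tangent 𝓘(ℝ, E).tangent
      (fun x : TangentBundle 𝓘(ℝ, E) M => tangentAct g x) u (Γ u)) with hV'
  set Y : E × E := mfderiv 𝓘(ℝ, E).tangent 𝓘(ℝ, E × E) (tangentCoord p') (tangentAct g u)
    (Γ (tangentAct g u)) with hY
  have hV1 : V = (y, V.2) := by
    refine Prod.ext ?_ rfl
    have := hΓ.coord_fst hus
    rw [hxy] at this
    exact this
  have hΦd : DifferentiableAt ℝ Φ (x, y) := by
    obtain ⟨A, hA, -⟩ := hasFDerivAt_prolongation (z := (x, y))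
      hφc.eventually_hasFDerivAt.self_of_nhds hφc.hasFDerivAt_fderiv
    exact hA.differentiableAt
  have hgev : ∀ᶠ q : TangentBundle 𝓘(ℝ, E) M in 𝓝 u,
      q.proj ∈ (extChartAt 𝓘(ℝ, E) p).source ∧ g • q.proj ∈ (extChartAt 𝓘(ℝ, E) p').source := by
    have hc := FiberBundle.continuous_proj E (TangentSpace 𝓘(ℝ, E) : M → Type _)
    have hc2 := (ha.smooth_left g).continuous.comp hc
    exact (hc.continuousAt.eventually_mem ((isOpen_extChartAt_source p).mem_nhds hu)).and
      (hc2.continuousAt.eventually_mem ((isOpen_extChartAt_source p').mem_nhds hgu))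
  have hVV' : V' = fderiv ℝ Φ (x, y) V := by
    have h1 := mfderiv_comp u (mdifferentiableAt_tangentCoord hgus) (hT.mdiff_left g u)
    have h2 : (tangentCoord (E := E) p' ∘ fun x => tangentAct g x) =ᶠ[𝓝 u]
        Φ ∘ tangentCoord (E := E) p := by
      filter_upwards [hgev] with q hq
      exact tangentCoord_tangentAct ha g hq.1 hq.2
    rw [h2.mfderiv_eq, mfderiv_comp u (by rw [hxy]; exact hΦd.mdifferentiableAt)
      (mdifferentiableAt_tangentCoord hus), mfderiv_eq_fderiv, hxy] at h1
    exact congrArg (fun T : E × E →L[ℝ] E × E => T (Γ u)) h1.symm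
  have hY1 : Y.1 = V'.1 := by
    have h1 := hΓ.coord_fst hgus
    rw [hcoord] at h1
    obtain ⟨A, hA, hAd⟩ := hasFDerivAt_prolongation (z := (x, y))
      hφc.eventually_hasFDerivAt.self_of_nhds hφc.hasFDerivAt_fderiv
    rw [hVV', hA.fderiv, hAd, hV1]
    exact h1
  have hl' : ContDiffAt ℝ ∞ (localL L p') (Φ (x, y)) :=
    contDiffAt_localL hL (hcoord ▸ (tangentCoord (E := E) p').map_source hgus)
  have hll : localL L p =ᶠ[𝓝 (x, y)] fun z => localL L p' (Φ z) := by
    have hzt : (x, y) ∈ (tangentCoord (E := E) p).target :=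
      hxy ▸ (tangentCoord (E := E) p).map_source hus
    have hsc : ContinuousAt (tangentCoord (E := E) p).symm (x, y) :=
      (contMDiffOn_tangentCoord_symm p).continuousOn.continuousAt
        ((isOpen_tangentCoord_target p).mem_nhds hzt)
    have hsu : (tangentCoord (E := E) p).symm (x, y) = u := by
      rw [← hxy, (tangentCoord p).left_inv hus]
    rw [← hsu] at hgev
    filter_upwards [hsc.eventually hgev, (isOpen_tangentCoord_target p).mem_nhds hzt]
      with z hz hzt
    have h1 : tangentCoord p' (tangentAct g ((tangentCoord p).symm z)) = Φ z := by
      rw [tangentCoord_tangentAct ha g hz.1 hz.2, (tangentCoord p).right_inv hzt]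
    change L _ = L _
    rw [← h1, (tangentCoord p').left_inv ((mem_tangentCoord_source p' _).2 hz.2), hinv]
  have hdual : ∀ e : E, fderiv ℝ (fderiv ℝ (localL L p')) (Φ (x, y)) (V' - Y)
      (0, fderiv ℝ φ x e) = 0 := by
    intro e
    have h1 : fderiv ℝ (fun z => fderiv ℝ (localL L p) z (0, e)) (x, y) V =
        fderiv ℝ (localL L p) (x, y) (e, 0) := by
      rw [← hxy]
      exact hΓ.euler_lagrange p u hus e
    have h2 : fderiv ℝ (fun z => fderiv ℝ (localL L p') z (0, fderiv ℝ φ x e)) (Φ (x, y)) Y =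
        fderiv ℝ (localL L p') (Φ (x, y)) (fderiv ℝ φ x e, 0) := by
      rw [← hcoord]
      exact hΓ.euler_lagrange p' (tangentAct g u) hgus (fderiv ℝ φ x e)
    have h3 := eulerLagrange_covariance hφc hl' hll V.2 e
    rw [← hV1, ← hVV', h1, sub_self] at h3
    rw [map_sub, sub_apply,
      ← fderiv_fderiv_apply hl' Y (0, fderiv ℝ φ x e), h2]
    exact h3.symm
  have hDinv := isInvertible_mfderiv_chart (E := E) hgu
  have hYV : V' = Y := by
    obtain ⟨D, hD⟩ := hDinv
    set w : E := D.symm (V'.2 - Y.2) with hw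
    have hwD : chartD E p' (g • u.proj) w = V'.2 - Y.2 := by
      rw [← hD]; simp [hw]
    have hw0 : w = 0 := by
      refine hreg (tangentAct g u) w fun w' => ?_
      refine (hessian_eq_coord hL hgus (w : E) w').trans ?_
      rw [hcoord]
      have h1 : ((0 : E), chartD E p' (tangentAct g u).proj w) = V' - Y := by
        refine Prod.ext ?_ ?_
        · simp [hY1]
        · exact hwD
      have h2 : (w' : E) = mfderiv 𝓘(ℝ, E) 𝓘(ℝ, E) (fun m : M => g • m) u.proj
          (mfderiv 𝓘(ℝ, E) 𝓘(ℝ, E) (fun m : M => g⁻¹ • m) (g • u.proj) w') :=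
        (ha.mfderiv_left_act_inv g u.proj w').symm
      have h3 := fderiv_chartTranslate ha g hu hgu
        (mfderiv 𝓘(ℝ, E) 𝓘(ℝ, E) (fun m : M => g⁻¹ • m) (g • u.proj) w' : E)
      rw [h1, h2]
      have h4 := hdual (chartD E p u.proj
        (mfderiv 𝓘(ℝ, E) 𝓘(ℝ, E) (fun m : M => g⁻¹ • m) (g • u.proj) w' : E))
      rw [hx, h3, ← hx] at h4
      exact h4
    rw [hw0, map_zero] at hwD
    exact Prod.ext hY1.symm (sub_eq_zero.1 hwD.symm)
  exact (isInvertible_mfderiv_extChartAt (I := 𝓘(ℝ, E).tangent) hgus).injective hYV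

end Invariance

/-! ### The generalized mechanical connection -/

section Invariance

variable {EG : Type*} [NormedAddCommGroup EG] [NormedSpace ℝ EG]
  {G : Type*} [Group G]
  {E : Type*} [NormedAddCommGroup E] [NormedSpace ℝ E]
  {M : Type*} [TopologicalSpace M] [ChartedSpace E M]
  [MulAction G M]
  {L : TangentBundle 𝓘(ℝ, E) M → ℝ}

/-- The Hessian of an invariant Lagrangian is invariant. -/
theorem hessian_tangentAct (hinv : ∀ (g : G) (u : TangentBundle 𝓘(ℝ, E) M),
      L (tangentAct g u) = L u) (g : G) (u : TangentBundle 𝓘(ℝ, E) M)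
    (v w : TangentSpace 𝓘(ℝ, E) u.proj) :
    hessian L (tangentAct g u) (mfderiv 𝓘(ℝ, E) 𝓘(ℝ, E) (fun m : M => g • m) u.proj v)
      (mfderiv 𝓘(ℝ, E) 𝓘(ℝ, E) (fun m : M => g • m) u.proj w) = hessian L u v w := by
  unfold hessian
  congr 1
  funext s
  congr 1
  funext t
  refine Eq.trans (congrArg L ?_) (hinv g ⟨u.proj, u.snd + s • v + t • w⟩)
  refine tangent_mk_congr (I := 𝓘(ℝ, E)) (N := M) rfl ?_
  let D : E →L[ℝ] E := mfderiv 𝓘(ℝ, E) 𝓘(ℝ, E) (fun m : M => g • m) u.proj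
  let v' : E := v
  let w' : E := w
  let u' : E := u.snd
  change D u' + s • D v' + t • D w' = D (u' + s • v' + t • w')
  simp

variable [TopologicalSpace G] [ChartedSpace EG G] [LieGroup 𝓘(ℝ, EG) ∞ G]
  [ContMDiffSMul 𝓘(ℝ, EG) 𝓘(ℝ, E) ∞ G M]

theorem fundamentalField_smul_point (g : G) (m : M) (η : GroupLieAlgebra 𝓘(ℝ, EG) G) :
    (fundamentalField η (g • m) : E) =
      mfderiv 𝓘(ℝ, E) 𝓘(ℝ, E) (fun m : M => g • m) m
        (fundamentalField (Ad g⁻¹ η) m : TangentSpace 𝓘(ℝ, E) m) := by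
  have ha := isSmoothAction_smul (EG := EG) (G := G) (E := E) (M := M)
  have h1 := ha.mfderiv_infGen g⁻¹ (g • m) η
  rw [inv_smul_smul] at h1
  have h2 := ha.mfderiv_left_act_inv g m (fundamentalField η (g • m))
  exact h2.symm.trans (congrArg (mfderiv 𝓘(ℝ, E) 𝓘(ℝ, E) (fun m : M => g • m) m) h1)

end Invariance

section Connection

open Topology Filter

variable {EG : Type*} [NormedAddCommGroup EG] [NormedSpace ℝ EG]
  {G : Type*} [TopologicalSpace G] [ChartedSpace EG G] [Group G]
  {E : Type*} [NormedAddCommGroup E] [NormedSpace ℝ E]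
  {M : Type*} [TopologicalSpace M] [ChartedSpace E M] [IsManifold 𝓘(ℝ, E) ∞ M]
  [MulAction G M]
  {L : TangentBundle 𝓘(ℝ, E) M → ℝ}

/-- The Hessian is a symmetric bilinear form. -/
theorem exists_hessian_eq_bilin (hL : ContMDiff 𝓘(ℝ, E).tangent 𝓘(ℝ, ℝ) ∞ L)
    (u : TangentBundle 𝓘(ℝ, E) M) :
    ∃ B : E →L[ℝ] E →L[ℝ] ℝ, (∀ v w : E, hessian L u v w = B v w) ∧
      ∀ v w : E, B v w = B w v := by
  have hu : u ∈ (tangentCoord (E := E) u.proj).source :=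
    (mem_tangentCoord_source _ _).2 (mem_extChartAt_source _)
  have hc := contDiffAt_localL hL ((tangentCoord (E := E) u.proj).map_source hu)
  refine ⟨(fderiv ℝ (fderiv ℝ (localL L u.proj)) (tangentCoord u.proj u)).bilinearComp
    ((ContinuousLinearMap.inr ℝ E E).comp (chartD E u.proj u.proj))
    ((ContinuousLinearMap.inr ℝ E E).comp (chartD E u.proj u.proj)),
    fun v w => hessian_eq_coord hL hu v w, fun v w => ?_⟩
  exact (hc.isSymmSndFDerivAt (by
      rw [minSmoothness_of_isRCLikeNormedField]
      exact ENat.LEInfty.out)).eq _ _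

/-- A linear functional-valued injective map on a finite-dimensional space is invertible. -/
theorem isInvertible_of_injective_dual {V : Type*} [NormedAddCommGroup V] [NormedSpace ℝ V]
    [FiniteDimensional ℝ V] (A : V →L[ℝ] V →L[ℝ] ℝ) (hA : ∀ v, A v = 0 → v = 0) :
    A.IsInvertible := by
  have hinj : Function.Injective (A : V →ₗ[ℝ] V →L[ℝ] ℝ) :=
    LinearMap.ker_eq_bot.1 (LinearMap.ker_eq_bot'.2 hA)
  have hfr : Module.finrank ℝ V = Module.finrank ℝ (V →L[ℝ] ℝ) := by
    rw [← (LinearMap.toContinuousLinearMap (𝕜 := ℝ) (E := V) (F' := ℝ)).finrank_eq]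
    exact (Subspace.dual_finrank_eq (K := ℝ) (V := V)).symm
  have : FiniteDimensional ℝ (V →L[ℝ] ℝ) :=
    (LinearMap.toContinuousLinearMap (𝕜 := ℝ) (E := V) (F' := ℝ)).finiteDimensional
  let e := LinearEquiv.ofInjectiveOfFinrankEq (A : V →ₗ[ℝ] V →L[ℝ] ℝ) hinj hfr
  exact ⟨e.toContinuousLinearEquiv, by ext v w; rfl⟩

/-- The fundamental field as a linear map in the Lie algebra element. -/
def fundL (EG G E : Type*) {M : Type*} [NormedAddCommGroup EG] [NormedSpace ℝ EG]
    [TopologicalSpace G] [ChartedSpace EG G] [Group G] [NormedAddCommGroup E] [NormedSpace ℝ E]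
    [TopologicalSpace M] [ChartedSpace E M] [MulAction G M] (m : M) : EG →L[ℝ] E :=
  mfderiv 𝓘(ℝ, EG) 𝓘(ℝ, E) (fun g : G => g • m) (1 : G)

theorem mechω_exists_unique [FiniteDimensional ℝ EG]
    (hL : ContMDiff 𝓘(ℝ, E).tangent 𝓘(ℝ, ℝ) ∞ L)
    (hnons : IsNonsingularOnFundamental EG G L) (u : TangentBundle 𝓘(ℝ, E) M)
    (v : TangentSpace 𝓘(ℝ, E) u.proj) :
    ∃! ξ : GroupLieAlgebra 𝓘(ℝ, EG) G, ∀ η : GroupLieAlgebra 𝓘(ℝ, EG) G,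
      hessian L u (v - fundamentalField ξ u.proj) (fundamentalField η u.proj) = 0 := by
  obtain ⟨B, hB, hBs⟩ := exists_hessian_eq_bilin hL u
  set X : EG →L[ℝ] E := fundL EG G E u.proj with hX
  let A : EG →L[ℝ] EG →L[ℝ] ℝ := B.bilinearComp X X
  have hA : ∀ ξ, A ξ = 0 → ξ = 0 := fun ξ h =>
    hnons u ξ fun η => (hB (X ξ) (X η)).trans (congrArg (fun T : EG →L[ℝ] ℝ => T η) h)
  obtain ⟨e, he⟩ := isInvertible_of_injective_dual A hA
  have hiff : ∀ ξ : EG, (∀ η : GroupLieAlgebra 𝓘(ℝ, EG) G,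
      hessian L u (v - fundamentalField (G := G) ξ u.proj) (fundamentalField η u.proj) = 0) ↔
      e ξ = (B (v : E)).comp X := by
    intro ξ
    have h1 : ∀ η : EG, hessian L u (v - fundamentalField (G := G) ξ u.proj)
        (fundamentalField (G := G) η u.proj) = B (v : E) (X η) - e ξ η := by
      intro η
      have h2 : e ξ η = B (X ξ) (X η) := by
        rw [← ContinuousLinearEquiv.coe_coe, he]; rfl
      rw [h2]
      let v' : E := v
      refine (hB (v' - X ξ) (X η)).trans ?_
      rw [map_sub, sub_apply]
    constructor
    · intro h
      ext η
      exact (sub_eq_zero.1 ((h1 η).symm.trans (h η))).symm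
    · intro h η
      refine (h1 η).trans ?_
      rw [h]
      exact sub_self _
  refine ⟨e.symm ((B (v : E)).comp X), (hiff _).2 (e.apply_symm_apply _), fun ξ hξ => ?_⟩
  exact (e.symm_apply_eq.2 ((hiff ξ).1 hξ).symm).symm

theorem mechω_eq_iff [FiniteDimensional ℝ EG]
    (hL : ContMDiff 𝓘(ℝ, E).tangent 𝓘(ℝ, ℝ) ∞ L) (hnons : IsNonsingularOnFundamental EG G L)
    (u : TangentBundle 𝓘(ℝ, E) M) (v : TangentSpace 𝓘(ℝ, E) u.proj)
    (ξ : GroupLieAlgebra 𝓘(ℝ, EG) G) :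
    mechω EG G L u v = ξ ↔ ∀ η : GroupLieAlgebra 𝓘(ℝ, EG) G,
      hessian L u (v - fundamentalField ξ u.proj) (fundamentalField η u.proj) = 0 := by
  have h1 := (mechω_exists_unique hL hnons u v)
  have h2 := Classical.epsilon_spec h1.exists
  exact ⟨fun h => h ▸ h2, fun h => h1.unique h2 h⟩

theorem mechω_add_fundamentalField [FiniteDimensional ℝ EG]
    (hL : ContMDiff 𝓘(ℝ, E).tangent 𝓘(ℝ, ℝ) ∞ L) (hnons : IsNonsingularOnFundamental EG G L)
    (u : TangentBundle 𝓘(ℝ, E) M)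
    (v : TangentSpace 𝓘(ℝ, E) u.proj) (ζ : GroupLieAlgebra 𝓘(ℝ, EG) G) :
    mechω EG G L u (v + fundamentalField ζ u.proj) = mechω EG G L u v + ζ := by
  rw [mechω_eq_iff hL hnons]
  intro η
  have h1 := (mechω_eq_iff hL hnons u v _).1 rfl η
  have h2 : (v + fundamentalField ζ u.proj -
      fundamentalField (mechω EG G L u v + ζ) u.proj : TangentSpace 𝓘(ℝ, E) u.proj) =
      v - fundamentalField (mechω EG G L u v) u.proj := by
    have h3 : (fundamentalField (mechω EG G L u v + ζ) u.proj : TangentSpace 𝓘(ℝ, E) u.proj) =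
        fundamentalField (mechω EG G L u v) u.proj + fundamentalField ζ u.proj :=
      map_add (mfderiv 𝓘(ℝ, EG) 𝓘(ℝ, E) (fun g : G => g • u.proj) (1 : G)) _ _
    rw [h3]
    abel
  rw [h2]
  exact h1

variable [LieGroup 𝓘(ℝ, EG) ∞ G] [ContMDiffSMul 𝓘(ℝ, EG) 𝓘(ℝ, E) ∞ G M]

/-- Equivariance of the mechanical connection. -/
theorem mechω_tangentAct [FiniteDimensional ℝ EG] (hL : ContMDiff 𝓘(ℝ, E).tangent 𝓘(ℝ, ℝ) ∞ L)
    (hnons : IsNonsingularOnFundamental EG G L)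
    (hinv : ∀ (g : G) (u : TangentBundle 𝓘(ℝ, E) M), L (tangentAct g u) = L u)
    (g : G) (u : TangentBundle 𝓘(ℝ, E) M) (v : TangentSpace 𝓘(ℝ, E) u.proj) :
    mechω EG G L (tangentAct g u) (mfderiv 𝓘(ℝ, E) 𝓘(ℝ, E) (fun m : M => g • m) u.proj v) =
      Ad g (mechω EG G L u v) := by
  have ha := isSmoothAction_smul (EG := EG) (G := G) (E := E) (M := M)
  refine (mechω_eq_iff hL hnons (tangentAct g u)
    (mfderiv 𝓘(ℝ, E) 𝓘(ℝ, E) (fun m : M => g • m) u.proj v : E) _).2 fun η => ?_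
  have h1 := (mechω_eq_iff hL hnons u v _).1 rfl (Ad g⁻¹ η)
  rw [← hessian_tangentAct hinv g] at h1
  have h2 := fundamentalField_smul_point (E := E) g u.proj η
  have h3 := ha.mfderiv_infGen g u.proj (mechω EG G L u v)
  let D : E →L[ℝ] E := mfderiv 𝓘(ℝ, E) 𝓘(ℝ, E) (fun m : M => g • m) u.proj
  let v' : E := v
  let x : E := fundamentalField (mechω EG G L u v) u.proj
  let y : E := fundamentalField (Ad g (mechω EG G L u v)) (g • u.proj)
  have h4 : D (v' - x) = D v' - y := (map_sub D v' x).trans (congrArg (fun z : E => D v' - z) h3)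
  have h5 : hessian L (tangentAct g u) (D v' - y : E)
      (fundamentalField η (g • u.proj) : E) = 0 := by
    rw [← h4, h2]
    exact h1
  exact h5


/-- The derivative of the orbit map in charts, as a map into the vertical directions. -/
def chartFund (EG G E : Type*) {M : Type*} [NormedAddCommGroup EG] [NormedSpace ℝ EG]
    [TopologicalSpace G] [ChartedSpace EG G] [Group G] [NormedAddCommGroup E] [NormedSpace ℝ E]
    [TopologicalSpace M] [ChartedSpace E M] [MulAction G M] (p : M) (x : E) : EG →L[ℝ] E × E :=
  (ContinuousLinearMap.inr ℝ E E).comp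
    ((fderiv ℝ (chartAct EG G E p) (extChartAt 𝓘(ℝ, EG) (1 : G) 1, x)).comp
      (ContinuousLinearMap.inl ℝ EG E))

theorem contDiffAt_chartFund {p : M} {x : E} (hx : x ∈ (extChartAt 𝓘(ℝ, E) p).target) :
    ContDiffAt ℝ ∞ (chartFund EG G E p) x := by
  have h0 : (extChartAt 𝓘(ℝ, EG) (1 : G) 1, x) ∈ chartActDomain EG G E p := by
    have := mem_chartActDomain (EG := EG) (G := G) p ((extChartAt 𝓘(ℝ, E) p).map_target hx)
    rwa [(extChartAt 𝓘(ℝ, E) p).right_inv hx] at this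
  have h1 : ContDiffAt ℝ ∞ (fderiv ℝ (chartAct EG G E p)) (extChartAt 𝓘(ℝ, EG) (1 : G) 1, x) :=
    ((contDiffOn_chartAct p).contDiffAt
      ((isOpen_chartActDomain p).mem_nhds h0)).fderiv_right (by simp)
  have h2 : ContDiffAt ℝ ∞ (fun x : E => fderiv ℝ (chartAct EG G E p)
      (extChartAt 𝓘(ℝ, EG) (1 : G) 1, x)) x :=
    h1.comp x (contDiffAt_const.prodMk contDiffAt_id)
  exact contDiffAt_const.clm_comp (h2.clm_comp contDiffAt_const)

/-- The mechanical connection evaluated on the tautological section `u ↦ u`, as a function on `TM`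
with values in the model space of `G`. -/
def mechωSelf (EG G : Type*) [NormedAddCommGroup EG] [NormedSpace ℝ EG]
    [TopologicalSpace G] [ChartedSpace EG G] [Group G] [MulAction G M]
    (L : TangentBundle 𝓘(ℝ, E) M → ℝ) (u : TangentBundle 𝓘(ℝ, E) M) : EG :=
  mechω EG G L u u.snd

/-- In coordinates `ω_u(u)` solves a linear system with smooth coefficients and invertible
matrix. -/
theorem contMDiff_mechωSelf [FiniteDimensional ℝ EG]
    (hL : ContMDiff 𝓘(ℝ, E).tangent 𝓘(ℝ, ℝ) ∞ L) (hnons : IsNonsingularOnFundamental EG G L) :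
    ContMDiff 𝓘(ℝ, E).tangent 𝓘(ℝ, EG) ∞ (mechωSelf EG G L) := by
  intro u₀
  set p := u₀.proj with hp
  let K : E × E → EG →L[ℝ] E × E := fun z => chartFund EG G E p z.1
  let A : E × E → EG →L[ℝ] EG →L[ℝ] ℝ := fun z =>
    ((ContinuousLinearMap.compL ℝ EG (E × E) ℝ).flip (K z)).comp
      ((fderiv ℝ (fderiv ℝ (localL L p)) z).comp (K z))
  let β : E × E → EG →L[ℝ] ℝ := fun z =>
    (fderiv ℝ (fderiv ℝ (localL L p)) z ((0 : E), z.2)).comp (K z)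
  have hu₀ : u₀ ∈ (tangentCoord (E := E) p).source :=
    (mem_tangentCoord_source _ _).2 (mem_extChartAt_source _)
  have hK : ∀ u ∈ (tangentCoord (E := E) p).source, ∀ ξ : EG, K (tangentCoord p u) ξ =
      ((0 : E), chartD E p u.proj (fundL EG G E u.proj ξ)) := by
    intro u hu ξ
    have h1 := (mem_tangentCoord_source p u).1 hu
    have h2 := mfderiv_chart_fundamentalField (EG := EG) (G := G) p h1 ξ
    refine Prod.ext rfl ?_
    rw [tangentCoord_apply p h1]
    exact h2.symm
  have hHK : ∀ u ∈ (tangentCoord (E := E) p).source, ∀ (v : TangentSpace 𝓘(ℝ, E) u.proj) (η : EG),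
      hessian L u v (fundamentalField (G := G) η u.proj) =
        fderiv ℝ (fderiv ℝ (localL L p)) (tangentCoord p u) ((0 : E), chartD E p u.proj v)
          (K (tangentCoord p u) η) :=
    fun u hu v η => (hessian_eq_coord hL hu _ _).trans (congrArg _ (hK u hu η).symm)
  have hA : ∀ u ∈ (tangentCoord (E := E) p).source, (A (tangentCoord p u)).IsInvertible := by
    intro u hu
    refine isInvertible_of_injective_dual _ fun ξ h => hnons u ξ fun η => ?_
    refine (hHK u hu _ η).trans ?_
    refine Eq.trans ?_ (congrArg (fun T : EG →L[ℝ] ℝ => T η) h)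
    exact congrArg (fun x => fderiv ℝ (fderiv ℝ (localL L p)) (tangentCoord p u) x
      (K (tangentCoord p u) η)) (hK u hu ξ).symm
  have hsol : ∀ u ∈ (tangentCoord (E := E) p).source, mechωSelf EG G L u =
      (A (tangentCoord p u)).inverse (β (tangentCoord p u)) := by
    intro u hu
    refine (mechω_eq_iff hL hnons u u.snd _).2 fun η => ?_
    set ξ : EG := (A (tangentCoord p u)).inverse (β (tangentCoord p u)) with hξ
    have h1 : A (tangentCoord p u) ξ = β (tangentCoord p u) := (hA u hu).self_apply_inverse _
    have h2 := congrArg (fun T : EG →L[ℝ] ℝ => T η) h1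
    change fderiv ℝ (fderiv ℝ (localL L p)) (tangentCoord p u) (K (tangentCoord p u) ξ)
      (K (tangentCoord p u) η) = fderiv ℝ (fderiv ℝ (localL L p)) (tangentCoord p u)
        ((0 : E), (tangentCoord p u).2) (K (tangentCoord p u) η) at h2
    refine (hHK u hu _ η).trans ?_
    have h3 : ((0 : E), chartD E p u.proj
        (u.snd - fundamentalField (G := G) ξ u.proj : TangentSpace 𝓘(ℝ, E) u.proj)) =
        ((0 : E), (tangentCoord p u).2) - K (tangentCoord p u) ξ := by
      rw [hK u hu, tangentCoord_apply p ((mem_tangentCoord_source p u).1 hu)]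
      let D : E →L[ℝ] E := chartD E p u.proj
      let x : E := u.snd
      let y : E := fundamentalField (G := G) ξ u.proj
      exact Prod.ext (sub_self (0 : E)).symm (map_sub D x y)
    rw [h3, map_sub, sub_apply, ← h2, sub_self]
  have hz₀ := (tangentCoord (E := E) p).map_source hu₀
  have hx₀ : (tangentCoord p u₀).1 ∈ (extChartAt 𝓘(ℝ, E) p).target := by
    rw [tangentCoord_apply p ((mem_tangentCoord_source p u₀).1 hu₀)]
    exact mem_extChartAt_target _
  have hH : ContDiffAt ℝ ∞ (fderiv ℝ (fderiv ℝ (localL L p))) (tangentCoord p u₀) :=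
    ((contDiffAt_localL hL hz₀).fderiv_right (m := ∞) (by simp)).fderiv_right (by simp)
  have hKs : ContDiffAt ℝ ∞ K (tangentCoord p u₀) :=
    (contDiffAt_chartFund hx₀).comp _ contDiffAt_fst
  have hAs : ContDiffAt ℝ ∞ A (tangentCoord p u₀) := by
    have h1 : ContDiffAt ℝ ∞ (fun z => (ContinuousLinearMap.compL ℝ EG (E × E) ℝ).flip (K z))
        (tangentCoord p u₀) := by fun_prop
    exact h1.clm_comp (hH.clm_comp hKs)
  have hβs : ContDiffAt ℝ ∞ β (tangentCoord p u₀) :=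
    (hH.clm_apply (contDiffAt_const.prodMk contDiffAt_snd)).clm_comp hKs
  have hω : ContDiffAt ℝ ∞ (fun z => (A z).inverse (β z)) (tangentCoord p u₀) :=
    ((hA u₀ hu₀).contDiffAt_map_inverse.comp _ hAs).clm_apply hβs
  have hnear := (isOpen_tangentCoord_source p).mem_nhds hu₀
  have hcomp := hω.contMDiffAt.comp u₀ ((contMDiffOn_tangentCoord p).contMDiffAt hnear)
  refine hcomp.congr_of_eventuallyEq ?_
  filter_upwards [hnear] with u hu
  exact hsol u hu

end Connection

/-! ### Lifting integral curves of a reduced field -/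

section Lifting

open Topology Filter

variable {EG : Type*} [NormedAddCommGroup EG] [NormedSpace ℝ EG]
  {G : Type*} [TopologicalSpace G] [ChartedSpace EG G] [Group G] [LieGroup 𝓘(ℝ, EG) ∞ G]
  {F : Type*} [NormedAddCommGroup F] [NormedSpace ℝ F]
  {H : Type*} [TopologicalSpace H] {I : ModelWithCorners ℝ F H}
  {N : Type*} [TopologicalSpace N] [ChartedSpace H N] [IsManifold I ∞ N]
  {a : G → N → N}

theorem contMDiffOn_mfderiv_field {q : N → F} {O : Set N} (hO : IsOpen O)
    (hq : ContMDiffOn I 𝓘(ℝ, F) ∞ q O) {Γ : (u : N) → TangentSpace I u}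
    (hΓ : ContMDiff I I.tangent ∞ (fun u => (⟨u, Γ u⟩ : TangentBundle I N))) :
    ContMDiffOn I 𝓘(ℝ, F) ∞ (fun u => (mfderiv I 𝓘(ℝ, F) q u (Γ u) : F)) O := by
  have h1 := (hq.contMDiffOn_tangentMapWithin (m := ∞) (by simp) hO.uniqueMDiffOn).comp
    hΓ.contMDiffOn (fun u hu => hu)
  have h2 := (contMDiff_snd_tangentBundle_modelSpace (n := ∞) F 𝓘(ℝ, F)).comp_contMDiffOn h1
  refine h2.congr fun u hu => ?_
  change _ = (mfderivWithin I 𝓘(ℝ, F) q O u (Γ u) : F)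
  rw [mfderivWithin_of_isOpen hO hu]

variable [I.Boundaryless]

/-- A coordinate system on the orbit space near the orbit of `u₀`, described upstairs: an invariant
map `q` separating the orbits in an invariant open set `O`, together with a local section `s`. -/
theorem IsSmoothAction.exists_orbit_coordinates (ha : IsSmoothAction EG I a) {O : Set N}
    (hO : IsOpen O) (hOinv : ∀ g, ∀ u ∈ O, a g u ∈ O) {h : N → G}
    (hh : ContMDiffOn I 𝓘(ℝ, EG) ∞ h O) (heq : ∀ g, ∀ u ∈ O, h (a g u) = g * h u)
    {u₀ : N} (hu₀ : u₀ ∈ O) :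
    ∃ (O' : Set N) (q : N → F) (s : F → N), IsOpen O' ∧ u₀ ∈ O' ∧ (∀ g, ∀ u ∈ O', a g u ∈ O') ∧
      ContMDiffOn I 𝓘(ℝ, F) ∞ q O' ∧ (∀ g, ∀ u ∈ O', q (a g u) = q u) ∧
      ContMDiffAt 𝓘(ℝ, F) I ∞ s (q u₀) ∧ ∀ u ∈ O', ∃ k, a k u = s (q u) := by
  -- `ρ` moves every point along its orbit to the slice `h = 1`
  let ρ : N → N := fun u => a (h u)⁻¹ u
  have hρs : ContMDiffOn I I ∞ ρ O := ha.smooth.comp_contMDiffOn (hh.inv.prodMk contMDiffOn_id)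
  have hρinv : ∀ g, ∀ u ∈ O, ρ (a g u) = ρ u := by
    intro g u hu
    change a (h (a g u))⁻¹ (a g u) = a (h u)⁻¹ u
    rw [heq g u hu, ← ha.mul, mul_inv_rev, inv_mul_cancel_right]
  set φ := extChartAt I (ρ u₀) with hφ
  have hO'o : IsOpen (O ∩ ρ ⁻¹' φ.source) :=
    hρs.continuousOn.isOpen_inter_preimage hO (isOpen_extChartAt_source _)
  refine ⟨O ∩ ρ ⁻¹' φ.source, φ ∘ ρ, φ.symm, hO'o, ⟨hu₀, mem_extChartAt_source _⟩, ?_, ?_, ?_, ?_,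
    ?_⟩
  · intro g u hu
    refine ⟨hOinv g u hu.1, ?_⟩
    rw [Set.mem_preimage, hρinv g u hu.1]
    exact hu.2
  · refine (contMDiffOn_extChartAt (x := ρ u₀)).comp (hρs.mono Set.inter_subset_left) fun u hu => ?_
    have := hu.2
    rwa [Set.mem_preimage, hφ, extChartAt_source] at this
  · intro g u hu
    exact congrArg φ (hρinv g u hu.1)
  · exact (contMDiffOn_extChartAt_symm (ρ u₀)).contMDiffAt
      ((isOpen_extChartAt_target _).mem_nhds (mem_extChartAt_target _))
  · intro u hu
    exact ⟨(h u)⁻¹, (φ.left_inv hu.2).symm⟩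

/-- Vector-valued derivatives can be tested by scalar functionals in finite dimension. -/
theorem hasDerivAt_of_forall_dual [FiniteDimensional ℝ F] {y : ℝ → F} {y' : F} {t : ℝ}
    (h : ∀ ℓ : F →L[ℝ] ℝ, HasDerivAt (fun s => ℓ (y s)) (ℓ y') t) : HasDerivAt y y' t := by
  let e := (Module.finBasis ℝ F).equivFunL
  have h1 : HasDerivAt (fun s => e (y s)) (e y') t := by
    rw [hasDerivAt_pi]
    intro i
    exact h ((ContinuousLinearMap.proj (R := ℝ) (φ := fun _ => ℝ) i).comp (e : F →L[ℝ] _))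
  have h2 := (e.symm : _ →L[ℝ] F).hasFDerivAt.comp_hasDerivAt t h1
  simpa [Function.comp_def] using h2

variable {Q : Type*} [TopologicalSpace Q] {pi : N → Q}

/-- An integral curve of an invariant field `Z` that differs from `Γ` by a field tangent to the
orbits projects to an integral curve of the field on the orbit space induced by `Γ`. The curve `c`
in the orbit space being given, `Z` has local integral curves over it through every point. -/
theorem IsSmoothAction.exists_local_lift [FiniteDimensional ℝ F] (ha : IsSmoothAction EG I a)
    (hpi : ∀ u v, pi u = pi v ↔ ∃ g, a g u = v) (hsurj : Function.Surjective pi)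
    (hopen : IsOpenMap pi) {Γ Z : (u : N) → TangentSpace I u}
    (hΓ : ContMDiff I I.tangent ∞ (fun u => (⟨u, Γ u⟩ : TangentBundle I N)))
    (hΓinv : ∀ g u, (mfderiv I I (a g) u (Γ u) : F) = Γ (a g u))
    (hZ : ContMDiff I I.tangent ∞ (fun u => (⟨u, Z u⟩ : TangentBundle I N)))
    (hZΓ : ∀ u, ∃ ξ, Z u = Γ u + infGen EG I a u ξ)
    {c : ℝ → Q} {t₀ : ℝ} (hcc : ContinuousAt c t₀)
    (hc : ∀ᶠ t in 𝓝 t₀, ∀ u, pi u = c t → ∀ (U : Set Q) (f : Q → ℝ), IsOpen U → c t ∈ U →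
      ContMDiffOn I 𝓘(ℝ, ℝ) ∞ (fun u => f (pi u)) (pi ⁻¹' U) →
      HasDerivAt (fun s => f (c s)) (mfderiv I 𝓘(ℝ, ℝ) (fun x => f (pi x)) u (Γ u) : ℝ) t)
    {u₀ : N} (hu₀ : pi u₀ = c t₀) {O : Set N}
    (hO : IsOpen O) (hOinv : ∀ g, ∀ u ∈ O, a g u ∈ O) {h : N → G}
    (hh : ContMDiffOn I 𝓘(ℝ, EG) ∞ h O) (heq : ∀ g, ∀ u ∈ O, h (a g u) = g * h u)
    (huO : u₀ ∈ O) :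
    ∃ γ : ℝ → N, γ t₀ = u₀ ∧ IsMIntegralCurveAt γ Z t₀ ∧ ∀ᶠ t in 𝓝 t₀, pi (γ t) = c t := by
  obtain ⟨O', q, s, hO'o, hu₀', hO'inv, hqs, hqinv, hss, hsq⟩ :=
    ha.exists_orbit_coordinates hO hOinv hh heq huO
  have hqd : ∀ u ∈ O', MDifferentiableAt I 𝓘(ℝ, F) q u := fun u hu =>
    (hqs.contMDiffAt (hO'o.mem_nhds hu)).mdifferentiableAt (by simp)
  -- the induced field in the coordinates of the orbit space
  let D : N → F := fun u => mfderiv I 𝓘(ℝ, F) q u (Γ u)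
  have hD : ContMDiffOn I 𝓘(ℝ, F) ∞ D O' := contMDiffOn_mfderiv_field hO'o hqs hΓ
  have hDinv : ∀ g, ∀ u ∈ O', D (a g u) = D u := by
    intro g u hu
    have h1 := mfderiv_comp u (hqd _ (hO'inv g u hu)) (ha.mdiff_left g u)
    have h2 : q ∘ a g =ᶠ[𝓝 u] q := by
      filter_upwards [hO'o.mem_nhds hu] with v hv
      exact hqinv g v hv
    have h3 := (h2.mfderiv_eq (I := I) (I' := 𝓘(ℝ, F))).symm.trans h1
    have h4 := congrArg (fun T : F →L[ℝ] F => T (Γ u)) h3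
    refine Eq.trans ?_ h4.symm
    exact congrArg (fun w : F => (mfderiv I 𝓘(ℝ, F) q (a g u) : F →L[ℝ] F) w) (hΓinv g u).symm
  have hDs : ∀ u ∈ O', D (s (q u)) = D u := by
    intro u hu
    obtain ⟨k, hk⟩ := hsq u hu
    rw [← hk, hDinv k u hu]
  have hsO : s (q u₀) ∈ O' := by
    obtain ⟨k, hk⟩ := hsq u₀ hu₀'
    exact hk ▸ hO'inv k u₀ hu₀'
  have hFs : ContDiffAt ℝ 1 (fun z => D (s z)) (q u₀) := by
    have h1 : ContMDiffAt I 𝓘(ℝ, F) ∞ D (s (q u₀)) := hD.contMDiffAt (hO'o.mem_nhds hsO)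
    exact ((h1.comp (q u₀) hss).contDiffAt).of_le (by exact_mod_cast le_top)
  obtain ⟨K, S, hS, hLip⟩ := hFs.exists_lipschitzOnWith
  -- the given curve in these coordinates
  let out : Q → N := Function.surjInv hsurj
  have hout : ∀ x, pi (out x) = x := Function.surjInv_eq hsurj
  have hqout : ∀ u ∈ O', out (pi u) ∈ O' ∧ q (out (pi u)) = q u := by
    intro u hu
    obtain ⟨g, hg⟩ := (hpi u (out (pi u))).1 (hout _).symm
    rw [← hg]
    exact ⟨hO'inv g u hu, hqinv g u hu⟩
  have hpre : pi ⁻¹' (pi '' O') = O' := by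
    refine Set.Subset.antisymm ?_ (Set.subset_preimage_image pi O')
    rintro u ⟨v, hv, hvu⟩
    obtain ⟨g, hg⟩ := (hpi v u).1 hvu
    exact hg ▸ hO'inv g v hv
  have hUo : IsOpen (pi '' O') := hopen _ hO'o
  have hcU : ∀ᶠ t in 𝓝 t₀, c t ∈ pi '' O' :=
    hcc.eventually_mem (hUo.mem_nhds ⟨u₀, hu₀', hu₀⟩)
  have hy : ∀ᶠ t in 𝓝 t₀, HasDerivAt (fun t => q (out (c t))) (D (s (q (out (c t))))) t := by
    filter_upwards [hcU, hc] with t htU ht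
    obtain ⟨u, hu, hut⟩ := htU
    have h1 : D (s (q (out (c t)))) = D u := by
      rw [← hut, (hqout u hu).2, hDs u hu]
    rw [h1]
    refine hasDerivAt_of_forall_dual fun ℓ => ?_
    have h2 : ∀ v ∈ O', ℓ (q (out (pi v))) = ℓ (q v) := fun v hv => by rw [(hqout v hv).2]
    have h3 : ContMDiffOn I 𝓘(ℝ, ℝ) ∞ (fun v => ℓ (q v)) O' :=
      ℓ.contMDiff.comp_contMDiffOn hqs
    have h4 := ht u hut (pi '' O') (fun x => ℓ (q (out x))) hUo (hut ▸ ⟨u, hu, rfl⟩)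
      (by rw [hpre]; exact h3.congr h2)
    have h5 : (fun v => ℓ (q (out (pi v)))) =ᶠ[𝓝 u] fun v => ℓ (q v) := by
      filter_upwards [hO'o.mem_nhds hu] with v hv using h2 v hv
    have h6 := h5.mfderiv_eq (I := I) (I' := 𝓘(ℝ, ℝ))
    have h7 := mfderiv_comp u (I' := 𝓘(ℝ, F)) (I'' := 𝓘(ℝ, ℝ)) (g := ℓ)
      ℓ.mdifferentiableAt (hqd u hu)
    rw [ContinuousLinearMap.mfderiv_eq] at h7
    have h8 := congrArg (fun T : F →L[ℝ] ℝ => T (Γ u)) (h6.trans h7)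
    exact h4.congr_deriv h8
  -- the projection of an integral curve of `Z` solves the same equation, as `dq` kills generators
  have : IsManifold I 1 N := IsManifold.of_le (n := ∞) (by exact_mod_cast le_top)
  have : CompleteSpace F := FiniteDimensional.complete ℝ F
  obtain ⟨γ, hγ0, hγ⟩ := exists_isMIntegralCurveAt_of_contMDiffAt_boundaryless (I := I) t₀
    (hZ.contMDiffAt (x := u₀) |>.of_le (n := ∞) (by exact_mod_cast le_top))
  have hγO : ∀ᶠ t in 𝓝 t₀, γ t ∈ O' :=
    hγ.continuousAt.eventually_mem (hO'o.mem_nhds (hγ0 ▸ hu₀'))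
  have hz : ∀ᶠ t in 𝓝 t₀, HasDerivAt (fun t => q (γ t)) (D (s (q (γ t)))) t := by
    filter_upwards [hγO, hγ] with t htO ht
    rw [hDs _ htO]
    have h1 := ((hqd _ htO).hasMFDerivAt).comp t ht
    let T : F →L[ℝ] F := mfderiv I 𝓘(ℝ, F) q (γ t)
    let z : F := Z (γ t)
    have h2 : HasFDerivAt (q ∘ γ) (T.comp ((1 : ℝ →L[ℝ] ℝ).smulRight z)) t :=
      hasMFDerivAt_iff_hasFDerivAt.1 h1
    refine h2.hasDerivAt.congr_deriv ?_
    obtain ⟨ξ, hξ⟩ := hZΓ (γ t)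
    have h3 : (mfderiv I 𝓘(ℝ, F) q (γ t) (infGen EG I a (γ t) ξ) : F) = 0 := by
      have hd : MDifferentiableAt I 𝓘(ℝ, F) q (a 1 (γ t)) := by
        rw [ha.one]
        exact hqd _ htO
      have h4 := mfderiv_comp (1 : G) hd (ha.mdiff_orbit (γ t) 1)
      have h5 : q ∘ (fun g => a g (γ t)) = fun _ => q (γ t) :=
        funext fun g => hqinv g _ htO
      rw [h5, mfderiv_const, ha.one] at h4
      exact (congrArg (fun T : EG →L[ℝ] F => T ξ) h4).symm
    let x : F := Γ (γ t)
    let y : F := infGen EG I a (γ t) ξ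
    have h6 : T (x + y) = T x := (map_add T x y).trans ((congrArg _ h3).trans (add_zero _))
    have h7 : T z = T (x + y) := congrArg (fun w : F => T w) hξ
    refine Eq.trans ?_ (h7.trans h6)
    change T ((1 : ℝ) • z) = T z
    rw [one_smul]
  have hyS : ∀ᶠ t in 𝓝 t₀, q (out (c t)) ∈ S := by
    refine hy.self_of_nhds.continuousAt.eventually_mem ?_
    rw [← hu₀, (hqout u₀ hu₀').2]
    exact hS
  have hzS : ∀ᶠ t in 𝓝 t₀, q (γ t) ∈ S := by
    refine hz.self_of_nhds.continuousAt.eventually_mem ?_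
    rw [hγ0]
    exact hS
  have huniq := ODE_solution_unique_of_eventually (v := fun _ z => D (s z)) (s := fun _ => S)
    (Eventually.of_forall fun _ => hLip) (hy.and hyS) (hz.and hzS)
    (by rw [← hu₀, (hqout u₀ hu₀').2, hγ0])
  refine ⟨γ, hγ0, hγ, ?_⟩
  filter_upwards [huniq, hγO, hcU] with t ht htO htU
  obtain ⟨u, hu, hut⟩ := htU
  rw [← hut, (hqout u hu).2] at ht
  obtain ⟨k, hk⟩ := hsq u hu
  obtain ⟨k', hk'⟩ := hsq (γ t) htO
  rw [← hut, (hpi (γ t) (s (q u))).2 ⟨k', by rw [hk', ht]⟩, (hpi u (s (q u))).2 ⟨k, hk⟩]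

end Lifting

/-! ### Patching local lifts -/

section Patching

open Topology Filter

/-- Two points of an open interval lie in a common bounded open interval inside it. -/
theorem exists_Ioo_subset {J : Set ℝ} (hJ : IsOpen J) (hJc : J.OrdConnected) {s t : ℝ}
    (hs : s ∈ J) (ht : t ∈ J) : ∃ a b, s ∈ Set.Ioo a b ∧ t ∈ Set.Ioo a b ∧ Set.Ioo a b ⊆ J := by
  have hmin : min s t ∈ J := by rcases min_choice s t with h | h <;> rw [h] <;> assumption
  have hmax : max s t ∈ J := by rcases max_choice s t with h | h <;> rw [h] <;> assumption
  obtain ⟨ε, hε, hεJ⟩ := Metric.isOpen_iff.1 hJ _ hmin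
  obtain ⟨δ, hδ, hδJ⟩ := Metric.isOpen_iff.1 hJ _ hmax
  have ha : min s t - ε / 2 ∈ J := hεJ (by
    rw [Metric.mem_ball, Real.dist_eq, sub_sub_cancel_left, abs_neg, abs_of_pos (half_pos hε)]
    exact half_lt_self hε)
  have hb : max s t + δ / 2 ∈ J := hδJ (by
    rw [Metric.mem_ball, Real.dist_eq, add_sub_cancel_left, abs_of_pos (half_pos hδ)]
    exact half_lt_self hδ)
  refine ⟨_, _, ⟨?_, ?_⟩, ⟨?_, ?_⟩, Set.Ioo_subset_Icc_self.trans (hJc.out ha hb)⟩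
  · linarith [min_le_left s t]
  · linarith [le_max_left s t]
  · linarith [min_le_right s t]
  · linarith [le_max_right s t]

variable {F : Type*} [NormedAddCommGroup F] [NormedSpace ℝ F]
  {H : Type*} [TopologicalSpace H] {I : ModelWithCorners ℝ F H}
  {N : Type*} [TopologicalSpace N] [ChartedSpace H N]

/-- Integral curves of an invariant field are mapped to integral curves. -/
theorem IsMIntegralCurveOn.map {f : N → N} (hf : MDifferentiable I I f)
    {Z : (u : N) → TangentSpace I u} (hZ : ∀ u, (mfderiv I I f u (Z u) : F) = Z (f u))
    {γ : ℝ → N} {s : Set ℝ} (hγ : IsMIntegralCurveOn γ Z s) :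
    IsMIntegralCurveOn (f ∘ γ) Z s := by
  intro t ht
  have h1 := (hf (γ t)).hasMFDerivAt.comp_hasMFDerivWithinAt t (hγ t ht)
  refine h1.congr_mfderiv ?_
  let T : F →L[ℝ] F := mfderiv I I f (γ t)
  let z : F := Z (γ t)
  let w : F := Z (f (γ t))
  have h2 : T z = w := hZ (γ t)
  change T.comp ((1 : ℝ →L[ℝ] ℝ).smulRight z) = (1 : ℝ →L[ℝ] ℝ).smulRight w
  ext
  simp [h2]

variable [I.Boundaryless] [IsManifold I ∞ N] [T2Space N]

theorem eqOn_of_isMIntegralCurveOn {Z : (u : N) → TangentSpace I u}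
    (hZ : ContMDiff I I.tangent ∞ (fun u => (⟨u, Z u⟩ : TangentBundle I N)))
    {J : Set ℝ} (hJ : IsOpen J) (hJc : J.OrdConnected) {γ γ' : ℝ → N}
    (hγ : IsMIntegralCurveOn γ Z J) (hγ' : IsMIntegralCurveOn γ' Z J) {t₀ : ℝ} (ht₀ : t₀ ∈ J)
    (h : γ t₀ = γ' t₀) : Set.EqOn γ γ' J := by
  intro t ht
  have : IsManifold I 1 N := IsManifold.of_le (n := ∞) (by exact_mod_cast le_top)
  obtain ⟨a, b, h0, h1, hab⟩ := exists_Ioo_subset hJ hJc ht₀ ht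
  exact isMIntegralCurveOn_Ioo_eqOn_of_contMDiff_boundaryless (I := I) h0
    (hZ.of_le (by exact_mod_cast le_top)) (hγ.mono hab) (hγ'.mono hab) h h1

variable {EG : Type*} [NormedAddCommGroup EG] [NormedSpace ℝ EG]
  {G : Type*} [TopologicalSpace G] [ChartedSpace EG G] [Group G]
  {a : G → N → N} {Q : Type*} {pi : N → Q}

/-- If an invariant field has local integral curves over a given curve in the orbit space near
every parameter, it has an integral curve over the whole of it: local curves are translated by
group elements so that they fit together. -/
theorem IsSmoothAction.exists_lift (ha : IsSmoothAction EG I a)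
    (hpi : ∀ u v, pi u = pi v ↔ ∃ g, a g u = v)
    {Z : (u : N) → TangentSpace I u}
    (hZ : ContMDiff I I.tangent ∞ (fun u => (⟨u, Z u⟩ : TangentBundle I N)))
    (hZinv : ∀ g u, (mfderiv I I (a g) u (Z u) : F) = Z (a g u))
    {J : Set ℝ} (hJ : IsOpen J) (hJc : J.OrdConnected) (h0J : (0 : ℝ) ∈ J) {c : ℝ → Q} {v₀ : N}
    (hv₀ : pi v₀ = c 0)
    (hloc : ∀ t₀ ∈ J, ∃ γ : ℝ → N, IsMIntegralCurveAt γ Z t₀ ∧ ∀ᶠ t in 𝓝 t₀, pi (γ t) = c t) :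
    ∃ γ : ℝ → N, γ 0 = v₀ ∧ IsMIntegralCurveOn γ Z J ∧ ∀ t ∈ J, pi (γ t) = c t := by
  have : IsManifold I 1 N := IsManifold.of_le (n := ∞) (by exact_mod_cast le_top)
  have hZ1 : ContMDiff I I.tangent 1 (fun u => (⟨u, Z u⟩ : TangentBundle I N)) :=
    hZ.of_le (by exact_mod_cast le_top)
  -- local lifts through a prescribed point, on an interval
  have hloc' : ∀ t₀ ∈ J, ∃ ε > 0, Set.Ioo (t₀ - ε) (t₀ + ε) ⊆ J ∧
      ∀ t' ∈ Set.Ioo (t₀ - ε) (t₀ + ε), ∀ u, pi u = c t' → ∃ γ : ℝ → N, γ t' = u ∧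
        IsMIntegralCurveOn γ Z (Set.Ioo (t₀ - ε) (t₀ + ε)) ∧
        ∀ t ∈ Set.Ioo (t₀ - ε) (t₀ + ε), pi (γ t) = c t := by
    intro t₀ ht₀
    obtain ⟨γ, hγ, hγc⟩ := hloc t₀ ht₀
    obtain ⟨ε, hε, hball⟩ := Metric.eventually_nhds_iff_ball.1
      ((hγ.and hγc).and (hJ.mem_nhds ht₀))
    rw [Real.ball_eq_Ioo] at hball
    refine ⟨ε, hε, fun t ht => (hball t ht).2, fun t' ht' u hu => ?_⟩
    obtain ⟨g, hg⟩ := (hpi (γ t') u).1 ((hball t' ht').1.2.trans hu.symm)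
    refine ⟨a g ∘ γ, hg, IsMIntegralCurveOn.map (ha.smooth_left g |>.mdifferentiable (by simp))
      (hZinv g) fun t ht => (hball t ht).1.1.hasMFDerivWithinAt, fun t ht => ?_⟩
    exact ((hpi _ _).2 ⟨g, rfl⟩).symm.trans (hball t ht).1.2
  -- the set of parameters reached by a lift is open and closed in `J`
  let P : ℝ → ℝ → (ℝ → N) → Prop := fun l r γ => (0 : ℝ) ∈ Set.Ioo l r ∧ Set.Ioo l r ⊆ J ∧
    γ 0 = v₀ ∧ IsMIntegralCurveOn γ Z (Set.Ioo l r) ∧ ∀ t ∈ Set.Ioo l r, pi (γ t) = c t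
  let T : Set ℝ := {t | ∃ l r γ, P l r γ ∧ t ∈ Set.Ioo l r}
  have hTo : IsOpen T := by
    rw [isOpen_iff_mem_nhds]
    rintro t ⟨l, r, γ, hP, ht⟩
    exact mem_of_superset (isOpen_Ioo.mem_nhds ht) fun t' ht' => ⟨l, r, γ, hP, ht'⟩
  have hT0 : (J ∩ T).Nonempty := by
    obtain ⟨ε, hε, hεJ, hsol⟩ := hloc' 0 h0J
    have h0 : (0 : ℝ) ∈ Set.Ioo (0 - ε) (0 + ε) := by constructor <;> linarith
    obtain ⟨γ, hγ0, hγ, hγc⟩ := hsol 0 h0 v₀ hv₀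
    exact ⟨0, h0J, _, _, γ, ⟨h0, hεJ, hγ0, hγ, hγc⟩, h0⟩
  have hTc : closure T ∩ J ⊆ T := by
    rintro t₀ ⟨htc, ht₀⟩
    obtain ⟨ε, hε, hεJ, hsol⟩ := hloc' t₀ ht₀
    have htI : t₀ ∈ Set.Ioo (t₀ - ε) (t₀ + ε) := by constructor <;> linarith
    obtain ⟨t', ht'I, l, r, γ, ⟨h0, hlr, hγ0, hγ, hγc⟩, ht'⟩ :=
      mem_closure_iff.1 htc _ isOpen_Ioo htI
    obtain ⟨γ', hγ'e, hγ', hγ'c⟩ := hsol t' ht'I (γ t') (hγc t' ht')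
    have hun : Set.Ioo l r ∪ Set.Ioo (t₀ - ε) (t₀ + ε) =
        Set.Ioo (min l (t₀ - ε)) (max r (t₀ + ε)) :=
      Set.Ioo_union_Ioo' (ht'I.1.trans ht'.2) (ht'.1.trans ht'I.2)
    classical
    have hglue := isMIntegralCurveOn_piecewise (I := I) hZ1 hγ hγ' ⟨ht', ht'I⟩ hγ'e.symm
    rw [hun] at hglue
    refine ⟨_, _, _, ⟨?_, ?_, ?_, hglue, ?_⟩, ?_⟩
    · rw [← hun]
      exact Or.inl h0
    · rw [← hun]
      exact Set.union_subset hlr hεJ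
    · rw [Set.piecewise_eq_of_mem _ _ _ h0, hγ0]
    · intro t ht
      rw [← hun] at ht
      by_cases h : t ∈ Set.Ioo l r
      · rw [Set.piecewise_eq_of_mem _ _ _ h, hγc t h]
      · rw [Set.piecewise_eq_of_notMem _ _ _ h, hγ'c t (ht.resolve_left h)]
    · rw [← hun]
      exact Or.inr htI
  have hJT : J ⊆ T := hJc.isPreconnected.subset_of_closure_inter_subset hTo hT0 hTc
  have : Nonempty N := ⟨v₀⟩
  choose! l r γ hP htI using fun t (ht : t ∈ J) => hJT ht
  have hagree : ∀ t ∈ J, ∀ t' ∈ Set.Ioo (l t) (r t), γ t' t' = γ t t' := by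
    intro t ht t' ht'
    have ht'J := (hP t ht).2.1 ht'
    refine isMIntegralCurveOn_Ioo_eqOn_of_contMDiff_boundaryless (I := I) (t₀ := 0)
      (a := max (l t') (l t)) (b := min (r t') (r t)) ⟨?_, ?_⟩ hZ1
      ((hP t' ht'J).2.2.2.1.mono (Set.Ioo_subset_Ioo (le_max_left _ _) (min_le_left _ _)))
      ((hP t ht).2.2.2.1.mono (Set.Ioo_subset_Ioo (le_max_right _ _) (min_le_right _ _)))
      ((hP t' ht'J).2.2.1.trans (hP t ht).2.2.1.symm) ⟨?_, ?_⟩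
    · exact max_lt (hP t' ht'J).1.1 (hP t ht).1.1
    · exact lt_min (hP t' ht'J).1.2 (hP t ht).1.2
    · exact max_lt (htI t' ht'J).1 ht'.1
    · exact lt_min (htI t' ht'J).2 ht'.2
  refine ⟨fun t => γ t t, (hP 0 h0J).2.2.1, fun t ht => ?_, fun t ht =>
    (hP t ht).2.2.2.2 t (htI t ht)⟩
  have h1 := ((hP t ht).2.2.2.1 t (htI t ht)).hasMFDerivAt (isOpen_Ioo.mem_nhds (htI t ht))
  have h2 : (fun t => γ t t) =ᶠ[𝓝 t] γ t := by
    filter_upwards [isOpen_Ioo.mem_nhds (htI t ht)] with t' ht'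
    exact hagree t ht t' ht'
  exact HasMFDerivAt.hasMFDerivWithinAt (HasMFDerivAt.congr_of_eventuallyEq h1 h2)

end Patching

/-! ### Connections and reconstruction -/

section GroupCurves

variable {EG : Type*} [NormedAddCommGroup EG] [NormedSpace ℝ EG]
  {G : Type*} [TopologicalSpace G] [ChartedSpace EG G] [Group G] [LieGroup 𝓘(ℝ, EG) ∞ G]

theorem eq_zero_of_maurerCartan_eq_zero {g : G} {X : TangentSpace 𝓘(ℝ, EG) g}
    (h : maurerCartan g X = 0) : X = 0 := by
  have h1 := (isSmoothAction_mul (EG := EG) (G := G)).mfderiv_left_inv g⁻¹ g X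
  refine h1.symm.trans ?_
  exact (congrArg (mfderiv 𝓘(ℝ, EG) 𝓘(ℝ, EG) (fun x : G => g⁻¹⁻¹ * x) (g⁻¹ * g)) h).trans
    (map_zero _)

theorem eq_zero_of_Ad_eq_zero {g : G} {ξ : GroupLieAlgebra 𝓘(ℝ, EG) G} (h : Ad g ξ = 0) :
    ξ = 0 := by
  have ha := isSmoothAction_mul (EG := EG) (G := G)
  have h1 := ha.mfderiv_infGen g 1 ξ
  rw [h, map_zero] at h1
  have h2 : (infGen EG 𝓘(ℝ, EG) (fun g x : G => g * x) 1 ξ : EG) = ξ := by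
    have h3 : (fun x : G => x * 1) = id := funext mul_one
    unfold infGen
    rw [h3, mfderiv_id]
    rfl
  have h4 := ha.mfderiv_left_inv g 1 (infGen EG 𝓘(ℝ, EG) (fun g x : G => g * x) 1 ξ)
  refine (h2.symm.trans h4.symm).trans ?_
  exact (congrArg (mfderiv 𝓘(ℝ, EG) 𝓘(ℝ, EG) (fun x : G => g⁻¹ * x) (g * 1)) h1).trans
    (map_zero _)

/-- A curve with vanishing Maurer-Cartan derivative is, like a constant curve, an integral curve of
the zero vector field, hence constant. -/
theorem eqOn_const_of_maurerCartan_eq_zero [T2Space G] {J : Set ℝ} (hJ : IsOpen J)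
    (hJc : J.OrdConnected) {k : ℝ → G} (hk : ∀ t ∈ J, MDifferentiableAt 𝓘(ℝ, ℝ) 𝓘(ℝ, EG) k t)
    (h : ∀ t ∈ J, maurerCartan (k t) (mfderiv 𝓘(ℝ, ℝ) 𝓘(ℝ, EG) k t (1 : ℝ)) = 0)
    {t₀ : ℝ} (ht₀ : t₀ ∈ J) : ∀ t ∈ J, k t = k t₀ := by
  have hZ : ContMDiff 𝓘(ℝ, EG) 𝓘(ℝ, EG).tangent ∞
      (fun g : G => (⟨g, 0⟩ : TangentBundle 𝓘(ℝ, EG) G)) :=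
    Bundle.contMDiff_zeroSection ℝ (TangentSpace 𝓘(ℝ, EG) : G → Type _)
  refine eqOn_of_isMIntegralCurveOn (γ' := fun _ => k t₀) hZ hJ hJc (fun t ht => ?_)
    (fun t _ => ?_) ht₀ rfl
  · refine (hk t ht).hasMFDerivAt.hasMFDerivWithinAt.congr_mfderiv ?_
    have h1 := eq_zero_of_maurerCartan_eq_zero (h t ht)
    let T : ℝ →L[ℝ] EG := mfderiv 𝓘(ℝ, ℝ) 𝓘(ℝ, EG) k t
    have h2 : T 1 = 0 := h1
    change T = (1 : ℝ →L[ℝ] ℝ).smulRight (0 : EG)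
    ext
    simpa using h2
  · have h1 := hasMFDerivAt_const (I := 𝓘(ℝ, ℝ)) (I' := 𝓘(ℝ, EG)) (k t₀) t
    refine h1.hasMFDerivWithinAt.congr_mfderiv ?_
    change (0 : ℝ →L[ℝ] EG) = (1 : ℝ →L[ℝ] ℝ).smulRight (0 : EG)
    simp

end GroupCurves

section Reconstruct

open Topology Filter

variable {EG : Type*} [NormedAddCommGroup EG] [NormedSpace ℝ EG]
  {G : Type*} [TopologicalSpace G] [ChartedSpace EG G] [Group G]
  {F : Type*} [NormedAddCommGroup F] [NormedSpace ℝ F]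
  {H : Type*} [TopologicalSpace H] {I : ModelWithCorners ℝ F H}
  {N : Type*} [TopologicalSpace N] [ChartedSpace H N]
  {a : G → N → N}

/-- `N` is covered by invariant open sets with a smooth equivariant map to `G`. -/
def IsLocallyTrivialAction (EG : Type*) [NormedAddCommGroup EG] [NormedSpace ℝ EG]
    [ChartedSpace EG G] (I : ModelWithCorners ℝ F H) (a : G → N → N) : Prop :=
  ∀ u₀ : N, ∃ (O : Set N) (h : N → G), IsOpen O ∧ u₀ ∈ O ∧ (∀ g, ∀ u ∈ O, a g u ∈ O) ∧
    ContMDiffOn I 𝓘(ℝ, EG) ∞ h O ∧ ∀ g, ∀ u ∈ O, h (a g u) = g * h u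

/-- The pointwise properties of a connection form of the action `a`: it reproduces the Lie
algebra element of an infinitesimal generator, and it is equivariant. -/
structure IsConnectionForm (EG : Type*) [NormedAddCommGroup EG] [NormedSpace ℝ EG]
    [ChartedSpace EG G] (I : ModelWithCorners ℝ F H) (a : G → N → N)
    (Ω : (u : N) → TangentSpace I u → GroupLieAlgebra 𝓘(ℝ, EG) G) : Prop where
  add_infGen : ∀ (u : N) (W : TangentSpace I u) ξ, Ω u (W + infGen EG I a u ξ) = Ω u W + ξ
  equivariant : ∀ g u (W : TangentSpace I u), Ω (a g u) (mfderiv I I (a g) u W) = Ad g (Ω u W)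

variable {Ω : (u : N) → TangentSpace I u → GroupLieAlgebra 𝓘(ℝ, EG) G}

theorem connection_congr {p p' : N} (h : p = p') {W W' : F} (hW : W = W') :
    Ω p W = Ω p' W' := by
  subst h
  subst hW
  rfl

/-- The horizontal part of the vector field `Γ`. -/
def horField (EG : Type*) [NormedAddCommGroup EG] [NormedSpace ℝ EG]
    [ChartedSpace EG G] (I : ModelWithCorners ℝ F H) (a : G → N → N)
    (Ω : (u : N) → TangentSpace I u → GroupLieAlgebra 𝓘(ℝ, EG) G)
    (Γ : (u : N) → TangentSpace I u) (u : N) : TangentSpace I u :=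
  Γ u - infGen EG I a u (Ω u (Γ u))

variable {Γ : (u : N) → TangentSpace I u}

theorem horField_add_infGen (u : N) :
    horField EG I a Ω Γ u + infGen EG I a u (Ω u (Γ u)) = Γ u :=
  sub_add_cancel _ _

theorem IsConnectionForm.apply_horField (hΩ : IsConnectionForm EG I a Ω) (u : N) :
    Ω u (horField EG I a Ω Γ u) = 0 := by
  have h := hΩ.add_infGen u (horField EG I a Ω Γ u) (Ω u (Γ u))
  rw [horField_add_infGen] at h
  exact left_eq_add.1 (h.trans (add_comm _ _))

variable [LieGroup 𝓘(ℝ, EG) ∞ G]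

/-- Group elements relating two differentiable curves depend differentiably on the parameter: they
are the quotients of the values of an equivariant map on the two curves. -/
theorem IsLocallyTrivialAction.mdifferentiableAt (hT : IsLocallyTrivialAction EG I a)
    {k : ℝ → G} {x y : ℝ → N} {t₀ : ℝ} (hx : MDifferentiableAt 𝓘(ℝ, ℝ) I x t₀)
    (hy : MDifferentiableAt 𝓘(ℝ, ℝ) I y t₀) (h : ∀ᶠ t in 𝓝 t₀, a (k t) (x t) = y t) :
    MDifferentiableAt 𝓘(ℝ, ℝ) 𝓘(ℝ, EG) k t₀ := by
  obtain ⟨O, f, hO, hxO, hinv, hf, heq⟩ := hT (x t₀)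
  have hyO : y t₀ ∈ O := h.self_of_nhds ▸ hinv (k t₀) _ hxO
  have hfx := ((hf.contMDiffAt (hO.mem_nhds hxO)).mdifferentiableAt (by simp)).comp t₀ hx
  have hfy := ((hf.contMDiffAt (hO.mem_nhds hyO)).mdifferentiableAt (by simp)).comp t₀ hy
  have hdiv : MDifferentiableAt (𝓘(ℝ, EG).prod 𝓘(ℝ, EG)) 𝓘(ℝ, EG)
      (fun p : G × G => p.1 * p.2⁻¹) ((f ∘ y) t₀, (f ∘ x) t₀) := by
    have h1 : ContMDiff (𝓘(ℝ, EG).prod 𝓘(ℝ, EG)) 𝓘(ℝ, EG) ∞ (fun p : G × G => p.1 * p.2⁻¹) :=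
      contMDiff_fst.mul contMDiff_snd.inv
    exact h1.mdifferentiable (by simp) _
  refine (hdiv.comp t₀ (hfy.prodMk hfx)).congr_of_eventuallyEq ?_
  filter_upwards [h, hx.continuousAt.eventually_mem (hO.mem_nhds hxO)] with t ht htO
  change k t = f (y t) * (f (x t))⁻¹
  rw [← ht, heq _ _ htO, mul_inv_cancel_right]

/-- The connection form on the velocity of `t ↦ k(t) · x(t)`. -/
theorem IsConnectionForm.apply_act_curve (ha : IsSmoothAction EG I a)
    (hΩ : IsConnectionForm EG I a Ω) {k : ℝ → G} {x w : ℝ → N} {t : ℝ}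
    (hk : MDifferentiableAt 𝓘(ℝ, ℝ) 𝓘(ℝ, EG) k t) (hx : MDifferentiableAt 𝓘(ℝ, ℝ) I x t)
    (hw : ∀ᶠ s in 𝓝 t, a (k s) (x s) = w s) :
    Ω (w t) (mfderiv 𝓘(ℝ, ℝ) I w t (1 : ℝ)) = Ad (k t) (Ω (x t) (mfderiv 𝓘(ℝ, ℝ) I x t (1 : ℝ)) +
      maurerCartan (k t) (mfderiv 𝓘(ℝ, ℝ) 𝓘(ℝ, EG) k t (1 : ℝ))) := by
  have h1 := (ha.mfderiv_act_curve hk hx).2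
  have h2 : (mfderiv 𝓘(ℝ, ℝ) I (fun s => a (k s) (x s)) t : ℝ →L[ℝ] F) =
      mfderiv 𝓘(ℝ, ℝ) I w t := (show (fun s => a (k s) (x s)) =ᶠ[𝓝 t] w from hw).mfderiv_eq
  have h3 := congrArg (fun T : ℝ →L[ℝ] F => T 1) h2
  have h4 : (mfderiv 𝓘(ℝ, ℝ) I w t (1 : ℝ) : F) = mfderiv I I (a (k t)) (x t)
      (mfderiv 𝓘(ℝ, ℝ) I x t (1 : ℝ) +
        infGen EG I a (x t) (maurerCartan (k t) (mfderiv 𝓘(ℝ, ℝ) 𝓘(ℝ, EG) k t (1 : ℝ)))) :=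
    h3.symm.trans (h1.trans (congrArg _ (add_comm _ _)))
  rw [← hΩ.add_infGen, ← hΩ.equivariant]
  exact connection_congr (F := F) hw.self_of_nhds.symm h4

/-- Horizontal curves over the same curve in the orbit space differ by a constant group element. -/
theorem IsConnectionForm.eqOn_of_horizontal [T2Space G] (ha : IsSmoothAction EG I a)
    (hfree : ∀ g u, a g u = u → g = 1)
    (hT : IsLocallyTrivialAction EG I a) (hΩ : IsConnectionForm EG I a Ω) {J : Set ℝ}
    (hJ : IsOpen J) (hJc : J.OrdConnected) {x y : ℝ → N}
    (hx : ∀ t ∈ J, MDifferentiableAt 𝓘(ℝ, ℝ) I x t)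
    (hy : ∀ t ∈ J, MDifferentiableAt 𝓘(ℝ, ℝ) I y t)
    (hxh : ∀ t ∈ J, Ω (x t) (mfderiv 𝓘(ℝ, ℝ) I x t (1 : ℝ)) = 0)
    (hyh : ∀ t ∈ J, Ω (y t) (mfderiv 𝓘(ℝ, ℝ) I y t (1 : ℝ)) = 0)
    (hxy : ∀ t ∈ J, ∃ g, a g (x t) = y t) {t₀ : ℝ} (ht₀ : t₀ ∈ J) (h0 : x t₀ = y t₀) :
    Set.EqOn y x J := by
  choose! k hk using hxy
  have hkd : ∀ t ∈ J, MDifferentiableAt 𝓘(ℝ, ℝ) 𝓘(ℝ, EG) k t := fun t ht =>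
    hT.mdifferentiableAt (hx t ht) (hy t ht) (eventually_of_mem (hJ.mem_nhds ht) hk)
  have hMC : ∀ t ∈ J, maurerCartan (k t) (mfderiv 𝓘(ℝ, ℝ) 𝓘(ℝ, EG) k t (1 : ℝ)) = 0 := by
    intro t ht
    have h1 := hΩ.apply_act_curve ha (hkd t ht) (hx t ht) (eventually_of_mem (hJ.mem_nhds ht) hk)
    rw [hyh t ht, hxh t ht, zero_add] at h1
    exact eq_zero_of_Ad_eq_zero h1.symm
  have h1 : k t₀ = 1 := hfree _ (x t₀) ((hk t₀ ht₀).trans h0.symm)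
  intro t ht
  rw [← hk t ht, eqOn_const_of_maurerCartan_eq_zero hJ hJc hkd hMC ht₀ t ht, h1, ha.one]

theorem IsConnectionForm.mfderiv_horField (ha : IsSmoothAction EG I a)
    (hΩ : IsConnectionForm EG I a Ω)
    (hΓ : ∀ g u, (mfderiv I I (a g) u (Γ u) : F) = Γ (a g u)) (g : G) (u : N) :
    (mfderiv I I (a g) u (horField EG I a Ω Γ u) : F) = horField EG I a Ω Γ (a g u) := by
  have h1 := ha.mfderiv_infGen g u (Ω u (Γ u))
  rw [← hΩ.equivariant] at h1
  have h2 : Ω (a g u) (mfderiv I I (a g) u (Γ u)) = Ω (a g u) (Γ (a g u)) :=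
    connection_congr (F := F) rfl (hΓ g u)
  rw [h2] at h1
  let T : F →L[ℝ] F := mfderiv I I (a g) u
  let x : F := Γ u
  let y : F := infGen EG I a u (Ω u (Γ u))
  let y' : F := infGen EG I a (a g u) (Ω (a g u) (Γ (a g u)))
  have h3 : T x - T y = T x - y' := congrArg (fun z : F => T x - z) h1
  let x' : F := Γ (a g u)
  have h4 : T x - y' = x' - y' := congrArg (fun z : F => z - y') (hΓ g u)
  exact (map_sub T x y).trans (h3.trans h4)

theorem contMDiff_horField [IsManifold I ∞ N] (ha : IsSmoothAction EG I a)
    (hΓ : ContMDiff I I.tangent ∞ (fun u => (⟨u, Γ u⟩ : TangentBundle I N)))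
    {f : N → EG} (hf : ContMDiff I 𝓘(ℝ, EG) ∞ f) (hfΩ : ∀ u, Ω u (Γ u) = f u) :
    ContMDiff I I.tangent ∞ (fun u => (⟨u, horField EG I a Ω Γ u⟩ : TangentBundle I N)) := by
  have h1 := hΓ.sub_section (ha.contMDiff_infGen hf)
  refine h1.congr fun u => ?_
  refine tangent_mk_congr rfl ?_
  change (Γ u - infGen EG I a u (Ω u (Γ u)) : TangentSpace I u) = _
  rw [hfΩ]
  rfl

/-- If `k` solves the reconstruction equation along an integral curve `x` of the horizontal part of
`Γ`, then `k · x` is an integral curve of `Γ`. -/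
theorem IsSmoothAction.hasMFDerivAt_of_maurerCartan (ha : IsSmoothAction EG I a)
    (hΓ : ∀ g u, (mfderiv I I (a g) u (Γ u) : F) = Γ (a g u)) {k : ℝ → G} {x : ℝ → N} {t : ℝ}
    (hk : MDifferentiableAt 𝓘(ℝ, ℝ) 𝓘(ℝ, EG) k t)
    (hx : HasMFDerivAt 𝓘(ℝ, ℝ) I x t
      ((1 : ℝ →L[ℝ] ℝ).smulRight (horField EG I a Ω Γ (x t))))
    (h : maurerCartan (k t) (mfderiv 𝓘(ℝ, ℝ) 𝓘(ℝ, EG) k t (1 : ℝ)) = Ω (x t) (Γ (x t))) :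
    HasMFDerivAt 𝓘(ℝ, ℝ) I (fun s => a (k s) (x s)) t
      ((1 : ℝ →L[ℝ] ℝ).smulRight (Γ (a (k t) (x t)))) := by
  obtain ⟨h1, h2⟩ := ha.mfderiv_act_curve hk hx.mdifferentiableAt
  rw [h, hx.mfderiv] at h2
  let T : ℝ →L[ℝ] F := mfderiv 𝓘(ℝ, ℝ) I (fun s => a (k s) (x s)) t
  let S : F →L[ℝ] F := mfderiv I I (a (k t)) (x t)
  let y : F := infGen EG I a (x t) (Ω (x t) (Γ (x t)))
  let z : F := horField EG I a Ω Γ (x t)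
  let w : F := Γ (a (k t) (x t))
  have h3 : T 1 = S (y + (1 : ℝ →L[ℝ] ℝ) 1 • z) := h2
  have h4 : z + y = (Γ (x t) : F) := horField_add_infGen (x t)
  have h5 : T 1 = w := by
    rw [h3, one_apply_eq_self, one_smul, add_comm, h4]
    exact hΓ _ _
  refine h1.hasMFDerivAt.congr_mfderiv ?_
  change T = (1 : ℝ →L[ℝ] ℝ).smulRight w
  ext
  simpa using h5

/-- The converse: if `k · x` is an integral curve of `Γ` for a horizontal curve `x`, then `k` solves
the reconstruction equation. -/
theorem IsConnectionForm.maurerCartan_eq (ha : IsSmoothAction EG I a)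
    (hΩ : IsConnectionForm EG I a Ω)
    (hΓ : ∀ g u, (mfderiv I I (a g) u (Γ u) : F) = Γ (a g u)) {k : ℝ → G} {x : ℝ → N} {t : ℝ}
    (hk : MDifferentiableAt 𝓘(ℝ, ℝ) 𝓘(ℝ, EG) k t) (hx : MDifferentiableAt 𝓘(ℝ, ℝ) I x t)
    (hxh : Ω (x t) (mfderiv 𝓘(ℝ, ℝ) I x t (1 : ℝ)) = 0)
    (h : HasMFDerivAt 𝓘(ℝ, ℝ) I (fun s => a (k s) (x s)) t
      ((1 : ℝ →L[ℝ] ℝ).smulRight (Γ (a (k t) (x t))))) :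
    maurerCartan (k t) (mfderiv 𝓘(ℝ, ℝ) 𝓘(ℝ, EG) k t (1 : ℝ)) = Ω (x t) (Γ (x t)) := by
  have h1 := hΩ.apply_act_curve ha hk hx (Eventually.of_forall fun s => rfl)
  rw [hxh, zero_add] at h1
  have h2 : (mfderiv 𝓘(ℝ, ℝ) I (fun s => a (k s) (x s)) t (1 : ℝ) : F) =
      mfderiv I I (a (k t)) (x t) (Γ (x t)) := by
    rw [h.mfderiv]
    exact (one_smul ℝ (Γ (a (k t) (x t)) : F)).trans (hΓ _ _).symm
  have h3 := (connection_congr (Ω := Ω) rfl h2).symm.trans h1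
  rw [hΩ.equivariant] at h3
  exact (sub_eq_zero.1 (eq_zero_of_Ad_eq_zero
    ((map_sub (Ad (k t)) _ _).trans (sub_eq_zero.2 h3)))).symm

end Reconstruct

/-! ### The right-hand side of the reconstruction equation in an adapted frame -/

section Frames

variable {EG : Type*} [NormedAddCommGroup EG] [NormedSpace ℝ EG]
  {G : Type*} [TopologicalSpace G] [ChartedSpace EG G] [Group G]

theorem Ad_mul [LieGroup 𝓘(ℝ, EG) ∞ G] (g k : G) (ξ : GroupLieAlgebra 𝓘(ℝ, EG) G) :
    Ad (g * k) ξ = Ad g (Ad k ξ) := by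
  have hd : ∀ l x : G, MDifferentiableAt 𝓘(ℝ, EG) 𝓘(ℝ, EG) (fun x => l * x * l⁻¹) x := fun l x => by
    have : ContMDiff 𝓘(ℝ, EG) 𝓘(ℝ, EG) ∞ (fun x => l * x * l⁻¹) :=
      (contMDiff_const.mul contMDiff_id).mul contMDiff_const
    exact this.mdifferentiable (by simp) _
  have h1 := mfderiv_comp (1 : G) (hd g _) (hd k 1)
  have h2 : (fun x => g * x * g⁻¹) ∘ (fun x => k * x * k⁻¹) =
      fun x => g * k * x * (g * k)⁻¹ := by
    funext x
    simp [mul_assoc]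
  have h3 : k * 1 * k⁻¹ = 1 := by simp
  rw [h2, h3] at h1
  exact congrArg (fun T : EG →L[ℝ] EG => T ξ) h1

variable {E : Type*} [NormedAddCommGroup E] [NormedSpace ℝ E]
  {M : Type*} [TopologicalSpace M] [ChartedSpace E M] [IsManifold 𝓘(ℝ, E) ∞ M]
  [MulAction G M]
  {L : TangentBundle 𝓘(ℝ, E) M → ℝ}
  {ι κ : Type*} [Fintype ι] [Fintype κ]

/-- Quasi-velocities with respect to an invariant frame are invariant. -/
theorem IsQuasiVelocity.tangentAct [LieGroup 𝓘(ℝ, EG) ∞ G] [ContMDiffSMul 𝓘(ℝ, EG) 𝓘(ℝ, E) ∞ G M]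
    {b : Module.Basis ι ℝ (GroupLieAlgebra 𝓘(ℝ, EG) G)} {W : Set M} {h : M → G}
    {X : κ → (m : M) → TangentSpace 𝓘(ℝ, E) m} (hX : IsAdaptedFrame b W h X) (g : G)
    {u : TangentBundle 𝓘(ℝ, E) M} (huW : u.proj ∈ W) {w : ι → ℝ}
    {v : κ → ℝ} (hu : IsQuasiVelocity b h X u w v) :
    IsQuasiVelocity b h X (tangentAct g u) w v := by
  have ha := isSmoothAction_smul (EG := EG) (G := G) (E := E) (M := M)
  let T : E →L[ℝ] E := mfderiv 𝓘(ℝ, E) 𝓘(ℝ, E) (fun m : M => g • m) u.proj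
  let p : ι → E := fun a => hatField b h a u.proj
  let q : κ → E := fun i => X i u.proj
  let p' : ι → E := fun a => hatField b h a (g • u.proj)
  let q' : κ → E := fun i => X i (g • u.proj)
  have hp : ∀ a, T (p a) = p' a := by
    intro a
    have h1 := ha.mfderiv_infGen g u.proj (Ad (h u.proj) (b a))
    rw [← Ad_mul, ← hX.equivariant g u.proj huW] at h1
    exact h1
  have hq : ∀ i, T (q i) = q' i := fun i => hX.invariant_frame i g u.proj huW
  have hu' : (u.snd : E) = ∑ a, w a • p a + ∑ i, v i • q i := hu
  have h2 : T (u.snd : E) = ∑ a, w a • p' a + ∑ i, v i • q' i := by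
    rw [hu', map_add, map_sum, map_sum]
    simp_rw [map_smul, hp, hq]
  exact h2

variable [DecidableEq ι]

/-- The mechanical connection on a combination of the fields `X_i` of a frame. -/
theorem mechω_sum_smul [FiniteDimensional ℝ EG]
    (hL : ContMDiff 𝓘(ℝ, E).tangent 𝓘(ℝ, ℝ) ∞ L) (hnons : IsNonsingularOnFundamental EG G L)
    (b : Module.Basis ι ℝ (GroupLieAlgebra 𝓘(ℝ, EG) G))
    (X : κ → (m : M) → TangentSpace 𝓘(ℝ, E) m) (u : TangentBundle 𝓘(ℝ, E) M) (v : κ → ℝ) :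
    mechω EG G L u (∑ i, v i • X i u.proj) = ∑ a, (-∑ i, mechB L b X u a i * v i) • b a := by
  obtain ⟨B, hB, hBs⟩ := exists_hessian_eq_bilin hL u
  let Y : GroupLieAlgebra 𝓘(ℝ, EG) G →ₗ[ℝ] E := (fundL EG G E u.proj : EG →ₗ[ℝ] E)
  let X' : κ → E := fun i => X i u.proj
  let gv : Matrix ι ι ℝ := Matrix.of fun a c => B (Y (b a)) (Y (b c))
  let gx : Matrix ι κ ℝ := Matrix.of fun c i => B (Y (b c)) (X' i)
  have hmB : mechB L b X u = -(gv⁻¹ * gx) := by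
    have h1 : (Matrix.of fun a c => hessian L u (fundamentalField (b a) u.proj)
        (fundamentalField (b c) u.proj)) = gv :=
      congrArg Matrix.of (funext fun a => funext fun c => hB (Y (b a)) (Y (b c)))
    have h2 : (Matrix.of fun c i => hessian L u (fundamentalField (b c) u.proj) (X i u.proj)) =
        gx := congrArg Matrix.of (funext fun c => funext fun i => hB (Y (b c)) (X' i))
    unfold mechB
    rw [h1, h2]
  -- the matrix of the Hessian on the fundamental fields is invertible
  have hgv : IsUnit gv.det := by
    rw [← Matrix.isUnit_iff_isUnit_det, ← Matrix.mulVec_injective_iff_isUnit]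
    refine (injective_iff_map_eq_zero (Matrix.mulVecLin gv)).2 fun y hy => ?_
    have h1 : ∑ c, y c • b c = 0 := by
      refine hnons u _ fun η => ?_
      refine (hB (Y (∑ c, y c • b c)) (Y η)).trans ?_
      have h2 : ((B (Y (∑ c, y c • b c)) : E →ₗ[ℝ] ℝ) ∘ₗ Y) = 0 := by
        refine b.ext fun a => ?_
        have h3 := congrFun hy a
        change ∑ c, B (Y (b a)) (Y (b c)) * y c = 0 at h3
        change B (Y (∑ c, y c • b c)) (Y (b a)) = 0
        rw [hBs, map_sum, map_sum, ← h3]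
        refine Finset.sum_congr rfl fun c _ => ?_
        rw [map_smul, map_smul, smul_eq_mul, mul_comm]
      exact congrArg (fun T : GroupLieAlgebra 𝓘(ℝ, EG) G →ₗ[ℝ] ℝ => T η) h2
    funext c
    exact (Fintype.linearIndependent_iff.1 b.linearIndependent y h1) c
  let z : ι → ℝ := (gv⁻¹ * gx).mulVec v
  have hz : gv.mulVec z = gx.mulVec v := by
    rw [Matrix.mulVec_mulVec, ← Matrix.mul_assoc, Matrix.mul_nonsing_inv _ hgv, Matrix.one_mul]
  have hcoef : ∀ a, -∑ i, mechB L b X u a i * v i = z a := by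
    intro a
    rw [hmB]
    simp [z, Matrix.mulVec, dotProduct]
  simp_rw [hcoef]
  refine (mechω_eq_iff hL hnons u _ _).2 fun η => ?_
  refine (hB (∑ i, v i • X' i - Y (∑ a, z a • b a)) (Y η)).trans ?_
  have h2 : ((B (∑ i, v i • X' i - Y (∑ a, z a • b a)) : E →ₗ[ℝ] ℝ) ∘ₗ Y) = 0 := by
    refine b.ext fun c => ?_
    change B (∑ i, v i • X' i - Y (∑ a, z a • b a)) (Y (b c)) = 0
    have h3 := congrFun hz c
    change ∑ a, B (Y (b c)) (Y (b a)) * z a = ∑ i, B (Y (b c)) (X' i) * v i at h3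
    rw [hBs, map_sub, map_sum, map_sum, map_sum, sub_eq_zero]
    have h4 : ∀ i, B (Y (b c)) (v i • X' i) = B (Y (b c)) (X' i) * v i := fun i => by
      rw [map_smul, smul_eq_mul, mul_comm]
    have h5 : ∀ a, B (Y (b c)) (Y (z a • b a)) = B (Y (b c)) (Y (b a)) * z a := fun a => by
      rw [map_smul, map_smul, smul_eq_mul, mul_comm]
    simp_rw [h4, h5]
    exact h3.symm
  exact congrArg (fun T : GroupLieAlgebra 𝓘(ℝ, EG) G →ₗ[ℝ] ℝ => T η) h2

theorem mechω_of_isQuasiVelocity [FiniteDimensional ℝ EG]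
    (hL : ContMDiff 𝓘(ℝ, E).tangent 𝓘(ℝ, ℝ) ∞ L) (hnons : IsNonsingularOnFundamental EG G L)
    (b : Module.Basis ι ℝ (GroupLieAlgebra 𝓘(ℝ, EG) G)) (h : M → G)
    (X : κ → (m : M) → TangentSpace 𝓘(ℝ, E) m) (u : TangentBundle 𝓘(ℝ, E) M) {w : ι → ℝ}
    {v : κ → ℝ} (hu : IsQuasiVelocity b h X u w v) :
    mechω EG G L u u.snd = ∑ a, (∑ d, adMatrix b (h u.proj) a d * w d
      - ∑ i, mechB L b X u a i * v i) • b a := by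
  let Y : GroupLieAlgebra 𝓘(ℝ, EG) G →ₗ[ℝ] E := (fundL EG G E u.proj : EG →ₗ[ℝ] E)
  let p : ι → E := fun a => hatField b h a u.proj
  have h1 : ∑ a, w a • p a = Y (∑ a, (∑ d, adMatrix b (h u.proj) a d * w d) • b a) := by
    have h2 : ∑ a, (∑ d, adMatrix b (h u.proj) a d * w d) • b a =
        Ad (h u.proj) (∑ d, w d • b d) := by
      rw [← b.sum_repr (Ad (h u.proj) (∑ d, w d • b d))]
      refine Finset.sum_congr rfl fun a _ => ?_
      congr 1
      rw [map_sum, map_sum, Finset.sum_apply']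
      refine Finset.sum_congr rfl fun d _ => ?_
      rw [map_smul, map_smul, adMatrix, LinearMap.toMatrix_apply, mul_comm]
      rfl
    rw [h2, map_sum, map_sum]
    refine Finset.sum_congr rfl fun d _ => ?_
    rw [map_smul, map_smul]
    rfl
  have h3 : u.snd = (∑ i, v i • X i u.proj) +
      fundamentalField (∑ a, (∑ d, adMatrix b (h u.proj) a d * w d) • b a) u.proj := by
    rw [add_comm]
    exact hu.trans (congrArg (fun y : TangentSpace 𝓘(ℝ, E) u.proj => y + ∑ i, v i • X i u.proj) h1)
  rw [h3, mechω_add_fundamentalField hL hnons, mechω_sum_smul hL hnons b, add_comm,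
    ← Finset.sum_add_distrib]
  refine Finset.sum_congr rfl fun a _ => ?_
  rw [← add_smul, sub_eq_add_neg]

end Frames

/-! ### The orbit space of `TM` and the vertical lift of the mechanical connection -/

section TangentOrbits

open Topology Filter

variable {EG : Type*} [NormedAddCommGroup EG] [NormedSpace ℝ EG]
  {G : Type*} [TopologicalSpace G] [ChartedSpace EG G] [Group G]
  {E : Type*} [NormedAddCommGroup E] [NormedSpace ℝ E]
  {M : Type*} [TopologicalSpace M] [ChartedSpace E M] [IsManifold 𝓘(ℝ, E) ∞ M]
  [MulAction G M]
  {L : TangentBundle 𝓘(ℝ, E) M → ℝ}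

theorem orbitProj_eq_iff
    (ha : IsSmoothAction EG 𝓘(ℝ, E).tangent
      (fun (g : G) (u : TangentBundle 𝓘(ℝ, E) M) => tangentAct g u))
    (u v : TangentBundle 𝓘(ℝ, E) M) :
    orbitProj G u = orbitProj G v ↔ ∃ g : G, tangentAct g u = v := by
  refine Equivalence.quot_mk_eq_iff ⟨fun u => ⟨1, ha.one u⟩, ?_, ?_⟩ u v
  · rintro u _ ⟨g, rfl⟩
    exact ⟨g⁻¹, ha.inv_act g u⟩
  · rintro u _ _ ⟨g, rfl⟩ ⟨k, rfl⟩
    exact ⟨k * g, ha.mul k g u⟩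

theorem isOpenMap_orbitProj
    (ha : IsSmoothAction EG 𝓘(ℝ, E).tangent
      (fun (g : G) (u : TangentBundle 𝓘(ℝ, E) M) => tangentAct g u)) :
    IsOpenMap (orbitProj G : TangentBundle 𝓘(ℝ, E) M → TangentOrbitSpace G E M) := by
  intro O hO
  refine isOpen_coinduced.2 ?_
  have h1 : (Quot.mk _ ⁻¹' (orbitProj G '' O) : Set (TangentBundle 𝓘(ℝ, E) M)) =
      ⋃ g : G, (fun u => tangentAct g u) ⁻¹' O := by
    ext u
    simp only [Set.mem_preimage, Set.mem_iUnion]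
    constructor
    · rintro ⟨v, hv, hvu⟩
      obtain ⟨g, hg⟩ := (orbitProj_eq_iff ha u v).1 hvu.symm
      exact ⟨g, hg ▸ hv⟩
    · rintro ⟨g, hg⟩
      exact ⟨_, hg, ((orbitProj_eq_iff ha u _).2 ⟨g, rfl⟩).symm⟩
  refine Eq.mpr (congrArg IsOpen h1) ?_
  exact isOpen_iUnion fun g => hO.preimage (ha.smooth_left g).continuous

theorem eq_zero_of_fundamentalField_eq_zero (hL : ContMDiff 𝓘(ℝ, E).tangent 𝓘(ℝ, ℝ) ∞ L)
    (hnons : IsNonsingularOnFundamental EG G L) (m : M) (ξ : GroupLieAlgebra 𝓘(ℝ, EG) G)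
    (h : (fundamentalField ξ m : TangentSpace 𝓘(ℝ, E) m) = 0) : ξ = 0 := by
  refine hnons ⟨m, 0⟩ ξ fun η => ?_
  obtain ⟨B, hB, -⟩ := exists_hessian_eq_bilin hL (⟨m, 0⟩ : TangentBundle 𝓘(ℝ, E) M)
  refine (hB (fundamentalField ξ m) (fundamentalField η m)).trans ?_
  have h1 : B (fundamentalField ξ m) = B 0 := congrArg B h
  rw [h1, map_zero]
  rfl

theorem mechΩ_eulerLagrange {Γ : (u : TangentBundle 𝓘(ℝ, E) M) → TangentSpace 𝓘(ℝ, E).tangent u}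
    (hΓ : IsEulerLagrangeField L Γ) (u : TangentBundle 𝓘(ℝ, E) M) :
    mechΩ EG G L u (Γ u) = mechω EG G L u u.snd :=
  congrArg (mechω EG G L u) (hΓ.second_order u)

variable [LieGroup 𝓘(ℝ, EG) ∞ G] [ContMDiffSMul 𝓘(ℝ, EG) 𝓘(ℝ, E) ∞ G M]

theorem isLocallyTrivialAction_tangentAct [FiniteDimensional ℝ EG] [FiniteDimensional ℝ E]
    [T2Space G] [T2Space M] [ProperSMul G M]
    (hfree : ∀ (g : G) (m : M), g • m = m → g = 1)
    (hL : ContMDiff 𝓘(ℝ, E).tangent 𝓘(ℝ, ℝ) ∞ L) (hnons : IsNonsingularOnFundamental EG G L) :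
    IsLocallyTrivialAction EG 𝓘(ℝ, E).tangent
      (fun (g : G) (u : TangentBundle 𝓘(ℝ, E) M) => tangentAct g u) := by
  intro u₀
  obtain ⟨W, h, hW, hmW, hinv, hh, heq⟩ := exists_equivariant_map (EG := EG) (G := G) (E := E)
    hfree u₀.proj fun ξ => eq_zero_of_fundamentalField_eq_zero hL hnons _ ξ
  have hp : ContMDiff 𝓘(ℝ, E).tangent 𝓘(ℝ, E) ∞
      (fun u : TangentBundle 𝓘(ℝ, E) M => u.proj) :=
    Bundle.contMDiff_proj (TangentSpace 𝓘(ℝ, E) : M → Type _)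
  exact ⟨(fun u => u.proj) ⁻¹' W, fun u => h u.proj, hW.preimage hp.continuous, hmW,
    fun g u hu => hinv g u.proj hu, hh.comp hp.contMDiffOn (fun u hu => hu),
    fun g u hu => heq g u.proj hu⟩

theorem isConnectionForm_mechΩ [FiniteDimensional ℝ EG]
    (hL : ContMDiff 𝓘(ℝ, E).tangent 𝓘(ℝ, ℝ) ∞ L) (hnons : IsNonsingularOnFundamental EG G L)
    (hinv : ∀ (g : G) (u : TangentBundle 𝓘(ℝ, E) M), L (tangentAct g u) = L u) :
    IsConnectionForm EG 𝓘(ℝ, E).tangent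
      (fun (g : G) (u : TangentBundle 𝓘(ℝ, E) M) => tangentAct g u) (mechΩ EG G L) where
  add_infGen u W ξ := by
    have h1 := map_add (mfderiv 𝓘(ℝ, E).tangent 𝓘(ℝ, E)
      (fun x : TangentBundle 𝓘(ℝ, E) M => x.proj) u) W
      (infGen EG 𝓘(ℝ, E).tangent (fun (g : G) (u : TangentBundle 𝓘(ℝ, E) M) => tangentAct g u) u ξ)
    have h2 := mfderiv_proj_infGen (EG := EG) (G := G) u ξ
    unfold mechΩ
    rw [h1, ← mechω_add_fundamentalField hL hnons, ← h2]
  equivariant g u W := by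
    have h1 := mfderiv_proj_tangentAct
      (isSmoothAction_smul (EG := EG) (G := G) (E := E) (M := M)) g u W
    refine Eq.trans ?_ (mechω_tangentAct hL hnons hinv g u _)
    exact congrArg (fun w : E => mechω EG G L (tangentAct g u) w) h1

end TangentOrbits

end Reconstruction

end

theorem mainTheorem4
    {EG : Type*} [NormedAddCommGroup EG] [NormedSpace ℝ EG] [FiniteDimensional ℝ EG]
    {G : Type*} [TopologicalSpace G] [ChartedSpace EG G] [Group G] [LieGroup 𝓘(ℝ, EG) ∞ G]
    [T2Space G]
    {E : Type*} [NormedAddCommGroup E] [NormedSpace ℝ E] [FiniteDimensional ℝ E]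
    {M : Type*} [TopologicalSpace M] [ChartedSpace E M] [IsManifold 𝓘(ℝ, E) ∞ M] [T2Space M]
    [MulAction G M] [ContMDiffSMul 𝓘(ℝ, EG) 𝓘(ℝ, E) ∞ G M] [ProperSMul G M]
    (hfree : ∀ (g : G) (m : M), g • m = m → g = 1)
    (L : TangentBundle 𝓘(ℝ, E) M → ℝ)
    (hL : ContMDiff 𝓘(ℝ, E).tangent 𝓘(ℝ, ℝ) ∞ L)
    (hreg : Reconstruction.IsRegular L)
    (hinv : ∀ (g : G) (u : TangentBundle 𝓘(ℝ, E) M), L (Reconstruction.tangentAct g u) = L u)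
    (hnons : Reconstruction.IsNonsingularOnFundamental EG G L)
    (Γ : (u : TangentBundle 𝓘(ℝ, E) M) → TangentSpace 𝓘(ℝ, E).tangent u)
    (hΓ : Reconstruction.IsEulerLagrangeField L Γ) :
    -- the field `Γ` is invariant, so that its reduced field on `TM/G` is well defined
    (∀ (g : G) (u : TangentBundle 𝓘(ℝ, E) M),
      mfderiv 𝓘(ℝ, E).tangent 𝓘(ℝ, E).tangent
        (fun x : TangentBundle 𝓘(ℝ, E) M => Reconstruction.tangentAct g x) u (Γ u) =
          Γ (Reconstruction.tangentAct g u)) ∧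
    ∀ (J : Set ℝ), IsOpen J → J.OrdConnected → (0 : ℝ) ∈ J →
    ∀ (v₀ : TangentBundle 𝓘(ℝ, E) M) (c : ℝ → Reconstruction.TangentOrbitSpace G E M),
      c 0 = Reconstruction.orbitProj G v₀ →
      Reconstruction.IsReducedIntegralCurveOn Γ c J →
      -- there is a unique horizontal lift `vh` through `v₀`
      ∃ vh : ℝ → TangentBundle 𝓘(ℝ, E) M,
        Reconstruction.IsMechHorizontalLift EG L c J v₀ vh ∧
        (∀ vh' : ℝ → TangentBundle 𝓘(ℝ, E) M,
          Reconstruction.IsMechHorizontalLift EG L c J v₀ vh' → Set.EqOn vh' vh J) ∧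
        -- the reconstruction equation has a unique solution `g`, and `g(t) • vh(t)` is the
        -- integral curve of `Γ` through `v₀`
        (∃ g : ℝ → G,
          Reconstruction.SolvesMaurerCartan (EG := EG) J
            (fun t => Reconstruction.mechΩ EG G L (vh t) (Γ (vh t))) g ∧
          (∀ g' : ℝ → G, Reconstruction.SolvesMaurerCartan (EG := EG) J
            (fun t => Reconstruction.mechΩ EG G L (vh t) (Γ (vh t))) g' → Set.EqOn g' g J) ∧
          Reconstruction.tangentAct (g 0) (vh 0) = v₀ ∧
          IsMIntegralCurveOn (fun t => Reconstruction.tangentAct (g t) (vh t)) Γ J ∧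
          (∀ v : ℝ → TangentBundle 𝓘(ℝ, E) M, v 0 = v₀ → IsMIntegralCurveOn v Γ J →
            Set.EqOn v (fun t => Reconstruction.tangentAct (g t) (vh t)) J)) ∧
        -- for a curve `g` in `G` with `g(0) = e`, the reconstruction equation characterizes the
        -- property that `g(t) • vh(t)` is an integral curve of `Γ`
        (∀ g : ℝ → G, g 0 = 1 →
          (Reconstruction.SolvesMaurerCartan (EG := EG) J
              (fun t => Reconstruction.mechΩ EG G L (vh t) (Γ (vh t))) g ↔
            IsMIntegralCurveOn (fun t => Reconstruction.tangentAct (g t) (vh t)) Γ J)) ∧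
        -- in an adapted frame, the right-hand side of the reconstruction equation is
        -- `(A^a_b w^b - B^a_i v^i) E_a`, where `w`, `v` are the quasi-velocities of `c(t)`, that
        -- is, of any point `u` of `TM` over `c(t)`
        (∀ {ι κ : Type} [Fintype ι] [DecidableEq ι] [Fintype κ]
          (b : Module.Basis ι ℝ (GroupLieAlgebra 𝓘(ℝ, EG) G)) (W : Set M) (h : M → G)
          (X : κ → (m : M) → TangentSpace 𝓘(ℝ, E) m),
          Reconstruction.IsAdaptedFrame b W h X →
          ∀ t ∈ J, (vh t).proj ∈ W →
          ∀ (u : TangentBundle 𝓘(ℝ, E) M), Reconstruction.orbitProj G u = c t →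
          ∀ (w : ι → ℝ) (v : κ → ℝ), Reconstruction.IsQuasiVelocity b h X u w v →
            Reconstruction.mechΩ EG G L (vh t) (Γ (vh t)) =
              ∑ a, (∑ d, Reconstruction.adMatrix b (h (vh t).proj) a d * w d
                - ∑ i, Reconstruction.mechB L b X (vh t) a i * v i) • b a) := by
  have ha := Reconstruction.isSmoothAction_tangentAct (EG := EG) (G := G) (E := E) (M := M)
  have hΓinv := Reconstruction.eulerLagrangeField_invariant hL hreg
    (Reconstruction.isSmoothAction_smul (EG := EG) (G := G) (E := E) (M := M)) hinv hΓ
  refine ⟨hΓinv, ?_⟩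
  intro J hJ hJc h0J v₀ c hc0 hc
  have hΩ := Reconstruction.isConnectionForm_mechΩ (EG := EG) (G := G) hL hnons hinv
  have hT := Reconstruction.isLocallyTrivialAction_tangentAct (EG := EG) (G := G) hfree hL hnons
  have hpi := Reconstruction.orbitProj_eq_iff ha
  have hfreeT : ∀ (g : G) (u : TangentBundle 𝓘(ℝ, E) M),
      Reconstruction.tangentAct g u = u → g = 1 :=
    fun g u h => hfree g u.proj (congrArg (fun x : TangentBundle 𝓘(ℝ, E) M => x.proj) h)
  have hcanc : ∀ (g k : G) (u : TangentBundle 𝓘(ℝ, E) M),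
      Reconstruction.tangentAct g u = Reconstruction.tangentAct k u → g = k := by
    intro g k u h
    refine inv_mul_eq_one.1 (hfreeT (k⁻¹ * g) u ?_) |>.symm
    rw [ha.mul, h, ha.inv_act]
  -- lifts of `c` to integral curves of a field which is vertically equivalent to `Γ`
  have hlift : ∀ Z : (u : TangentBundle 𝓘(ℝ, E) M) → TangentSpace 𝓘(ℝ, E).tangent u,
      ContMDiff 𝓘(ℝ, E).tangent 𝓘(ℝ, E).tangent.tangent ∞
        (fun u => (⟨u, Z u⟩ : TangentBundle 𝓘(ℝ, E).tangent (TangentBundle 𝓘(ℝ, E) M))) →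
      (∀ (g : G) u, (mfderiv 𝓘(ℝ, E).tangent 𝓘(ℝ, E).tangent
        (fun x : TangentBundle 𝓘(ℝ, E) M => Reconstruction.tangentAct g x) u (Z u) : E × E) =
          Z (Reconstruction.tangentAct g u)) →
      (∀ u, ∃ ξ, Z u = Γ u + Reconstruction.infGen EG 𝓘(ℝ, E).tangent
        (fun (g : G) (u : TangentBundle 𝓘(ℝ, E) M) => Reconstruction.tangentAct g u) u ξ) →
      ∃ γ : ℝ → TangentBundle 𝓘(ℝ, E) M, γ 0 = v₀ ∧ IsMIntegralCurveOn γ Z J ∧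
        ∀ t ∈ J, Reconstruction.orbitProj G (γ t) = c t := by
    intro Z hZ hZinv hZΓ
    refine ha.exists_lift hpi hZ hZinv hJ hJc h0J hc0.symm fun t₀ ht₀ => ?_
    obtain ⟨u₀, hu₀⟩ := Quot.exists_rep (c t₀)
    obtain ⟨O, h, hO, huO, hOinv, hh, heq⟩ := hT u₀
    obtain ⟨γ, -, h1, h2⟩ := ha.exists_local_lift hpi Quot.mk_surjective
      (Reconstruction.isOpenMap_orbitProj ha) hΓ.smooth hΓinv hZ hZΓ
      (hc.1.continuousAt (hJ.mem_nhds ht₀))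
      (Filter.eventually_of_mem (hJ.mem_nhds ht₀) fun t ht u hu U f => hc.2 t ht u hu U f)
      hu₀ hO hOinv hh heq huO
    exact ⟨γ, h1, h2⟩
  -- the integral curve of `Γ`
  obtain ⟨v, hv0, hv, hvc⟩ := hlift Γ hΓ.smooth hΓinv fun u => ⟨0, by rw [map_zero, add_zero]⟩
  -- the horizontal lift, an integral curve of the horizontal part of `Γ`
  set Z := Reconstruction.horField EG 𝓘(ℝ, E).tangent
    (fun (g : G) (u : TangentBundle 𝓘(ℝ, E) M) => Reconstruction.tangentAct g u)
    (Reconstruction.mechΩ EG G L) Γ with hZdef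
  have hZs := Reconstruction.contMDiff_horField (Ω := Reconstruction.mechΩ EG G L) ha hΓ.smooth
    (Reconstruction.contMDiff_mechωSelf (EG := EG) (G := G) hL hnons)
    (Reconstruction.mechΩ_eulerLagrange hΓ)
  obtain ⟨vh, hvh0, hvh, hvhc⟩ := hlift Z hZs (hΩ.mfderiv_horField ha hΓinv)
    fun u => ⟨-Reconstruction.mechΩ EG G L u (Γ u), by
      rw [map_neg, ← sub_eq_add_neg]; rfl⟩
  have hvd : ∀ t ∈ J, HasMFDerivAt 𝓘(ℝ, ℝ) 𝓘(ℝ, E).tangent v t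
      ((1 : ℝ →L[ℝ] ℝ).smulRight (Γ (v t))) := fun t ht => (hv t ht).hasMFDerivAt (hJ.mem_nhds ht)
  have hvhd : ∀ t ∈ J, HasMFDerivAt 𝓘(ℝ, ℝ) 𝓘(ℝ, E).tangent vh t
      ((1 : ℝ →L[ℝ] ℝ).smulRight (Z (vh t))) := fun t ht => (hvh t ht).hasMFDerivAt (hJ.mem_nhds ht)
  have hhor : ∀ t ∈ J, Reconstruction.mechΩ EG G L (vh t)
      (mfderiv 𝓘(ℝ, ℝ) 𝓘(ℝ, E).tangent vh t (1 : ℝ)) = 0 := by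
    intro t ht
    refine Eq.trans ?_ (hΩ.apply_horField (Γ := Γ) (vh t))
    refine Reconstruction.connection_congr (F := E × E) rfl ?_
    rw [(hvhd t ht).mfderiv]
    exact one_smul ℝ (Z (vh t) : E × E)
  have hMC_int : ∀ g : ℝ → G, Reconstruction.SolvesMaurerCartan (EG := EG) J
      (fun t => Reconstruction.mechΩ EG G L (vh t) (Γ (vh t))) g →
      IsMIntegralCurveOn (fun t => Reconstruction.tangentAct (g t) (vh t)) Γ J :=
    fun g hg t ht => (ha.hasMFDerivAt_of_maurerCartan hΓinv (hg.differentiable t ht) (hvhd t ht)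
      (hg.equation t ht)).hasMFDerivWithinAt
  have hint_MC : ∀ g : ℝ → G, g 0 = 1 →
      IsMIntegralCurveOn (fun t => Reconstruction.tangentAct (g t) (vh t)) Γ J →
      Reconstruction.SolvesMaurerCartan (EG := EG) J
        (fun t => Reconstruction.mechΩ EG G L (vh t) (Γ (vh t))) g := by
    intro g hg0 hg
    have hgd : ∀ t ∈ J, MDifferentiableAt 𝓘(ℝ, ℝ) 𝓘(ℝ, EG) g t := fun t ht =>
      hT.mdifferentiableAt (hvhd t ht).mdifferentiableAt
        ((hg t ht).hasMFDerivAt (hJ.mem_nhds ht)).mdifferentiableAt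
        (Filter.Eventually.of_forall fun _ => rfl)
    exact ⟨hg0, hgd, fun t ht => hΩ.maurerCartan_eq ha hΓinv (hgd t ht)
      (hvhd t ht).mdifferentiableAt (hhor t ht) ((hg t ht).hasMFDerivAt (hJ.mem_nhds ht))⟩
  refine ⟨vh, ⟨hvh0, hvhc, fun t ht => (hvhd t ht).mdifferentiableAt, hhor⟩, ?_, ?_, ?_, ?_⟩
  · intro vh' hvh'
    exact hΩ.eqOn_of_horizontal ha hfreeT hT hJ hJc (fun t ht => (hvhd t ht).mdifferentiableAt)
      hvh'.differentiable hhor hvh'.horizontal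
      (fun t ht => (hpi _ _).1 ((hvhc t ht).trans (hvh'.proj t ht).symm)) h0J
      (hvh0.trans hvh'.initial.symm)
  · have hex : ∀ t ∈ J, ∃ g : G, Reconstruction.tangentAct g (vh t) = v t := fun t ht =>
      (hpi _ _).1 ((hvhc t ht).trans (hvc t ht).symm)
    choose! g hg using hex
    have hg0 : g 0 = 1 := hfreeT _ (vh 0) ((hg 0 h0J).trans (hv0.trans hvh0.symm))
    have hgint : IsMIntegralCurveOn (fun t => Reconstruction.tangentAct (g t) (vh t)) Γ J := by
      intro t ht
      have h1 : (fun t => Reconstruction.tangentAct (g t) (vh t)) =ᶠ[nhds t] v :=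
        Filter.eventually_of_mem (hJ.mem_nhds ht) hg
      have h2 := (hvd t ht).congr_of_eventuallyEq h1
      rw [← hg t ht] at h2
      exact h2.hasMFDerivWithinAt
    have hact0 : Reconstruction.tangentAct (g 0) (vh 0) = v₀ := by rw [hg0, hvh0, ha.one]
    have huniq : ∀ w : ℝ → TangentBundle 𝓘(ℝ, E) M, w 0 = v₀ → IsMIntegralCurveOn w Γ J →
        Set.EqOn w (fun t => Reconstruction.tangentAct (g t) (vh t)) J := fun w hw0 hw =>
      Reconstruction.eqOn_of_isMIntegralCurveOn hΓ.smooth hJ hJc hw hgint h0J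
        (hw0.trans hact0.symm)
    refine ⟨g, hint_MC g hg0 hgint, fun g' hg' t ht => ?_, hact0, hgint, huniq⟩
    exact hcanc _ _ (vh t) (huniq _ (by rw [hg'.initial, hvh0, ha.one]) (hMC_int g' hg') ht)
  · exact fun g hg0 => ⟨hMC_int g, hint_MC g hg0⟩
  · intro ι κ _ _ _ b W h X hX t ht htW u hu w v hq
    obtain ⟨k, hk⟩ := (hpi u (vh t)).1 (hu.trans (hvhc t ht).symm)
    have huW : u.proj ∈ W := by
      have h1 : u = Reconstruction.tangentAct k⁻¹ (vh t) := by rw [← hk, ha.inv_act]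
      rw [h1]
      exact hX.invariant k⁻¹ _ htW
    have hq' := hq.tangentAct hX k huW
    rw [hk] at hq'
    rw [Reconstruction.mechΩ_eulerLagrange hΓ,
      Reconstruction.mechω_of_isQuasiVelocity hL hnons b h X (vh t) hq']
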